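/- For every constant $\eta_0<1/2$ there are a randomized algorithm and constants $A,B\in\mathbb R$ and $c\in\mathbb N$, depending only on $\eta_0$, with the following property. Let $n$, $k\ge 1$ be integers and $0<\eta\le\eta_0$ a real number with $n>k/\eta$. In the $(n,k,\eta)$-LSPN problem (learning sparse parity with noise), there is an unknown $\mathbf{secret}\in\mathbf F_2^n$ of Hamming weight at most $k$, and each sample is an independent pair $(x,\langle x,\mathbf{secret}\rangle+e)$ with $x$ uniform in $\mathbf F_2^n$ and $e\in\mathbf F_2$ an independent Bernoulli noise with $\Pr[e=1]=\eta$. Given random access to $$m=\Big\lceil B\Big(\frac k\eta+k\log\frac nk\Big)\Big\rceil$$ samples and the integers $n$, $k$, $\lceil k/\eta\rceil$ and $m$, the algorithm always halts within $$T\le\Big(\frac k\eta\Big)^{c}\Big(A\,\frac{\eta n}{k}\Big)^{k}$$ steps, and for every such $\mathbf{secret}$ it outputs $\mathbf{secret}$ with probability at least $0.9$ over the samples and its own random choices. The algorithm is a single program, the same for all $n,k,\eta$, on a randomized word RAM with words of $O_{\eta_0}(\log n)$ bits, in which arithmetic on words, comparisons, memory access, reading one bit of a sample, and drawing a uniformly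 random element of $\{0,\dots,v-1\}$ for a word $v$ each cost one step. -/

import Mathlib

open scoped ENNReal

/-! ### The problem -/

namespace LSPN

/-- Bernoulli noise in `𝔽₂`: equal to `1` with probability `η` and to `0` otherwise. -/
noncomputable def noise (η : ℝ) (hη : η ∈ Set.Icc (0 : ℝ) 1) : PMF (ZMod 2) :=
  PMF.ofFintype (fun e => if e = 1 then ENNReal.ofReal η else ENNReal.ofReal (1 - η)) (by
    have h : ∀ f : ZMod 2 → ℝ≥0∞, ∑ e, f e = f 0 + f 1 := fun f => Fin.sum_univ_two f
    rw [h, if_neg (by decide), if_pos rfl, ← ENNReal.ofReal_add (by linarith [hη.2]) hη.1]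
    simp)

/-- One sample `(x, ⟨x, secret⟩ + e)`, with `x` uniform in `𝔽₂ⁿ` and `e` independent noise. -/
noncomputable def sample {n : ℕ} (η : ℝ) (hη : η ∈ Set.Icc (0 : ℝ) 1) (secret : Fin n → ZMod 2) :
    PMF ((Fin n → ZMod 2) × ZMod 2) :=
  (PMF.uniformOfFintype (Fin n → ZMod 2)).bind fun x =>
    (noise η hη).map fun e => (x, x ⬝ᵥ secret + e)

/-- The law of `m` independent draws from `p`. -/
noncomputable def iid {α : Type*} [Fintype α] (p : PMF α) (m : ℕ) : PMF (Fin m → α) :=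
  PMF.ofFintype (fun f => ∏ i, p (f i)) (by
    classical
    have h : ∑ a, p a = 1 := by rw [← tsum_fintype (L := .unconditional _)]; exact p.tsum_coe
    rw [← Fintype.piFinset_univ, ← Finset.prod_univ_sum]
    simp [h])

/-- `m` labelled vectors of `𝔽₂ⁿ`: the read-only input of a program. -/
abbrev Data (n m : ℕ) : Type := Fin m → (Fin n → ZMod 2) × ZMod 2

/-! ### Randomized word RAM programs -/

/-- Arithmetic of natural numbers: subtraction is truncated, `x / 0 = 0` and `x % 0 = x`. -/
inductive BinOp : Type
  | add | sub | mul | div | mod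

def BinOp.eval : BinOp → ℕ → ℕ → ℕ
  | .add, x, y => x + y
  | .sub, x, y => x - y
  | .mul, x, y => x * y
  | .div, x, y => x / y
  | .mod, x, y => x % y

/-- Programs. The arguments called `r`, `a`, `b`, `i`, `j` are names of registers. -/
inductive Prog : Type
  /-- `r ← v`, for a constant `v`. -/
  | const (r v : ℕ)
  /-- `r ← a ∘ b`. -/
  | op (o : BinOp) (r a b : ℕ)
  /-- `r ← mem[a]`. -/
  | load (r a : ℕ)
  /-- `mem[a] ← r`. -/
  | store (a r : ℕ)
  /-- `r ←` coordinate number `j` of the vector of sample number `i`. -/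
  | readX (r i j : ℕ)
  /-- `r ←` the label of sample number `i`. -/
  | readY (r i : ℕ)
  /-- `r ←` a fresh uniformly random element of `{0, …, a - 1}`. -/
  | rand (r a : ℕ)
  /-- Do nothing. -/
  | skip
  /-- Run `p`, then `q`. -/
  | seq (p q : Prog)
  /-- If `a < b` then run `p`, else run `q`. -/
  | branch (a b : ℕ) (p q : Prog)
  /-- While `a < b`, run `p`. -/
  | loop (a b : ℕ) (p : Prog)

/-- Contents of the registers and of the random access working memory. -/
structure Store : Type where
  reg : ℕ → ℕ
  mem : ℕ → ℕ

/-- Write `v` to register `r`, reduced to a word of `w` bits. -/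
def Store.setReg (w : ℕ) (s : Store) (r v : ℕ) : Store :=
  { s with reg := Function.update s.reg r (v % 2 ^ w) }

/-- Write `v` to memory cell `a`, reduced to a word of `w` bits. -/
def Store.setMem (w : ℕ) (s : Store) (a v : ℕ) : Store :=
  { s with mem := Function.update s.mem a (v % 2 ^ w) }

/-- Bit `j` of the vector of sample `i`; reads out of range return `0`. -/
def Data.bitX {n m : ℕ} (D : Data n m) (i j : ℕ) : ℕ :=
  if h : i < m ∧ j < n then ((D ⟨i, h.1⟩).1 ⟨j, h.2⟩).val else 0

/-- The label of sample `i`; reads out of range return `0`. -/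
def Data.bitY {n m : ℕ} (D : Data n m) (i : ℕ) : ℕ :=
  if h : i < m then (D ⟨i, h⟩).2.val else 0

/-- The programs still to be run, in this order, and the current store. -/
abbrev Config : Type := List Prog × Store

/-- One step, of unit cost, of a machine with words of `w` bits. A machine that has nothing left to
run has halted and stays as it is. In `rand`, the range `{0, …, v - 1}` is read as `{0}` if
`v = 0`. -/
noncomputable def step {n m : ℕ} (w : ℕ) (D : Data n m) : Config → PMF Config
  | ([], s) => PMF.pure ([], s)
  | (.const r v :: l, s) => PMF.pure (l, s.setReg w r v)
  | (.op o r a b :: l, s) => PMF.pure (l, s.setReg w r (o.eval (s.reg a) (s.reg b)))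
  | (.load r a :: l, s) => PMF.pure (l, s.setReg w r (s.mem (s.reg a)))
  | (.store a r :: l, s) => PMF.pure (l, s.setMem w (s.reg a) (s.reg r))
  | (.readX r i j :: l, s) => PMF.pure (l, s.setReg w r (D.bitX (s.reg i) (s.reg j)))
  | (.readY r i :: l, s) => PMF.pure (l, s.setReg w r (D.bitY (s.reg i)))
  | (.rand r a :: l, s) =>
      (PMF.uniformOfFintype (Fin (s.reg a - 1 + 1))).map fun u => (l, s.setReg w r u)
  | (.skip :: l, s) => PMF.pure (l, s)
  | (.seq p q :: l, s) => PMF.pure (p :: q :: l, s)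
  | (.branch a b p q :: l, s) =>
      PMF.pure (if s.reg a < s.reg b then (p :: l, s) else (q :: l, s))
  | (.loop a b p :: l, s) =>
      PMF.pure (if s.reg a < s.reg b then (p :: .loop a b p :: l, s) else (l, s))

/-- The law of the configuration after `t` steps. -/
noncomputable def run {n m : ℕ} (w : ℕ) (D : Data n m) : ℕ → Config → PMF Config
  | 0, c => PMF.pure c
  | t + 1, c => (step w D c).bind (run w D t)

def Halted (c : Config) : Prop := c.1 = []

/-- The output is the contents of the memory cells `0, …, n - 1`. -/
def Outputs {n : ℕ} (c : Config) (v : Fin n → ZMod 2) : Prop :=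
  ∀ j : Fin n, c.2.mem j = (v j).val

/-- The program `P` about to start with the numbers `n, k, s, m` in the registers `0, 1, 2, 3`;
all other registers and all memory cells are `0`. -/
def start (w : ℕ) (P : Prog) (n k s m : ℕ) : Config :=
  ([P], ((((⟨fun _ => 0, fun _ => 0⟩ : Store).setReg w 0 n).setReg w 1 k).setReg w 2 s).setReg w 3 m)

/-- With words of `w` bits and `m` samples, `P` solves the `(n, k, η)`-LSPN problem in time `T` with
probability `δ`. The program halts within `T` steps on all samples and all random choices, and for
each secret of Hamming weight at most `k`, it outputs the secret with probability at least `δ` over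
the samples and its random choices. It is told `n`, `k`, `m` and, as the only information on the
noise rate, the integer `⌈k / η⌉`. -/
def Solves (P : Prog) (w n k : ℕ) (η : ℝ) (hη : η ∈ Set.Icc (0 : ℝ) 1) (m T : ℕ) (δ : ℝ≥0∞) :
    Prop :=
  (∀ D : Data n m, ∀ c ∈ (run w D T (start w P n k ⌈k / η⌉₊ m)).support, Halted c) ∧
  ∀ secret : Fin n → ZMod 2, hammingNorm secret ≤ k →
    δ ≤ ((iid (sample η hη secret) m).bind fun D =>
      run w D T (start w P n k ⌈k / η⌉₊ m)).toOuterMeasure {c | Outputs c secret}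

end LSPN

/-!
# Learning sparse parities with noise

The program looks for the secret by guessing a small set of coordinates that contains its support,
and a few samples that are free of noise. Put `s = ⌈k / η⌉`, and cut the coordinates into `Q`
blocks of size `g ≈ s / k`, so that `Q` is of the order of `n k / s`. Some `k` blocks contain the
support of the secret, and `k` random blocks are these with probability at least
`k! / Q ^ k ≥ (c s / n) ^ k`. The chosen blocks have only `K ≤ 2 s` coordinates, hence
`r = 7 (K + 1)` random noiseless samples determine the secret by elimination; and `r` samples drawn
from the first `m1 = 200 s` ones are all noiseless with probability at least
`(1 - 3 η / 2) ^ r ≥ exp (-c k)`, since `η s` is of the order of `k`. So a single proposal is the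
secret with probability at least `h = (c s / n) ^ k`, for some constant `c` (`hit_lower`,
`hit_bound`). This needs two properties of the first `m1` samples, which they have with high
probability (`ex_noisy_le`, `ex_cleanCount_le`): at most `3 η m1 / 2` of them are noisy, and no
nonzero vector supported on the right blocks is orthogonal to more than `9 / 10` of the others.

A proposed vector `v` is tested on the remaining samples, one after the other. A sample disagrees
with the secret with probability `η ≤ η₀`, and with a wrong vector with probability `1 / 2`. Fix a
threshold `p / q` strictly between `η₀` and `1 / 2`, and reject `v` as soon as more than
`(C + p l) / q` of the first `l` samples of the test disagree. By exponential moments the secret is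
seldom ever rejected (`ex_not_alive_le`). Proposals depend on the first `m1` samples only, so a
wrong one passes `l` tests with probability exponentially small in `l` (`ex_alive_le`). Hence it
costs a bounded expected number of tests, and as `m - m1` is a large multiple of
`k / η + k log (n / k)`, the probability to accept it is small even compared with `h`
(`ex_wrongCost_le`, `wrong_accept_le`). No union bound over the `Q ^ k` choices of blocks is needed.

For fixed samples the search is a Markov chain whose steps are proposals and single tests. A
potential function bounds the expected number of steps before the secret is accepted, by
`(2 + wrongCost) / h + (m - m1)`, where acceptance of a wrong vector counts as all available steps
(`Par.succ_bound`). A counter with `k` digits to a base proportional to `⌊n / s⌋` stops the search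
after `s (a ⌊n / s⌋) ^ k` steps. For large `a` this exceeds the bound by a large factor, while the
running time stays below `(k / η) ^ 23 (a η n / k) ^ k`. Note that `s ⌊n / s⌋ ≤ n`, which is what
keeps the parameters of a run, the number of samples included, linear in `n`, so that words of
`O (log n)` bits suffice.
-/

namespace LSPN

/-! ### Big-step semantics of programs -/

section Semantics
variable {n m : ℕ} (w : ℕ) (D : Data n m)

theorem run_nil (T : ℕ) (s : Store) : run w D T ([], s) = PMF.pure ([], s) := by
  induction T with
  | zero => rfl
  | succ T ih => simp [run, step, ih]

/-- Configuration `c` halts within `t` steps, and `μ` is the law of the final store. -/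
def Ends (c : Config) (t : ℕ) (μ : PMF Store) : Prop :=
  ∀ T, t ≤ T → run w D T c = μ.map fun s => ([], s)

/-- Big-step semantics in continuation-passing form: started on the store `s`, the program `P`
finishes within `t` steps, and `μ` is the law of the store it leaves. Since `t` is only an upper
bound, the number of steps may depend on the random choices. -/
def Tri (P : Prog) (s : Store) (t : ℕ) (μ : PMF Store) : Prop :=
  ∀ (l : List Prog) (t' : ℕ) (ν : Store → PMF Store),
    (∀ s' ∈ μ.support, Ends w D (l, s') t' (ν s')) → Ends w D (P :: l, s) (t + t') (μ.bind ν)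

/-- `Tri` for a run whose final store does not depend on the random choices. -/
def TriD (P : Prog) (s : Store) (t : ℕ) (s' : Store) : Prop :=
  Tri w D P s t (PMF.pure s')

variable {w D}

theorem Ends.mono {c : Config} {t t' : ℕ} {μ : PMF Store} (h : Ends w D c t μ) (ht : t ≤ t') :
    Ends w D c t' μ := fun T hT => h T (ht.trans hT)

theorem Tri.mono {P : Prog} {s : Store} {t t' : ℕ} {μ : PMF Store} (h : Tri w D P s t μ)
    (ht : t ≤ t') : Tri w D P s t' μ := fun l t'' ν hν =>
  (h l t'' ν hν).mono (by omega)

theorem TriD.mono {P : Prog} {s s' : Store} {t t' : ℕ} (h : TriD w D P s t s')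
    (ht : t ≤ t') : TriD w D P s t' s' := Tri.mono h ht

theorem Ends.of_step {c c' : Config} {t : ℕ} {μ : PMF Store} (hc : step w D c = PMF.pure c')
    (h : Ends w D c' t μ) : Ends w D c (1 + t) μ := by
  intro T hT
  obtain ⟨T, rfl⟩ : ∃ T', T = T' + 1 := ⟨T - 1, by omega⟩
  rw [run, hc, PMF.pure_bind]
  exact h T (by omega)

theorem TriD.of_step {P : Prog} {s s' : Store}
    (h : ∀ l, step w D (P :: l, s) = PMF.pure (l, s')) : TriD w D P s 1 s' := by
  intro l t' ν hν
  rw [PMF.pure_bind]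
  exact Ends.of_step (h l) (hν s' (by simp))

theorem Tri.seq {P Q : Prog} {s : Store} {t t' : ℕ} {μ : PMF Store} {ν : Store → PMF Store}
    (hP : Tri w D P s t μ) (hQ : ∀ s' ∈ μ.support, Tri w D Q s' t' (ν s')) :
    Tri w D (.seq P Q) s (1 + t + t') (μ.bind ν) := by
  intro l t'' κ hκ
  rw [add_assoc, add_assoc, PMF.bind_bind]
  refine Ends.of_step (c' := (P :: Q :: l, s)) rfl ?_
  refine hP _ _ _ fun s' hs' => hQ s' hs' _ _ _ fun s'' hs'' => hκ s'' ?_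
  rw [PMF.mem_support_bind_iff]
  exact ⟨s', hs', hs''⟩

theorem TriD.seq {P Q : Prog} {s s' s'' : Store} {t t' : ℕ}
    (hP : TriD w D P s t s') (hQ : TriD w D Q s' t' s'') :
    TriD w D (.seq P Q) s (1 + t + t') s'' := by
  have := Tri.seq (ν := fun _ => PMF.pure s'') hP (t' := t') (Q := Q) (by
    intro x hx
    obtain rfl : x = s' := by simpa using hx
    exact hQ)
  rwa [PMF.pure_bind] at this

theorem TriD.seqTri {P Q : Prog} {s s' : Store} {t t' : ℕ} {μ : PMF Store}
    (hP : TriD w D P s t s') (hQ : Tri w D Q s' t' μ) :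
    Tri w D (.seq P Q) s (1 + t + t') μ := by
  have := Tri.seq (ν := fun _ => μ) hP (t' := t') (Q := Q) (by
    intro x hx
    obtain rfl : x = s' := by simpa using hx
    exact hQ)
  rwa [PMF.pure_bind] at this

theorem Tri.branch_pos {a b : ℕ} {P Q : Prog} {s : Store} {t : ℕ} {μ : PMF Store}
    (hab : s.reg a < s.reg b) (hP : Tri w D P s t μ) :
    Tri w D (.branch a b P Q) s (1 + t) μ := by
  intro l t' ν hν
  rw [add_assoc]
  refine Ends.of_step (c' := (P :: l, s)) ?_ (hP l t' ν hν)
  simp [step, hab]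

theorem Tri.branch_neg {a b : ℕ} {P Q : Prog} {s : Store} {t : ℕ} {μ : PMF Store}
    (hab : ¬ s.reg a < s.reg b) (hQ : Tri w D Q s t μ) :
    Tri w D (.branch a b P Q) s (1 + t) μ := by
  intro l t' ν hν
  rw [add_assoc]
  refine Ends.of_step (c' := (Q :: l, s)) ?_ (hQ l t' ν hν)
  simp [step, hab]

theorem TriD.loop_done {a b : ℕ} {P : Prog} {s : Store} (hab : ¬ s.reg a < s.reg b) :
    TriD w D (.loop a b P) s 1 s :=
  TriD.of_step fun l => by simp [step, hab]

theorem Tri.loop_next {a b : ℕ} {P : Prog} {s : Store} {t t' : ℕ} {μ : PMF Store}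
    {ν : Store → PMF Store} (hab : s.reg a < s.reg b) (hP : Tri w D P s t μ)
    (hl : ∀ s' ∈ μ.support, Tri w D (.loop a b P) s' t' (ν s')) :
    Tri w D (.loop a b P) s (1 + t + t') (μ.bind ν) := by
  intro l t'' κ hκ
  rw [add_assoc, add_assoc, PMF.bind_bind]
  refine Ends.of_step (c' := (P :: .loop a b P :: l, s)) (by simp [step, hab]) ?_
  refine hP _ _ _ fun s' hs' => hl s' hs' _ _ _ fun s'' hs'' => hκ s'' ?_
  rw [PMF.mem_support_bind_iff]
  exact ⟨s', hs', hs''⟩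

theorem TriD.loop_next {a b : ℕ} {P : Prog} {s s' s'' : Store} {t t' : ℕ}
    (hab : s.reg a < s.reg b) (hP : TriD w D P s t s')
    (hl : TriD w D (.loop a b P) s' t' s'') :
    TriD w D (.loop a b P) s (1 + t + t') s'' := by
  have := Tri.loop_next (ν := fun _ => PMF.pure s'') hab hP (t' := t') (by
    intro x hx
    obtain rfl : x = s' := by simpa using hx
    exact hl)
  rwa [PMF.pure_bind] at this

/-- Invariant rule for a loop whose counter register `a` runs up to the value `N` of register `b`. -/
theorem TriD.forLoop {a b : ℕ} {P : Prog} {N t : ℕ} (Inv : ℕ → Store → Prop)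
    (hreg : ∀ j s, Inv j s → s.reg a = j ∧ s.reg b = N)
    (hbody : ∀ j < N, ∀ s, Inv j s → ∃ s', TriD w D P s t s' ∧ Inv (j + 1) s')
    {s : Store} (hs : Inv 0 s) :
    ∃ s', TriD w D (.loop a b P) s (N * (1 + t) + 1) s' ∧ Inv N s' := by
  suffices H : ∀ i j s, i + j = N → Inv j s →
      ∃ s', TriD w D (.loop a b P) s (i * (1 + t) + 1) s' ∧ Inv N s' from H N 0 s rfl hs
  intro i
  induction i with
  | zero =>
    intro j s hij hj
    obtain rfl : j = N := by omega
    have := hreg _ _ hj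
    exact ⟨s, (TriD.loop_done (by omega)).mono (by omega), hj⟩
  | succ i ih =>
    intro j s hij hj
    have hr := hreg _ _ hj
    obtain ⟨s', h1, h2⟩ := hbody j (by omega) s hj
    obtain ⟨s'', h3, h4⟩ := ih (j + 1) s' (by omega) h2
    exact ⟨s'', (TriD.loop_next (by omega) h1 h3).mono (by ring_nf; rfl), h4⟩

end Semantics

/-! ### Straight-line code -/

/-- Write `v` to register `r` without reduction. -/
def Store.put (s : Store) (r v : ℕ) : Store := { s with reg := Function.update s.reg r v }

/-- Write `v` to memory cell `a` without reduction. -/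
def Store.putMem (s : Store) (a v : ℕ) : Store := { s with mem := Function.update s.mem a v }

@[simp] theorem Store.reg_put (s : Store) (r v x : ℕ) :
    (s.put r v).reg x = if x = r then v else s.reg x := by
  simp [Store.put, Function.update_apply]

@[simp] theorem Store.mem_put (s : Store) (r v : ℕ) : (s.put r v).mem = s.mem := rfl

@[simp] theorem Store.reg_putMem (s : Store) (a v : ℕ) : (s.putMem a v).reg = s.reg := rfl

@[simp] theorem Store.mem_putMem (s : Store) (a v x : ℕ) :
    (s.putMem a v).mem x = if x = a then v else s.mem x := by
  simp [Store.putMem, Function.update_apply]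

theorem Store.setReg_eq {w v : ℕ} (hv : v < 2 ^ w) (s : Store) (r : ℕ) :
    s.setReg w r v = s.put r v := by
  simp [Store.setReg, Store.put, Nat.mod_eq_of_lt hv]

theorem Store.setMem_eq {w v : ℕ} (hv : v < 2 ^ w) (s : Store) (a : ℕ) :
    s.setMem w a v = s.putMem a v := by
  simp [Store.setMem, Store.putMem, Nat.mod_eq_of_lt hv]

section Straight
variable {n m : ℕ} (w : ℕ) (D : Data n m)

/-- The effect of straight-line code on a machine with unbounded words. Loops and random draws are
left out: their value here is never used. -/
def exec : Prog → Store → Store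
  | .const r v, s => s.put r v
  | .op o r a b, s => s.put r (o.eval (s.reg a) (s.reg b))
  | .load r a, s => s.put r (s.mem (s.reg a))
  | .store a r, s => s.putMem (s.reg a) (s.reg r)
  | .readX r i j, s => s.put r (D.bitX (s.reg i) (s.reg j))
  | .readY r i, s => s.put r (D.bitY (s.reg i))
  | .rand _ _, s => s
  | .skip, s => s
  | .seq p q, s => exec q (exec p s)
  | .branch a b p q, s => if s.reg a < s.reg b then exec p s else exec q s
  | .loop _ _ _, s => s

/-- The code is straight-line and no value it computes overflows a word of `w` bits. -/
def Safe : Prog → Store → Prop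
  | .const _ v, _ => v < 2 ^ w
  | .op o _ a b, s => o.eval (s.reg a) (s.reg b) < 2 ^ w
  | .load _ a, s => s.mem (s.reg a) < 2 ^ w
  | .store _ r, s => s.reg r < 2 ^ w
  | .readX _ _ _, _ => 1 < 2 ^ w
  | .readY _ _, _ => 1 < 2 ^ w
  | .rand _ _, _ => False
  | .skip, _ => True
  | .seq p q, s => Safe p s ∧ Safe q (exec D p s)
  | .branch a b p q, s => if s.reg a < s.reg b then Safe p s else Safe q s
  | .loop _ _ _, _ => False

/-- An upper bound on the running time of straight-line code. -/
def Prog.time : Prog → ℕ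
  | .seq p q => 1 + p.time + q.time
  | .branch _ _ p q => 1 + (p.time + q.time)
  | _ => 1

/-- All registers that the straight-line code writes have a number that is at least `L`. -/
def Prog.Above (L : ℕ) : Prog → Prop
  | .const r _ => L ≤ r
  | .op _ r _ _ => L ≤ r
  | .load r _ => L ≤ r
  | .readX r _ _ => L ≤ r
  | .readY r _ => L ≤ r
  | .seq p q => p.Above L ∧ q.Above L
  | .branch _ _ p q => p.Above L ∧ q.Above L
  | _ => True

variable {D}

theorem bitX_le (i j : ℕ) : D.bitX i j ≤ 1 := by
  unfold Data.bitX
  split_ifs with h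
  · have := ZMod.val_lt ((D ⟨i, h.1⟩).1 ⟨j, h.2⟩)
    omega
  · simp

theorem bitY_le (i : ℕ) : D.bitY i ≤ 1 := by
  unfold Data.bitY
  split_ifs with h
  · have := ZMod.val_lt ((D ⟨i, h⟩).2)
    omega
  · simp

variable {w}

/-- Straight-line code without overflow has the effect that it has for unbounded words. -/
theorem triD_exec (P : Prog) (s : Store) (hs : Safe w D P s) :
    TriD w D P s P.time (exec D P s) := by
  induction P generalizing s with
  | const r v => exact TriD.of_step fun l => by simp [step, exec, Store.setReg_eq hs]
  | op o r a b => exact TriD.of_step fun l => by simp [step, exec, Store.setReg_eq hs]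
  | load r a => exact TriD.of_step fun l => by simp [step, exec, Store.setReg_eq hs]
  | store a r => exact TriD.of_step fun l => by simp [step, exec, Store.setMem_eq hs]
  | readX r i j =>
    exact TriD.of_step fun l => by
      simp [step, exec, Store.setReg_eq ((bitX_le (D := D) (s.reg i) (s.reg j)).trans_lt hs)]
  | readY r i =>
    exact TriD.of_step fun l => by
      simp [step, exec, Store.setReg_eq ((bitY_le (D := D) (s.reg i)).trans_lt hs)]
  | rand r a => exact hs.elim
  | skip => exact TriD.of_step fun l => by simp [step, exec]
  | seq p q ihp ihq => exact TriD.seq (ihp s hs.1) (ihq _ hs.2)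
  | branch a b p q ihp ihq =>
    by_cases hab : s.reg a < s.reg b
    · simp only [Safe, hab, if_true] at hs
      simp only [exec, hab, if_true]
      exact (Tri.branch_pos hab (ihp s hs)).mono (by simp [Prog.time])
    · simp only [Safe, hab, if_false] at hs
      simp only [exec, hab, if_false]
      exact (Tri.branch_neg hab (ihq s hs)).mono (by simp [Prog.time])
  | loop a b p => exact hs.elim

theorem exec_reg_of_above {L : ℕ} (P : Prog) (s : Store) (hP : P.Above L) (x : ℕ) (hx : x < L) :
    (exec D P s).reg x = s.reg x := by
  induction P generalizing s with
  | seq p q ihp ihq => rw [exec, ihq _ hP.2, ihp _ hP.1]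
  | branch a b p q ihp ihq =>
    rw [exec]
    split_ifs
    · exact ihp _ hP.1
    · exact ihq _ hP.2
  | const r v => simp only [exec, Store.reg_put]; rw [if_neg]; simp only [Prog.Above] at hP; omega
  | op o r a b => simp only [exec, Store.reg_put]; rw [if_neg]; simp only [Prog.Above] at hP; omega
  | load r a => simp only [exec, Store.reg_put]; rw [if_neg]; simp only [Prog.Above] at hP; omega
  | readX r i j => simp only [exec, Store.reg_put]; rw [if_neg]; simp only [Prog.Above] at hP; omega
  | readY r i => simp only [exec, Store.reg_put]; rw [if_neg]; simp only [Prog.Above] at hP; omega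
  | store a r => rfl
  | rand r a => rfl
  | skip => rfl
  | loop a b p => rfl

end Straight

/-- The instructions of a list, one after the other. -/
def block : List Prog → Prog
  | [] => .skip
  | p :: l => .seq p (block l)

/-! ### Parameters, registers and memory -/

/-- The numbers a run of the program depends on: the input numbers `n`, `m`, `k` and `s = ⌈k / η⌉`,
and the constants of the program, of which `p / q` is the threshold on the rate of disagreement. -/
structure Par : Type where
  (n m k s p q C a : ℕ)

namespace Par
variable (P : Par)

/-- The size of a block of coordinates. -/
def g : ℕ := P.s / P.k + 1
/-- The number of blocks. The last blocks lie outside of `{0, …, n - 1}`; there are `k` blocks to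
spare, so that the support of the secret can always be covered by exactly `k` blocks. -/
def Q : ℕ := P.n / P.g + 1 + P.k
/-- The number of coordinates in `k` blocks. -/
def K : ℕ := P.k * P.g
/-- The number of equations that are solved. The factor `7` is such that `2 (9 / 10) ^ 7 < 1`. -/
def r : ℕ := 7 * (P.K + 1)
/-- The number of samples from which equations are drawn. -/
def m1 : ℕ := 200 * P.s
/-- The base of the iteration counter. It is proportional to `⌊n / s⌋` rather than to `n / s`, a
number that the program cannot compute. -/
def base : ℕ := P.a * (P.n / P.s)

/-- An upper bound for the numbers held in registers. -/
def X : ℕ := P.n + P.m + P.k + P.s + P.g + P.Q + (P.K + 1) + P.r + P.m1 + P.base + P.p + P.q + P.C + 8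

/-- Words of `w` bits are long enough for all intermediate results. -/
def Fits (w : ℕ) : Prop := 64 * (P.X * P.X) < 2 ^ w

/-- The values of the registers that are not changed after the initialization. -/
structure Consts (s : Store) : Prop where
  r0 : s.reg 0 = P.n
  r1 : s.reg 1 = P.k
  r2 : s.reg 2 = P.s
  r3 : s.reg 3 = P.m
  r4 : s.reg 4 = P.g
  r5 : s.reg 5 = P.Q
  r6 : s.reg 6 = P.K
  r7 : s.reg 7 = P.K + 1
  r8 : s.reg 8 = P.r
  r9 : s.reg 9 = P.m1
  r10 : s.reg 10 = P.base
  r11 : s.reg 11 = 8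
  r12 : s.reg 12 = 0
  r13 : s.reg 13 = 1
  r14 : s.reg 14 = 2
  r15 : s.reg 15 = (P.K + 1) * (P.K + 1)
  r16 : s.reg 16 = P.q
  r17 : s.reg 17 = P.p
  r18 : s.reg 18 = P.C
  r19 : s.reg 19 = P.n + 1
  r20 : s.reg 20 = P.n + 2
  r21 : s.reg 21 = P.n + 3
  r22 : s.reg 22 = P.n + 4

variable {P}

theorem Consts.congr {s s' : Store} (h : P.Consts s) {L : ℕ} (hL : 30 ≤ L)
    (hs : ∀ x < L, s'.reg x = s.reg x) : P.Consts s' := by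
  constructor <;> rw [hs _ (by omega)]
  exacts [h.r0, h.r1, h.r2, h.r3, h.r4, h.r5, h.r6, h.r7, h.r8, h.r9, h.r10, h.r11, h.r12, h.r13,
    h.r14, h.r15, h.r16, h.r17, h.r18, h.r19, h.r20, h.r21, h.r22]

variable (P)

/-- Cell `x` of working array number `ρ`. The arrays are interleaved behind the output cells:
`0` holds the chosen blocks, `1` the chosen samples, `2` the matrix, `3` the products of its rows
with the current equation, `4` the digits of the iteration counter. -/
def arr (μ : ℕ → ℕ) (ρ x : ℕ) : ℕ := μ (P.n + 8 * x + ρ)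

/-- The number of the array that a memory cell belongs to; `8` for output cells. -/
def region (a : ℕ) : ℕ := if a < P.n then 8 else (a - P.n) % 8

variable {P}

theorem region_arr {ρ : ℕ} (x : ℕ) (hρ : ρ < 8) : P.region (P.n + 8 * x + ρ) = ρ := by
  unfold region
  rw [if_neg (by omega)]
  omega

theorem region_out {a : ℕ} (h : a < P.n) : P.region a = 8 := if_pos h

theorem arr_congr {μ μ' : ℕ → ℕ} {ρ : ℕ} (hρ : ρ < 8)
    (h : ∀ a, P.region a = ρ → μ' a = μ a) (x : ℕ) : P.arr μ' ρ x = P.arr μ ρ x :=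
  h _ (region_arr x hρ)

variable (P)

/-- Coordinate number `j` of the chosen blocks. -/
def pos (μ : ℕ → ℕ) (j : ℕ) : ℕ := P.arr μ 0 (j / P.g) * P.g + j % P.g

/-- Bounds on the contents of the arrays. -/
structure MemOK (μ : ℕ → ℕ) : Prop where
  blocks : ∀ x < P.k, P.arr μ 0 x < P.Q
  matrix : ∀ x < (P.K + 1) * (P.K + 1), P.arr μ 2 x ≤ 1

theorem n_le_X : P.n ≤ P.X := by unfold X; omega
theorem m_le_X : P.m ≤ P.X := by unfold X; omega
theorem k_le_X : P.k ≤ P.X := by unfold X; omega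
theorem s_le_X : P.s ≤ P.X := by unfold X; omega
theorem g_le_X : P.g ≤ P.X := by unfold X; omega
theorem Q_le_X : P.Q ≤ P.X := by unfold X; omega
theorem K_lt_X : P.K + 1 ≤ P.X := by unfold X; omega
theorem r_le_X : P.r ≤ P.X := by unfold X; omega
theorem m1_le_X : P.m1 ≤ P.X := by unfold X; omega
theorem base_le_X : P.base ≤ P.X := by unfold X; omega
theorem eight_le_X : 8 ≤ P.X := by unfold X; omega
theorem g_pos : 0 < P.g := Nat.succ_pos _

variable {P}

theorem Fits.ne_zero {w : ℕ} (hw : P.Fits w) : w ≠ 0 := by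
  rintro rfl
  have hX := P.eight_le_X
  have hXX : 8 * P.X ≤ P.X * P.X := Nat.mul_le_mul_right _ hX
  unfold Fits at hw
  omega

theorem sq_le_X {a b : ℕ} (ha : a ≤ P.X) (hb : b ≤ P.X) : a * b ≤ P.X * P.X := Nat.mul_le_mul ha hb

theorem idx_lt {i j : ℕ} (hi : i < P.K + 1) (hj : j < P.K + 1) :
    i * (P.K + 1) + j < (P.K + 1) * (P.K + 1) := by
  nlinarith

theorem idx_inj {i j i' j' : ℕ} (hj : j < P.K + 1) (hj' : j' < P.K + 1)
    (h : i * (P.K + 1) + j = i' * (P.K + 1) + j') : i = i' ∧ j = j' := by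
  have h1 : ∀ x y, y < P.K + 1 → (x * (P.K + 1) + y) / (P.K + 1) = x := fun x y hy => by
    rw [mul_comm, Nat.mul_add_div (by omega), Nat.div_eq_of_lt hy, add_zero]
  have h2 : i = i' := by rw [← h1 i j hj, h, h1 i' j' hj']
  subst h2
  exact ⟨rfl, by omega⟩

end Par

/-! ### Scalar product of a row of the matrix with a sample -/

section Programs

open Prog BinOp

/-- Add the contribution of column `reg 64` of the matrix to a scalar product. Register `65` holds
the index of the start of the row. -/
def dotBody : Prog :=
  block [op div 66 64 4, op mul 66 66 11, op add 66 66 0, load 66 66, op mul 66 66 4,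
    op mod 67 64 4, op add 66 66 67, readX 66 61 66, op add 67 65 64, op mul 67 67 11,
    op add 67 67 20, load 67 67, op mul 66 66 67, op add 63 63 66, op add 64 64 13]

/-- Register `63` receives the scalar product of row number `reg 60` of the matrix, its last entry
replaced by `reg 62`, with sample number `reg 61`. -/
def dotProg : Prog :=
  .seq (block [const 63 0, const 64 0, op mul 65 60 7]) (.seq (loop 64 6 dotBody)
    (block [readY 66 61, op mul 66 66 62, op add 63 63 66, op mod 63 63 14]))

variable {P : Par} {w : ℕ} {D : Data P.n P.m}

/-- The scalar product computed by `dotProg`. -/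
def Par.dotNat (P : Par) (D : Data P.n P.m) (μ : ℕ → ℕ) (i x l : ℕ) : ℕ :=
  (∑ j ∈ Finset.range P.K, D.bitX x (P.pos μ j) * P.arr μ 2 (i * (P.K + 1) + j) + D.bitY x * l) % 2

theorem dotProg_spec (hw : P.Fits w) {s : Store} (hc : P.Consts s) (hm : P.MemOK s.mem)
    {i x l : ℕ} (hi : s.reg 60 = i) (hiK : i < P.K + 1) (hx : s.reg 61 = x) (hl : s.reg 62 = l)
    (hl1 : l ≤ 1) :
    ∃ s', TriD w D dotProg s (P.K * 40 + 30) s' ∧ s'.mem = s.mem ∧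
      (∀ y < 63, s'.reg y = s.reg y) ∧ s'.reg 63 = P.dotNat D s.mem i x l := by
  have hw0 := hw.ne_zero
  unfold Par.Fits at hw
  have hX := P.eight_le_X
  have hXX : 8 * P.X ≤ P.X * P.X := Nat.mul_le_mul_right _ hX
  have hg := P.g_pos
  have hgX := P.g_le_X
  have hKX := P.K_lt_X
  have hQX := P.Q_le_X
  have hnX := P.n_le_X
  have e0 := hc.r0; have e4 := hc.r4; have e6 := hc.r6; have e7 := hc.r7; have e11 := hc.r11
  have e13 := hc.r13; have e14 := hc.r14; have e20 := hc.r20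
  have hiK' : i * (P.K + 1) ≤ P.X * P.X := Par.sq_le_X (by omega) hKX
  let Inv : ℕ → Store → Prop := fun j t => t.mem = s.mem ∧ (∀ y < 63, t.reg y = s.reg y) ∧
    t.reg 64 = j ∧ t.reg 65 = i * (P.K + 1) ∧ j ≤ P.K ∧ t.reg 63 ≤ j ∧
    t.reg 63 = ∑ j ∈ Finset.range j, D.bitX x (P.pos s.mem j) * P.arr s.mem 2 (i * (P.K + 1) + j)
  obtain ⟨s2, h2, hI⟩ : ∃ s', TriD w D (loop 64 6 dotBody)
      (exec D (block [const 63 0, const 64 0, op mul 65 60 7]) s) (P.K * (1 + 31) + 1) s' ∧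
      Inv P.K s' := by
    refine TriD.forLoop Inv (fun j t ht => ⟨ht.2.2.1, by rw [ht.2.1 6 (by omega), e6]⟩) ?_ ?_
    · rintro j hj t ⟨t1, t2, t3, t4, t5, t6, t7⟩
      have f0 := (t2 0 (by omega)).trans e0
      have f4 := (t2 4 (by omega)).trans e4
      have f11 := (t2 11 (by omega)).trans e11
      have f13 := (t2 13 (by omega)).trans e13
      have f20 := (t2 20 (by omega)).trans e20
      have f61 := (t2 61 (by omega)).trans hx
      have b1 : j / P.g < P.k := by
        rw [Nat.div_lt_iff_lt_mul hg]; exact hj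
      have b2 : j % P.g < P.g := Nat.mod_lt _ hg
      have b3 := hm.blocks _ b1
      have b4 := hm.matrix _ (Par.idx_lt hiK (show j < P.K + 1 by omega))
      have b5 : P.arr s.mem 0 (j / P.g) * P.g ≤ P.X * P.X := Par.sq_le_X (by omega) hgX
      have b6 : j / P.g ≤ j := Nat.div_le_self _ _
      have b7 := bitX_le (D := D) x (P.pos s.mem j)
      have b8 : D.bitX x (P.pos s.mem j) * P.arr s.mem 2 (i * (P.K + 1) + j) ≤ 1 :=
        (Nat.mul_le_mul b7 b4).trans (by norm_num)
      have c1 : t.mem (j / P.g * 8 + P.n) = P.arr s.mem 0 (j / P.g) := by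
        rw [t1, Par.arr]; congr 1; ring
      have c2 : t.mem ((i * (P.K + 1) + j) * 8 + (P.n + 2)) =
          P.arr s.mem 2 (i * (P.K + 1) + j) := by
        rw [t1, Par.arr]; congr 1; ring
      have c3 : P.arr s.mem 0 (j / P.g) * P.g + j % P.g = P.pos s.mem j := rfl
      refine ⟨exec D dotBody t, triD_exec _ _ ?_, ?_, ?_, ?_, ?_, hj, ?_, ?_⟩
      · simp [dotBody, block, Safe, exec, BinOp.eval, f0, f4, f11, f13, f20, f61, t3, t4, c1, c2, c3, hw0]
        refine ⟨?_, ?_, ?_, ?_, ?_, ?_, ?_, ?_, ?_, ?_, ?_, ?_, ?_, ?_⟩ <;> omega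
      · rw [← t1]; rfl
      · intro y hy
        rw [exec_reg_of_above (L := 63) _ _ (by simp [dotBody, block, Prog.Above]) _ hy, t2 y hy]
      · simp [dotBody, block, exec, f13, t3, BinOp.eval]
      · simp [dotBody, block, exec, t4]
      · simp [dotBody, block, exec, BinOp.eval, f0, f4, f11, f13, f20, f61, t3, t4, c1, c2, c3]
        omega
      · rw [Finset.sum_range_succ, ← t7]
        simp [dotBody, block, exec, BinOp.eval, f0, f4, f11, f13, f20, f61, t3, t4, c1, c2, c3]
    · refine ⟨rfl, ?_, ?_, ?_, by omega, ?_, ?_⟩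
      · intro y hy
        rw [exec_reg_of_above (L := 63) _ _ (by simp [block, Prog.Above]) _ hy]
      · simp [block, exec]
      · simp [block, exec, hi, e7, BinOp.eval]
      · simp [block, exec]
      · simp [block, exec]
  obtain ⟨t1, t2, t3, t4, t5, t6, t7⟩ := hI
  have f14 := (t2 14 (by omega)).trans e14
  have f61 := (t2 61 (by omega)).trans hx
  have f62 := (t2 62 (by omega)).trans hl
  have b1 := bitY_le (D := D) x
  have b2 : D.bitY x * l ≤ 1 := (Nat.mul_le_mul b1 hl1).trans (by norm_num)
  refine ⟨_, (TriD.seq (triD_exec _ _ ?_) (TriD.seq h2 (triD_exec _ _ ?_))).mono ?_, ?_, ?_, ?_⟩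
  · simp [block, Safe, exec, BinOp.eval, hi, e7]; omega
  · simp [block, Safe, exec, BinOp.eval, f14, f61, f62, hw0]; omega
  · simp [block, Prog.time]; omega
  · exact t1
  · intro y hy
    rw [exec_reg_of_above (L := 63) _ _ (by simp [block, Prog.Above]) _ hy, t2 y hy]
  · simp [block, exec, BinOp.eval, f14, f61, f62, t7, Par.dotNat]

end Programs

/-! ### Elimination with one sample -/

section Elimination

open Prog BinOp

variable {P : Par} {w : ℕ} {D : Data P.n P.m}

theorem Par.MemOK.congr {μ μ' : ℕ → ℕ} (h : P.MemOK μ)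
    (h0 : ∀ a, P.region a = 0 → μ' a = μ a) (h2 : ∀ a, P.region a = 2 → μ' a = μ a) :
    P.MemOK μ' :=
  ⟨fun x hx => by rw [Par.arr_congr (by omega) h0]; exact h.blocks x hx,
    fun x hx => by rw [Par.arr_congr (by omega) h2]; exact h.matrix x hx⟩

theorem Par.pos_congr {μ μ' : ℕ → ℕ} (h0 : ∀ a, P.region a = 0 → μ' a = μ a) (j : ℕ) :
    P.pos μ' j = P.pos μ j := by
  unfold Par.pos
  rw [Par.arr_congr (by omega) h0]

theorem Par.dotNat_congr {μ μ' : ℕ → ℕ}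
    (h0 : ∀ a, P.region a = 0 → μ' a = μ a) (h2 : ∀ a, P.region a = 2 → μ' a = μ a)
    (i x l : ℕ) : P.dotNat D μ' i x l = P.dotNat D μ i x l := by
  unfold Par.dotNat
  congr 2
  refine Finset.sum_congr rfl fun j _ => ?_
  rw [Par.pos_congr h0, Par.arr_congr (by omega) h2]

theorem Par.dotNat_le (μ : ℕ → ℕ) (i x l : ℕ) : P.dotNat D μ i x l ≤ 1 :=
  Nat.le_of_lt_succ (Nat.mod_lt _ (by norm_num))

/-- The scalar product of row `i` of the matrix with sample `x`. -/
def Par.dotRow (P : Par) (D : Data P.n P.m) (μ : ℕ → ℕ) (x i : ℕ) : ℕ :=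
  P.dotNat D μ i x (P.arr μ 2 (i * (P.K + 1) + P.K))

/-- The last one of the first `i` rows whose scalar product with sample `x` is nonzero. -/
def Par.pivotNat (P : Par) (D : Data P.n P.m) (μ : ℕ → ℕ) (x : ℕ) : ℕ → ℕ
  | 0 => 0
  | i + 1 => if 0 < P.dotRow D μ x i then i else P.pivotNat D μ x i

theorem Par.pivotNat_lt (μ : ℕ → ℕ) (x : ℕ) (i : ℕ) : P.pivotNat D μ x i < i + 1 := by
  induction i with
  | zero => simp [Par.pivotNat]
  | succ i ih => rw [Par.pivotNat]; split_ifs <;> omega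

/-- Store the scalar product of row `reg 60` of the matrix with sample `reg 61` in array `3`. If it
is nonzero, then the row becomes the pivot row, whose number is in register `52`. -/
def prodBody : Prog :=
  .seq (block [op mul 53 60 7, op add 53 53 6, op mul 53 53 11, op add 53 53 20, load 62 53])
    (.seq dotProg (block [op mul 53 60 11, op add 53 53 21, store 53 63,
      op sub 54 60 52, op mul 54 54 63, op add 52 52 54, op add 60 60 13]))

theorem prodLoop_spec (hw : P.Fits w) {s : Store} (hc : P.Consts s) (hm : P.MemOK s.mem)
    {x : ℕ} (hi : s.reg 60 = 0) (hx : s.reg 61 = x) (hp : s.reg 52 = 0) :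
    ∃ s', TriD w D (loop 60 7 prodBody) s ((P.K + 1) * (P.K * 40 + 70) + 1) s' ∧
      (∀ a, P.region a ≠ 3 → s'.mem a = s.mem a) ∧ (∀ y < 52, s'.reg y = s.reg y) ∧
      s'.reg 52 = P.pivotNat D s.mem x (P.K + 1) ∧
      ∀ i < P.K + 1, P.arr s'.mem 3 i = P.dotRow D s.mem x i := by
  have hw0 := hw.ne_zero
  have hw' := hw
  unfold Par.Fits at hw
  have hX := P.eight_le_X
  have hXX : 8 * P.X ≤ P.X * P.X := Nat.mul_le_mul_right _ hX
  have hKX := P.K_lt_X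
  have hnX := P.n_le_X
  let Inv : ℕ → Store → Prop := fun j t => (∀ a, P.region a ≠ 3 → t.mem a = s.mem a) ∧
    (∀ y < 52, t.reg y = s.reg y) ∧ t.reg 60 = j ∧ t.reg 61 = x ∧ j ≤ P.K + 1 ∧
    t.reg 52 = P.pivotNat D s.mem x j ∧ ∀ i < j, P.arr t.mem 3 i = P.dotRow D s.mem x i
  obtain ⟨s2, h2, hI⟩ : ∃ s', TriD w D (loop 60 7 prodBody) s
      ((P.K + 1) * (1 + (P.K * 40 + 69)) + 1) s' ∧ Inv (P.K + 1) s' := by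
    refine TriD.forLoop Inv (fun j t ht => ⟨ht.2.2.1, by rw [ht.2.1 7 (by omega), hc.r7]⟩) ?_ ?_
    · rintro j hj t ⟨t1, t2, t3, t4, t5, t6, t7⟩
      have hct : P.Consts t := hc.congr (L := 52) (by omega) t2
      have e6 := hct.r6; have e7 := hct.r7; have e11 := hct.r11; have e20 := hct.r20
      have hmt : P.MemOK t.mem :=
        hm.congr (fun a ha => t1 a (by omega)) (fun a ha => t1 a (by omega))
      have hjK : j * (P.K + 1) ≤ P.X * P.X := Par.sq_le_X (by omega) hKX
      have c1 : t.mem ((j * (P.K + 1) + P.K) * 8 + (P.n + 2)) =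
          P.arr t.mem 2 (j * (P.K + 1) + P.K) := by
        rw [Par.arr]; congr 1; ring
      have c2 := hmt.matrix _ (Par.idx_lt hj (show P.K < P.K + 1 by omega))
      set pre := block [op mul 53 60 7, op add 53 53 6, op mul 53 53 11, op add 53 53 20,
        load 62 53] with hpre
      have hab : pre.Above 52 := by simp [hpre, block, Prog.Above]
      have h1 := triD_exec (w := w) (D := D) pre t (by
        simp [hpre, block, Safe, exec, BinOp.eval, e6, e7, e11, e20, t3, c1]; omega)
      set u := exec D pre t with hu
      have hum : u.mem = t.mem := rfl
      have hur : ∀ y < 52, u.reg y = t.reg y := fun y hy => exec_reg_of_above pre t hab y hy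
      obtain ⟨v, v1, v2, v3, v4⟩ := dotProg_spec (D := D) hw' (s := u) (hct.congr (L := 52) (by omega) hur)
        hmt (i := j) (x := x) (l := P.arr t.mem 2 (j * (P.K + 1) + P.K))
        (by simp [hu, hpre, block, exec, t3]) hj (by simp [hu, hpre, block, exec, t4])
        (by simp [hu, hpre, block, exec, BinOp.eval, e6, e7, e11, e20, t3, c1]) c2
      have hd : v.reg 63 = P.dotRow D s.mem x j := by
        rw [v4, Par.dotRow, hum, Par.dotNat_congr (fun a ha => t1 a (by omega))
          (fun a ha => t1 a (by omega)),
          Par.arr_congr (μ := s.mem) (by omega) (fun a ha => t1 a (by omega))]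
      have hd1 : v.reg 63 ≤ 1 := by rw [v4]; exact P.dotNat_le ..
      have v60 : v.reg 60 = j := by rw [v3 _ (by omega)]; simp [hu, hpre, block, exec, t3]
      have v61 : v.reg 61 = x := by rw [v3 _ (by omega)]; simp [hu, hpre, block, exec, t4]
      have v52 : v.reg 52 = P.pivotNat D s.mem x j := by
        rw [v3 _ (by omega)]; simp [hu, hpre, block, exec, t6]
      have hcv : P.Consts v := hct.congr (L := 52) (by omega)
        fun y hy => (v3 y (by omega)).trans (hur y hy)
      have e11 := hcv.r11; have e21 := hcv.r21; have e13 := hcv.r13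
      have hp1 := P.pivotNat_lt (D := D) s.mem x j
      have hv1 : 0 < v.reg 63 → v.reg 63 = 1 := by omega
      have hv2 : (j - P.pivotNat D s.mem x j) * v.reg 63 ≤ (j - P.pivotNat D s.mem x j) * 1 :=
        Nat.mul_le_mul_left _ hd1
      refine ⟨_, (TriD.seq h1 (TriD.seq v1 (triD_exec _ _ ?_))).mono ?_, ?_, ?_, ?_, ?_, ?_, ?_, ?_⟩
      · simp [block, Safe, exec, BinOp.eval, v60, v52, e11, e21, e13]
        omega
      · simp [hpre, block, Prog.time]; omega
      · intro a ha
        have : a ≠ j * 8 + (P.n + 3) := by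
          rintro rfl
          apply ha
          rw [show j * 8 + (P.n + 3) = P.n + 8 * j + 3 by ring, Par.region_arr _ (by omega)]
        simp [block, exec, BinOp.eval, v60, e11, e21, this, v2, hum, t1 a ha]
      · intro y hy
        rw [exec_reg_of_above (L := 52) _ _ (by simp [block, Prog.Above]) _ hy, v3 y (by omega),
          hur y hy, t2 y hy]
      · simp [block, exec, v60, e13, BinOp.eval]
      · simp [block, exec, v61]
      · exact hj
      · rw [Par.pivotNat, ← hd]
        simp [block, exec, BinOp.eval, v60, v52]
        split_ifs with h63
        · rw [hv1 h63]; omega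
        · rw [Nat.eq_zero_of_not_pos h63]; omega
      · intro i hi
        rw [Par.arr]
        simp [block, exec, BinOp.eval, v60, e11, e21]
        by_cases hij : i = j
        · subst hij
          rw [if_pos (by ring), hd]
        · rw [if_neg (by omega), v2, hum]
          exact t7 i (by omega)
    · exact ⟨fun _ _ => rfl, fun _ _ => rfl, hi, hx, by omega, hp, fun i hi => absurd hi (by omega)⟩
  obtain ⟨t1, t2, t3, t4, t5, t6, t7⟩ := hI
  exact ⟨s2, h2.mono (by ring_nf; rfl), t1, t2, t6, t7⟩

/-- In the column `reg 54` of the matrix, add to row `i` the entry `reg 55` times entry `i` of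
array `3`. -/
def colBody : Prog :=
  block [op mul 61 60 11, op add 61 61 21, load 61 61, op mul 61 61 55, op mul 62 60 7,
    op add 62 62 54, op mul 62 62 11, op add 62 62 20, load 63 62, op add 63 63 61,
    op mod 63 63 14, store 62 63, op add 60 60 13]

theorem colLoop_spec (hw : P.Fits w) {s : Store} (hc : P.Consts s) (hm : P.MemOK s.mem)
    (hd : ∀ i < P.K + 1, P.arr s.mem 3 i ≤ 1) {j b : ℕ} (hj : j < P.K + 1) (hb : b ≤ 1)
    (hi : s.reg 60 = 0) (h54 : s.reg 54 = j) (h55 : s.reg 55 = b) :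
    ∃ s', TriD w D (loop 60 7 colBody) s ((P.K + 1) * 28 + 1) s' ∧
      (∀ a, (∀ i < P.K + 1, a ≠ P.n + 8 * (i * (P.K + 1) + j) + 2) → s'.mem a = s.mem a) ∧
      (∀ y < 60, s'.reg y = s.reg y) ∧
      ∀ i < P.K + 1, P.arr s'.mem 2 (i * (P.K + 1) + j) =
        (P.arr s.mem 2 (i * (P.K + 1) + j) + P.arr s.mem 3 i * b) % 2 := by
  have hw0 := hw.ne_zero
  unfold Par.Fits at hw
  have hX := P.eight_le_X
  have hXX : 8 * P.X ≤ P.X * P.X := Nat.mul_le_mul_right _ hX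
  have hKX := P.K_lt_X
  have hnX := P.n_le_X
  let Inv : ℕ → Store → Prop := fun l t =>
    (∀ a, (∀ i < l, a ≠ P.n + 8 * (i * (P.K + 1) + j) + 2) → t.mem a = s.mem a) ∧
    (∀ y < 60, t.reg y = s.reg y) ∧ t.reg 60 = l ∧ l ≤ P.K + 1 ∧
    ∀ i < l, P.arr t.mem 2 (i * (P.K + 1) + j) =
        (P.arr s.mem 2 (i * (P.K + 1) + j) + P.arr s.mem 3 i * b) % 2
  obtain ⟨s2, h2, hI⟩ : ∃ s', TriD w D (loop 60 7 colBody) s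
      ((P.K + 1) * (1 + 27) + 1) s' ∧ Inv (P.K + 1) s' := by
    refine TriD.forLoop Inv (fun j t ht => ⟨ht.2.2.1, by rw [ht.2.1 7 (by omega), hc.r7]⟩) ?_ ?_
    · rintro i hj' t ⟨t1, t2, t3, t4, t5⟩
      have hct : P.Consts t := hc.congr (L := 60) (by omega) t2
      have e7 := hct.r7; have e11 := hct.r11; have e20 := hct.r20
      have e21 := hct.r21; have e14 := hct.r14; have e13 := hct.r13
      have e54 := (t2 54 (by omega)).trans h54
      have e55 := (t2 55 (by omega)).trans h55
      have hjK : i * (P.K + 1) ≤ P.X * P.X := Par.sq_le_X (by omega) hKX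
      have c1 : t.mem (i * 8 + (P.n + 3)) = P.arr s.mem 3 i := by
        rw [t1, Par.arr]
        · congr 1; ring
        · intro i' _; omega
      have c2 : t.mem ((i * (P.K + 1) + j) * 8 + (P.n + 2)) =
          P.arr s.mem 2 (i * (P.K + 1) + j) := by
        rw [t1, Par.arr]
        · congr 1; ring
        · intro i' hi' h
          have := (Par.idx_inj hj hj (by omega : i * (P.K + 1) + j = i' * (P.K + 1) + j)).1
          omega
      have c3 := hm.matrix _ (Par.idx_lt hj' hj)
      have c4 := hd i hj'
      have c5 : P.arr s.mem 3 i * b ≤ 1 := (Nat.mul_le_mul c4 hb).trans (by norm_num)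
      refine ⟨exec D colBody t, (triD_exec _ _ ?_).mono (by simp [colBody, block, Prog.time]), ?_, ?_, ?_, hj', ?_⟩
      · simp [colBody, block, Safe, exec, BinOp.eval, e7, e11, e20, e21, e14, e13, e54, e55, t3, c1, c2]
        omega
      · intro a ha
        have h1 : a ≠ (i * (P.K + 1) + j) * 8 + (P.n + 2) := by
          have := ha i (by omega)
          omega
        simp [colBody, block, exec, BinOp.eval, e7, e11, e20, e21, e14, e13, e54, e55, t3, h1]
        exact t1 a fun i' hi' => ha i' (by omega)
      · intro y hy
        rw [exec_reg_of_above (L := 60) _ _ (by simp [colBody, block, Prog.Above]) _ hy, t2 y hy]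
      · simp [colBody, block, exec, BinOp.eval, e13, t3]
      · intro i' hi'
        rw [Par.arr]
        simp [colBody, block, exec, BinOp.eval, e7, e11, e20, e21, e14, e13, e54, e55, t3, c1, c2]
        by_cases hij : i' = i
        · subst hij
          rw [if_pos (by ring)]
        · rw [if_neg]
          · exact t5 i' (by omega)
          · intro h
            exact hij (Par.idx_inj hj hj
              (by omega : i' * (P.K + 1) + j = i * (P.K + 1) + j)).1
    · exact ⟨fun _ _ => rfl, fun _ _ => rfl, hi, by omega, fun i hi => absurd hi (by omega)⟩
  obtain ⟨t1, t2, t3, t4, t5⟩ := hI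
  exact ⟨s2, h2, t1, t2, t5⟩

/-- Add the pivot row to the rows that are not orthogonal to the sample, in column `reg 54`. The
scalar products are read from array `3`, since the matrix is overwritten column by column. -/
def updBody : Prog :=
  .seq (block [op mul 55 52 7, op add 55 55 54, op mul 55 55 11, op add 55 55 20, load 55 55,
    const 60 0]) (.seq (loop 60 7 colBody) (op add 54 54 13))

/-- Make all rows of the matrix orthogonal to sample `reg 61`. -/
def elimProg : Prog :=
  .seq (block [const 52 0, const 60 0]) (.seq (loop 60 7 prodBody) (.seq (const 54 0)
    (loop 54 7 updBody)))

theorem elimProg_spec (hw : P.Fits w) {s : Store} (hc : P.Consts s) (hm : P.MemOK s.mem)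
    {x : ℕ} (hx : s.reg 61 = x) :
    ∃ s', TriD w D elimProg s ((P.K + 1) * (P.K * 80 + 200) + 100) s' ∧
      (∀ a, P.region a ≠ 2 → P.region a ≠ 3 → s'.mem a = s.mem a) ∧
      (∀ y < 52, s'.reg y = s.reg y) ∧
      ∀ i < P.K + 1, ∀ j < P.K + 1, P.arr s'.mem 2 (i * (P.K + 1) + j) =
        (P.arr s.mem 2 (i * (P.K + 1) + j) + P.dotRow D s.mem x i *
          P.arr s.mem 2 (P.pivotNat D s.mem x (P.K + 1) * (P.K + 1) + j)) % 2 := by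
  have hw0 := hw.ne_zero
  have hw' := hw
  unfold Par.Fits at hw
  have hX := P.eight_le_X
  have hXX : 8 * P.X ≤ P.X * P.X := Nat.mul_le_mul_right _ hX
  have hKX := P.K_lt_X
  have hnX := P.n_le_X
  set pre := block [const 52 0, const 60 0] with hpre
  have h1 := triD_exec (w := w) (D := D) pre s (by simp [hpre, block, Safe])
  have hur : ∀ y < 52, (exec D pre s).reg y = s.reg y :=
    fun y hy => exec_reg_of_above pre s (by simp [hpre, block, Prog.Above]) y hy
  obtain ⟨v, v1, v2, v3, v4, v5⟩ := prodLoop_spec (D := D) hw' (s := exec D pre s)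
    (hc.congr (by omega) hur) hm (x := x) (by simp [hpre, block, exec])
    (by simp [hpre, block, exec, hx]) (by simp [hpre, block, exec])
  change ∀ a, P.region a ≠ 3 → v.mem a = s.mem a at v2
  change v.reg 52 = P.pivotNat D s.mem x (P.K + 1) at v4
  change ∀ i < P.K + 1, P.arr v.mem 3 i = P.dotRow D s.mem x i at v5
  replace v3 : ∀ y < 52, v.reg y = s.reg y := fun y hy => (v3 y hy).trans (hur y hy)
  set p := P.pivotNat D s.mem x (P.K + 1) with hp
  have hpos : p < P.K + 1 := by
    rw [hp, Par.pivotNat]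
    have := P.pivotNat_lt (D := D) s.mem x P.K
    split_ifs <;> omega
  have hpK : p * (P.K + 1) ≤ P.X * P.X := Par.sq_le_X (by omega) hKX
  let Inv : ℕ → Store → Prop := fun l t =>
    (∀ a, P.region a ≠ 2 → t.mem a = v.mem a) ∧
    (∀ y < 53, t.reg y = v.reg y) ∧ t.reg 54 = l ∧ l ≤ P.K + 1 ∧
    ∀ i < P.K + 1, ∀ j < P.K + 1, P.arr t.mem 2 (i * (P.K + 1) + j) =
        if j < l then (P.arr s.mem 2 (i * (P.K + 1) + j) + P.dotRow D s.mem x i *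
          P.arr s.mem 2 (p * (P.K + 1) + j)) % 2 else P.arr s.mem 2 (i * (P.K + 1) + j)
  have hcv : P.Consts v := hc.congr (L := 52) (by omega) v3
  obtain ⟨s2, h2, hI⟩ : ∃ s', TriD w D (loop 54 7 updBody) (exec D (const 54 0) v)
      ((P.K + 1) * (1 + ((P.K + 1) * 28 + 20)) + 1) s' ∧ Inv (P.K + 1) s' := by
    refine TriD.forLoop Inv (fun j t ht => ⟨ht.2.2.1, by rw [ht.2.1 7 (by omega), hcv.r7]⟩) ?_ ?_
    · rintro j hj t ⟨t1, t2, t3, t4, t5⟩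
      have hct : P.Consts t := hcv.congr (L := 53) (by omega) t2
      have e7 := hct.r7; have e11 := hct.r11; have e20 := hct.r20
      have e52 := (t2 52 (by omega)).trans v4
      have hmt : P.MemOK t.mem := by
        refine ⟨fun y hy => ?_, fun y hy => ?_⟩
        · rw [Par.arr_congr (μ := s.mem) (by omega)
            fun a ha => (t1 a (by omega)).trans (v2 a (by omega))]
          exact hm.blocks y hy
        · have h1 : y / (P.K + 1) < P.K + 1 := Nat.div_lt_of_lt_mul hy
          have h2 : y % (P.K + 1) < P.K + 1 := Nat.mod_lt _ (by omega)
          have h3 := t5 _ h1 _ h2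
          have h4 := hm.matrix y hy
          rw [Nat.div_add_mod'] at h3
          rw [h3]
          split_ifs <;> omega
      have c1 : t.mem ((p * (P.K + 1) + j) * 8 + (P.n + 2)) =
          P.arr t.mem 2 (p * (P.K + 1) + j) := by
        rw [Par.arr]; congr 1; ring
      have c2 := hmt.matrix _ (Par.idx_lt hpos hj)
      set pre' := block [op mul 55 52 7, op add 55 55 54, op mul 55 55 11, op add 55 55 20,
        load 55 55, const 60 0] with hpre'
      have h1 := triD_exec (w := w) (D := D) pre' t (by
        simp [hpre', block, Safe, exec, BinOp.eval, e7, e11, e20, e52, t3, c1]; omega)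
      set u := exec D pre' t with hu
      have hum : u.mem = t.mem := rfl
      have hur : ∀ y < 53, u.reg y = t.reg y :=
        fun y hy => exec_reg_of_above pre' t (by simp [hpre', block, Prog.Above]) y hy
      have hd3 : ∀ i, P.arr u.mem 3 i = P.arr v.mem 3 i := fun i =>
        Par.arr_congr (by omega) (fun a ha => t1 a (by omega)) i
      obtain ⟨z, z1, z2, z3, z4⟩ := colLoop_spec (D := D) hw' (s := u)
        (hct.congr (L := 53) (by omega) hur) hmt
        (by intro i hi; rw [hd3, v5 i hi]; exact P.dotNat_le ..)
        (j := j) (b := P.arr t.mem 2 (p * (P.K + 1) + j)) hj c2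
        (by simp [hu, hpre', block, exec]) (by simp [hu, hpre', block, exec, t3])
        (by simp [hu, hpre', block, exec, BinOp.eval, e7, e11, e20, e52, t3, c1])
      have z54 : z.reg 54 = j := by
        rw [z3 _ (by omega)]; simp [hu, hpre', block, exec, t3]
      have z13 : z.reg 13 = 1 := by rw [z3 _ (by omega), hur _ (by omega), hct.r13]
      refine ⟨_, (TriD.seq h1 (TriD.seq z1 (triD_exec _ _ ?_))).mono ?_, ?_, ?_, ?_, ?_, ?_⟩
      · simp [Safe, BinOp.eval, z54, z13]; omega
      · simp [hpre', block, Prog.time]; omega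
      · intro a ha
        change z.mem a = _
        rw [z2 a, hum, t1 a ha]
        rintro i hi rfl
        exact ha (Par.region_arr _ (by omega))
      · intro y hy
        rw [exec_reg_of_above (L := 53) _ _ (by simp [Prog.Above]) _ hy, z3 y (by omega),
          hur y hy, t2 y hy]
      · simp [exec, z54, z13, BinOp.eval]
      · omega
      · intro i hi j' hj'
        change P.arr z.mem 2 _ = _
        by_cases hjj : j' = j
        · subst hjj
          rw [z4 i hi, hd3, v5 i hi, hum, t5 i hi _ hj, t5 p hpos _ hj, if_neg (by omega),
            if_neg (by omega), if_pos (by omega)]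
        · have : P.arr z.mem 2 (i * (P.K + 1) + j') = P.arr t.mem 2 (i * (P.K + 1) + j') := by
            rw [Par.arr, z2, hum, Par.arr]
            intro i' hi' h
            exact hjj (Par.idx_inj hj' hj
              (by omega : i * (P.K + 1) + j' = i' * (P.K + 1) + j)).2
          rw [this, t5 i hi j' hj']
          congr 1
          simp only [eq_iff_iff]
          omega
    · refine ⟨fun _ _ => rfl, ?_, ?_, by omega, ?_⟩
      · intro y hy
        exact exec_reg_of_above (L := 53) _ _ (by simp [Prog.Above]) _ hy
      · simp [exec]
      · intro i hi j hj
        rw [if_neg (by omega)]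
        exact Par.arr_congr (by omega) (fun a ha => v2 a (by omega)) _
  obtain ⟨t1, t2, t3, t4, t5⟩ := hI
  refine ⟨s2, (TriD.seq h1 (TriD.seq v1 (TriD.seq (triD_exec _ _ ?_) h2))).mono ?_, ?_, ?_, ?_⟩
  · simp [Safe]
  · simp only [hpre, block, Prog.time]
    nlinarith
  · intro a ha ha'
    rw [t1 a ha, v2 a ha']
  · intro y hy
    rw [t2 y (by omega), v3 y hy]
  · intro i hi j hj
    rw [t5 i hi j hj, if_pos hj]

end Elimination

/-! ### Elimination over `𝔽₂` -/

section Model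

variable {n : ℕ}

/-- Pairs of a vector and a label. A pair `(v, b)` also stands for the affine form `⟨x, v⟩ + b y` of
a sample `(x, y)`; the equation of a secret `v` is that of `(v, 1)`. -/
abbrev Vec (n : ℕ) : Type := (Fin n → ZMod 2) × ZMod 2

/-- The scalar product of two pairs. -/
def dotp (a b : Vec n) : ZMod 2 := a.1 ⬝ᵥ b.1 + a.2 * b.2

theorem dotp_add (a b c : Vec n) : dotp a (b + c) = dotp a b + dotp a c := by
  simp [dotp, dotProduct_add, mul_add]; ring

theorem dotp_smul (a b : Vec n) (x : ZMod 2) : dotp a (x • b) = x * dotp a b := by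
  simp [dotp, dotProduct_smul]; ring

theorem dotp_sum {ι : Type*} (S : Finset ι) (a : Vec n) (f : ι → Vec n) :
    dotp a (∑ i ∈ S, f i) = ∑ i ∈ S, dotp a (f i) := by
  classical
  induction S using Finset.induction_on with
  | empty => simp [dotp]
  | insert i S hi ih => rw [Finset.sum_insert hi, Finset.sum_insert hi, dotp_add, ih]

theorem zmod_two_eq_one {a : ZMod 2} (h : a ≠ 0) : a = 1 := by
  revert a; decide

/-- The last one of the first `i` pairs that satisfies `p`, or the first pair if there is none. -/
def lastIdx (p : ℕ → Prop) [DecidablePred p] : ℕ → ℕ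
  | 0 => 0
  | i + 1 => if p i then i else lastIdx p i

theorem lastIdx_lt (p : ℕ → Prop) [DecidablePred p] (i : ℕ) : lastIdx p i < i + 1 := by
  induction i with
  | zero => simp [lastIdx]
  | succ i ih => rw [lastIdx]; split_ifs <;> omega

theorem lastIdx_lt' (p : ℕ → Prop) [DecidablePred p] (i : ℕ) : lastIdx p (i + 1) < i + 1 := by
  have := lastIdx_lt p i
  rw [lastIdx]; split_ifs <;> omega

theorem lastIdx_spec {p : ℕ → Prop} [DecidablePred p] {N i : ℕ} (hi : i < N) (hp : p i) :
    p (lastIdx p N) := by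
  induction N with
  | zero => omega
  | succ N ih =>
    rw [lastIdx]
    split_ifs with h
    · exact h
    · refine ih (lt_of_le_of_ne (by omega) ?_)
      rintro rfl
      exact h hp

theorem lastIdx_congr {p p' : ℕ → Prop} [DecidablePred p] [DecidablePred p'] {N : ℕ}
    (h : ∀ i < N, p i ↔ p' i) : lastIdx p N = lastIdx p' N := by
  induction N with
  | zero => rfl
  | succ N ih =>
    rw [lastIdx, lastIdx, ih fun i hi => h i (by omega)]
    simp only [h N (by omega)]

/-- Make the pairs `F 0, …, F K` orthogonal to `ρ`, by adding one of them that is not orthogonal to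
`ρ` to all pairs that are not, itself included. -/
def elimStep (K : ℕ) (ρ : Vec n) (F : ℕ → Vec n) : ℕ → Vec n := fun i =>
  F i + dotp ρ (F i) • F (lastIdx (fun i => dotp ρ (F i) ≠ 0) (K + 1))

/-- Elimination with the first `t` equations of a sequence. -/
def elimN (K : ℕ) (ρ : ℕ → Vec n) (F : ℕ → Vec n) : ℕ → ℕ → Vec n
  | 0 => F
  | t + 1 => elimStep K (ρ t) (elimN K ρ F t)

theorem elimN_congr {K : ℕ} {ρ ρ' : ℕ → Vec n} {F : ℕ → Vec n} {t : ℕ}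
    (h : ∀ i < t, ρ i = ρ' i) : elimN K ρ F t = elimN K ρ' F t := by
  induction t with
  | zero => rfl
  | succ t ih => rw [elimN, elimN, ih fun i hi => h i (by omega), h t (by omega)]

theorem dotp_elimN {K : ℕ} (ρ F : ℕ → Vec n) (T : ℕ) :
    ∀ t < T, ∀ i < K + 1, dotp (ρ t) (elimN K ρ F T i) = 0 := by
  induction T with
  | zero => intro t ht; omega
  | succ T ih =>
    intro t ht i hi
    rw [elimN, elimStep, dotp_add, dotp_smul]
    set G := elimN K ρ F T
    set p := lastIdx (fun i => dotp (ρ T) (G i) ≠ 0) (K + 1) with hp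
    rcases Nat.lt_succ_iff_lt_or_eq.mp ht with h | rfl
    · rw [ih t h i hi, ih t h p (lastIdx_lt' _ _), mul_zero, add_zero]
    · by_cases h : dotp (ρ t) (G i) = 0
      · rw [h, zero_mul, add_zero]
      · have h' : dotp (ρ t) (G p) ≠ 0 :=
          lastIdx_spec (p := fun i => dotp (ρ t) (G i) ≠ 0) hi h
        rw [zmod_two_eq_one h, zmod_two_eq_one h']
        decide

/-- A combination of the pairs that is orthogonal to all equations is unchanged by elimination. -/
theorem sum_elimN {K : ℕ} (ρ F : ℕ → Vec n) (σ : ℕ → ZMod 2) (T : ℕ)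
    (h : ∀ t < T, dotp (ρ t) (∑ i ∈ Finset.range (K + 1), σ i • F i) = 0) :
    ∑ i ∈ Finset.range (K + 1), σ i • elimN K ρ F T i = ∑ i ∈ Finset.range (K + 1), σ i • F i := by
  induction T with
  | zero => rfl
  | succ T ih =>
    have ih' := ih fun t ht => h t (by omega)
    rw [elimN]
    unfold elimStep
    simp only [smul_add, Finset.sum_add_distrib, ← mul_smul]
    rw [← Finset.sum_smul, ih']
    have := h T (by omega)
    rw [← ih', dotp_sum] at this
    simp only [dotp_smul] at this
    rw [this, zero_smul, add_zero]

theorem elimN_apply_eq_zero {K : ℕ} (ρ F : ℕ → Vec n) (S : Set (Fin n))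
    (hF : ∀ i < K + 1, ∀ x ∉ S, (F i).1 x = 0) (T : ℕ) :
    ∀ i < K + 1, ∀ x ∉ S, (elimN K ρ F T i).1 x = 0 := by
  induction T with
  | zero => exact hF
  | succ T ih =>
    intro i hi x hx
    simp only [elimN, elimStep, Prod.fst_add, Prod.smul_fst, Pi.add_apply, Pi.smul_apply]
    rw [ih i hi x hx, ih _ (lastIdx_lt' _ _) x hx]
    simp

/-- The vector that elimination with the first `T` equations proposes. -/
def solve (K : ℕ) (ρ F : ℕ → Vec n) (T : ℕ) : Fin n → ZMod 2 :=
  (elimN K ρ F T (lastIdx (fun i => (elimN K ρ F T i).2 ≠ 0) (K + 1))).1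

/-- If `v` satisfies the equations, and no other vector with support in `S` does, then elimination
finds `v`. -/
theorem solve_eq {K : ℕ} {ρ F : ℕ → Vec n} {T : ℕ} {σ : ℕ → ZMod 2} {v : Fin n → ZMod 2}
    {S : Set (Fin n)} (hσ : ∑ i ∈ Finset.range (K + 1), σ i • F i = (v, 1))
    (hF : ∀ i < K + 1, ∀ x ∉ S, (F i).1 x = 0)
    (hv : ∀ x ∉ S, v x = 0) (hρ : ∀ t < T, dotp (ρ t) (v, 1) = 0)
    (hker : ∀ w : Fin n → ZMod 2, (∀ x ∉ S, w x = 0) → w ≠ 0 → ∃ t < T, (ρ t).1 ⬝ᵥ w ≠ 0) :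
    solve K ρ F T = v := by
  set c := lastIdx (fun i => (elimN K ρ F T i).2 ≠ 0) (K + 1) with hc
  have hcK : c < K + 1 := lastIdx_lt' _ _
  have hsum := sum_elimN (K := K) ρ F σ T (by rwa [hσ])
  have h1 : ∃ i < K + 1, (elimN K ρ F T i).2 ≠ 0 := by
    by_contra! h
    have h2 := congrArg Prod.snd (hsum.trans hσ)
    rw [Prod.snd_sum, Finset.sum_eq_zero] at h2
    · exact zero_ne_one h2
    · intro i hi
      simp [h i (Finset.mem_range.mp hi)]
  obtain ⟨i, hi, hi'⟩ := h1
  have h2 : (elimN K ρ F T c).2 = 1 :=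
    zmod_two_eq_one (lastIdx_spec (p := fun i => (elimN K ρ F T i).2 ≠ 0) hi hi')
  change (elimN K ρ F T c).1 = v
  by_contra hne
  obtain ⟨t, ht, ht'⟩ := hker ((elimN K ρ F T c).1 - v)
    (fun x hx => by
      rw [Pi.sub_apply, elimN_apply_eq_zero ρ F S hF T c hcK x hx, hv x hx, sub_zero])
    (sub_ne_zero.mpr hne)
  apply ht'
  have h3 := dotp_elimN (K := K) ρ F T t ht c hcK
  have h4 := hρ t ht
  unfold dotp at h3 h4
  rw [h2] at h3
  rw [dotProduct_sub, sub_eq_zero]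
  exact add_right_cancel (h3.trans h4.symm)

end Model

/-! ### The matrix in memory -/

section Rep

variable {P : Par} {D : Data P.n P.m}

/-- The sample of a given number, and `0` for numbers out of range. -/
def row {n m : ℕ} (D : Data n m) (x : ℕ) : Vec n := if h : x < m then D ⟨x, h⟩ else 0

theorem cast_bitX {n m : ℕ} (D : Data n m) (x : ℕ) (y : Fin n) :
    ((D.bitX x y : ℕ) : ZMod 2) = (row D x).1 y := by
  unfold Data.bitX row
  by_cases h : x < m <;> simp [h]

theorem cast_bitX_of_le {n m : ℕ} (D : Data n m) (x : ℕ) {y : ℕ} (hy : n ≤ y) :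
    D.bitX x y = 0 := dif_neg (by omega)

theorem cast_bitY {n m : ℕ} (D : Data n m) (x : ℕ) : ((D.bitY x : ℕ) : ZMod 2) = (row D x).2 := by
  unfold Data.bitY row
  by_cases h : x < m <;> simp [h]

namespace Par
variable (P)

/-- The vector that a row of the matrix stands for. -/
def rowVec (μ : ℕ → ℕ) (i : ℕ) : Fin P.n → ZMod 2 := fun y =>
  ∑ j ∈ Finset.range P.K, if P.pos μ j = y then (P.arr μ 2 (i * (P.K + 1) + j) : ZMod 2) else 0

/-- The pair that a row of the matrix stands for. -/
def rowPair (μ : ℕ → ℕ) (i : ℕ) : Vec P.n :=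
  (P.rowVec μ i, (P.arr μ 2 (i * (P.K + 1) + P.K) : ZMod 2))

variable {P}

theorem cast_dotNat (μ : ℕ → ℕ) (i x l : ℕ) :
    ((P.dotNat D μ i x l : ℕ) : ZMod 2) = (row D x).1 ⬝ᵥ P.rowVec μ i + (row D x).2 * l := by
  unfold dotNat rowVec dotProduct
  rw [ZMod.natCast_mod]
  push_cast
  rw [cast_bitY]
  congr 1
  simp only [Finset.mul_sum]
  rw [Finset.sum_comm]
  refine Finset.sum_congr rfl fun j _ => ?_
  by_cases h : P.pos μ j < P.n
  · rw [Finset.sum_eq_single ⟨P.pos μ j, h⟩]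
    · rw [if_pos rfl, ← cast_bitX]
    · intro y _ hy
      rw [if_neg (fun h' => hy (Fin.ext h'.symm)), mul_zero]
    · simp
  · rw [cast_bitX_of_le D x (by omega), Nat.cast_zero, zero_mul, Finset.sum_eq_zero]
    intro y _
    rw [if_neg (by have := y.2; omega), mul_zero]

theorem cast_dotRow (μ : ℕ → ℕ) (x i : ℕ) :
    ((P.dotRow D μ x i : ℕ) : ZMod 2) = dotp (row D x) (P.rowPair μ i) :=
  cast_dotNat ..

theorem dotRow_pos_iff (μ : ℕ → ℕ) (x i : ℕ) :
    0 < P.dotRow D μ x i ↔ dotp (row D x) (P.rowPair μ i) ≠ 0 := by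
  rw [← cast_dotRow]
  have : P.dotRow D μ x i ≤ 1 := P.dotNat_le ..
  interval_cases P.dotRow D μ x i <;> simp

theorem pivotNat_eq (μ : ℕ → ℕ) (x i : ℕ) : P.pivotNat D μ x i =
    lastIdx (fun i => dotp (row D x) (P.rowPair μ i) ≠ 0) i := by
  induction i with
  | zero => rfl
  | succ i ih => rw [pivotNat, lastIdx, ih]; simp only [dotRow_pos_iff]

/-- The memory cells of the matrix represent the pairs `F`. -/
def Rep (P : Par) (μ : ℕ → ℕ) (F : ℕ → Vec P.n) : Prop := ∀ i < P.K + 1, P.rowPair μ i = F i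

theorem Rep.elim {μ μ' : ℕ → ℕ} {F : ℕ → Vec P.n} {x : ℕ} (h : P.Rep μ F)
    (h0 : ∀ a, P.region a = 0 → μ' a = μ a)
    (h2 : ∀ i < P.K + 1, ∀ j < P.K + 1, P.arr μ' 2 (i * (P.K + 1) + j) =
        (P.arr μ 2 (i * (P.K + 1) + j) + P.dotRow D μ x i *
          P.arr μ 2 (P.pivotNat D μ x (P.K + 1) * (P.K + 1) + j)) % 2) :
    P.Rep μ' (elimStep P.K (row D x) F) := by
  intro i hi
  have hp : P.pivotNat D μ x (P.K + 1) = lastIdx (fun i => dotp (row D x) (F i) ≠ 0) (P.K + 1) := by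
    rw [pivotNat_eq]
    exact lastIdx_congr fun i hi => by rw [h i hi]
  have hq : P.pivotNat D μ x (P.K + 1) < P.K + 1 := by rw [hp]; exact lastIdx_lt' _ _
  unfold elimStep
  rw [← hp, ← h i hi, ← h _ hq, ← cast_dotRow]
  ext y
  · simp only [rowPair, rowVec, Prod.fst_add, Prod.smul_fst, Pi.add_apply, Pi.smul_apply,
      smul_eq_mul, Finset.mul_sum]
    rw [← Finset.sum_add_distrib]
    refine Finset.sum_congr rfl fun j hj => ?_
    rw [pos_congr h0]
    split_ifs
    · rw [h2 i hi j (by have := Finset.mem_range.mp hj; omega), ZMod.natCast_mod]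
      push_cast
      rfl
    · simp
  · simp only [rowPair, Prod.snd_add, Prod.smul_snd, smul_eq_mul]
    rw [h2 i hi P.K (by omega), ZMod.natCast_mod]
    push_cast
    rfl

/-- Coordinate number `j` of the blocks `β`. -/
def posOf (P : Par) (β : ℕ → ℕ) (j : ℕ) : ℕ := β (j / P.g) * P.g + j % P.g

/-- The unit vectors of the chosen coordinates, and the unit label. -/
def initF (P : Par) (β : ℕ → ℕ) (i : ℕ) : Vec P.n :=
  (fun y => if i < P.K ∧ P.posOf β i = y then 1 else 0, if i = P.K then 1 else 0)

theorem rep_init {μ : ℕ → ℕ} {β : ℕ → ℕ} (hβ : ∀ x < P.k, P.arr μ 0 x = β x)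
    (h2 : ∀ i < P.K + 1, ∀ j < P.K + 1,
      P.arr μ 2 (i * (P.K + 1) + j) = if i = j then 1 else 0) : P.Rep μ (P.initF β) := by
  intro i hi
  ext y
  · simp only [rowPair, rowVec, initF]
    rw [Finset.sum_congr rfl (g := fun j => if i = j then if P.posOf β i = y then 1 else 0 else 0)]
    · rw [Finset.sum_ite_eq]
      simp only [Finset.mem_range]
      split_ifs <;> simp_all
    · intro j hj
      have hj := Finset.mem_range.mp hj
      rw [h2 i hi j (by omega)]
      have : P.pos μ j = P.posOf β j := by
        unfold pos posOf
        rw [hβ]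
        rw [Nat.div_lt_iff_lt_mul P.g_pos]
        exact hj
      rw [this]
      by_cases hij : i = j
      · subst hij; simp
      · simp [hij]
  · simp only [rowPair, initF]
    rw [h2 i hi P.K (by omega)]
    split_ifs <;> simp

/-- The vector proposed for blocks `β` and samples `R`. -/
def cand (P : Par) (D : Data P.n P.m) (β R : ℕ → ℕ) : Fin P.n → ZMod 2 :=
  solve P.K (fun t => row D (R t)) (P.initF β) P.r

end Par
end Rep

/-! ### Random sequences in memory -/

section Uniform

/-- Independent uniform draws from `α` and `β` make a uniform draw from `γ ≃ α × β`. -/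
theorem uniform_bind_map {α β γ : Type*} [Fintype α] [Nonempty α] [Fintype β] [Nonempty β]
    [Fintype γ] [Nonempty γ] (e : α × β ≃ γ) :
    ((PMF.uniformOfFintype α).bind fun a => (PMF.uniformOfFintype β).map fun b => e (a, b)) =
      PMF.uniformOfFintype γ := by
  classical
  ext c
  rw [PMF.bind_apply, tsum_fintype]
  simp only [PMF.map_apply, PMF.uniformOfFintype_apply, tsum_fintype]
  rw [Finset.sum_eq_single (e.symm c).1]
  · rw [Finset.sum_eq_single (e.symm c).2]
    · rw [if_pos (by simp), ← Fintype.card_congr e, Fintype.card_prod, Nat.cast_mul,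
        ENNReal.mul_inv (by simp) (by simp)]
    · intro b _ hb
      rw [if_neg]
      intro h
      exact hb (congrArg Prod.snd ((e.symm_apply_eq).mpr h)).symm
    · simp
  · intro a _ ha
    rw [Finset.sum_eq_zero, mul_zero]
    intro b _
    rw [if_neg]
    intro h
    exact ha (congrArg Prod.fst ((e.symm_apply_eq).mpr h)).symm
  · simp

theorem uniform_fin_succ (i N : ℕ) [NeZero N] :
    ((PMF.uniformOfFintype (Fin N)).bind fun u =>
      (PMF.uniformOfFintype (Fin i → Fin N)).map fun f => (Fin.cons u f : Fin (i + 1) → Fin N)) =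
      PMF.uniformOfFintype (Fin (i + 1) → Fin N) :=
  uniform_bind_map (Fin.consEquiv fun _ : Fin (i + 1) => Fin N)

end Uniform

section Fill

open Prog BinOp

variable {P : Par} {w : ℕ} {D : Data P.n P.m}

/-- The step `rand`, with the range rewritten: its type in the definition of `step` depends on the
store. -/
theorem step_rand (r a N : ℕ) (s : Store) (h : s.reg a = N + 1) (l : List Prog) :
    step w D (.rand r a :: l, s) =
      (PMF.uniformOfFintype (Fin (N + 1))).map fun u : Fin (N + 1) => (l, s.setReg w r (u : ℕ)) := by
  have key : ∀ M, M = N → (PMF.uniformOfFintype (Fin (M + 1))).map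
      (fun u : Fin (M + 1) => (l, s.setReg w r (u : ℕ))) = (PMF.uniformOfFintype (Fin (N + 1))).map
      fun u : Fin (N + 1) => (l, s.setReg w r (u : ℕ)) := by
    rintro _ rfl; rfl
  rw [← key (s.reg a - 1) (by omega), step]
  exact PMF.map_comp (fun u : Fin (s.reg a - 1 + 1) => (u : ℕ)) _ _

theorem Tri.rand {r a N : ℕ} [NeZero N] {s : Store} (h : s.reg a = N) (hN : N ≤ 2 ^ w) :
    Tri w D (.rand r a) s 1
      ((PMF.uniformOfFintype (Fin N)).map fun u : Fin N => s.put r (u : ℕ)) := by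
  obtain ⟨N', rfl⟩ : ∃ N', N = N' + 1 := ⟨N - 1, by have := NeZero.ne N; omega⟩
  intro l t' ν hν T hT
  obtain ⟨T, rfl⟩ : ∃ T', T = T' + 1 := ⟨T - 1, by omega⟩
  rw [run, step_rand r a N' s h, PMF.bind_map, PMF.bind_map, PMF.map_bind]
  congr 1
  funext u
  have hu : (u : ℕ) < 2 ^ w := by have := u.2; omega
  simp only [Function.comp]
  rw [Store.setReg_eq hu]
  refine hν _ ?_ T (by omega)
  rw [PMF.mem_support_map_iff]
  exact ⟨u, by simp, rfl⟩

/-- Write a random element of `{0, …, reg r - 1}` to entry `reg 50` of an array. -/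
def fillBody (b r : ℕ) : Prog :=
  .seq (block [op mul 51 50 11, op add 51 51 b]) (.seq (.rand 52 r)
    (block [store 51 52, op add 50 50 13]))

/-- Fill an array that starts at `reg b` and has length `reg c` with random elements of
`{0, …, reg r - 1}`. -/
def fillProg (b c r : ℕ) : Prog := .seq (const 50 0) (loop 50 c (fillBody b r))

theorem fillBody_spec (hw : P.Fits w) {b r N ρ j : ℕ} [NeZero N] (hb : b < 30) (hr : r < 30)
    (hρ : ρ < 8) (hN : N ≤ P.X) {s : Store} (hcs : P.Consts s) (hsb : s.reg b = P.n + ρ)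
    (hsr : s.reg r = N) (hj : s.reg 50 = j) (hjX : j < P.X) :
    ∃ S : Fin N → Store, Tri w D (fillBody b r) s 20 ((PMF.uniformOfFintype (Fin N)).map S) ∧
      ∀ u, (∀ a, a ≠ P.n + 8 * j + ρ → (S u).mem a = s.mem a) ∧
        (∀ y < 50, (S u).reg y = s.reg y) ∧ (S u).reg 50 = j + 1 ∧
        P.arr (S u).mem ρ j = u := by
  have hw0 := hw.ne_zero
  unfold Par.Fits at hw
  have hX := P.eight_le_X
  have hXX : 8 * P.X ≤ P.X * P.X := Nat.mul_le_mul_right _ hX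
  have hnX := P.n_le_X
  have e11 := hcs.r11; have e13 := hcs.r13
  have hb' : b ≠ 51 := by omega
  set pre := block [op mul 51 50 11, op add 51 51 b] with hpre
  have h1 := triD_exec (w := w) (D := D) pre s (by
    simp [hpre, block, Safe, exec, BinOp.eval, e11, hj, hb', hsb]; omega)
  have hur : ∀ y < 50, (exec D pre s).reg y = s.reg y :=
    fun y hy => exec_reg_of_above pre s (by simp [hpre, block, Prog.Above]) y hy
  have h2 : Tri w D (.rand 52 r) (exec D pre s) 1
    ((PMF.uniformOfFintype (Fin N)).map fun u : Fin N => (exec D pre s).put 52 (u : ℕ)) :=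
    Tri.rand (by rw [hur _ (by omega), hsr]) (by omega)
  set post := block [store 51 52, op add 50 50 13] with hpost
  refine ⟨fun u => exec D post ((exec D pre s).put 52 u), ?_, ?_⟩
  · have h3 : Tri w D (.seq (.rand 52 r) post) (exec D pre s) _ _ :=
      Tri.seq (ν := fun s' => PMF.pure (exec D post s')) (t' := post.time) h2 (by
      intro s' hs'
      rw [PMF.mem_support_map_iff] at hs'
      obtain ⟨u, _, rfl⟩ := hs'
      have := u.2
      refine triD_exec _ _ ?_
      simp [hpre, hpost, block, Safe, exec, BinOp.eval, e13, hj]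
      omega)
    rw [PMF.bind_map] at h3
    exact (h1.seqTri h3).mono (by simp [hpre, hpost, block, Prog.time])
  · intro u
    refine ⟨?_, ?_, ?_, ?_⟩
    · intro a ha
      have : a ≠ j * 8 + (P.n + ρ) := by omega
      simp [hpre, hpost, block, exec, BinOp.eval, e11, hj, hb', hsb, this]
    · intro y hy
      rw [exec_reg_of_above (L := 50) _ _ (by simp [hpost, block, Prog.Above]) _ hy, Store.reg_put,
        if_neg (by omega), hur y hy]
    · simp [hpre, hpost, block, exec, BinOp.eval, e13, hj]
    · have : P.n + 8 * j + ρ = j * 8 + (P.n + ρ) := by ring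
      simp [Par.arr, this, hpre, hpost, block, exec, BinOp.eval, e11, hj, hb', hsb]

theorem fillLoop_spec (hw : P.Fits w) {b c r N L ρ : ℕ} [NeZero N] (hb : b < 30) (hc : c < 30)
    (hr : r < 30) (hρ : ρ < 8) (hN : N ≤ P.X) (hL : L ≤ P.X) (i : ℕ) :
    ∀ (j : ℕ) (s : Store), i + j = L → P.Consts s → s.reg b = P.n + ρ → s.reg c = L →
      s.reg r = N → s.reg 50 = j →
      ∃ S : (Fin i → Fin N) → Store, Tri w D (loop 50 c (fillBody b r)) s (i * 21 + 1)
        ((PMF.uniformOfFintype (Fin i → Fin N)).map S) ∧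
        ∀ f, (∀ a, (∀ x, j ≤ x → a ≠ P.n + 8 * x + ρ) → (S f).mem a = s.mem a) ∧
          (∀ y < 50, (S f).reg y = s.reg y) ∧ ∀ x : Fin i, P.arr (S f).mem ρ (j + x) = f x := by
  induction i with
  | zero =>
    intro j s hij _ _ hsc _ hj
    refine ⟨fun _ => s, ?_, fun f => ⟨fun _ _ => rfl, fun _ _ => rfl, fun x => x.elim0⟩⟩
    have : (PMF.uniformOfFintype (Fin 0 → Fin N)).map (fun _ => s) = PMF.pure s :=
      PMF.map_const _ _
    rw [this]
    exact (TriD.loop_done (by omega)).mono (by omega)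
  | succ i ih =>
    intro j s hij hcs hsb hsc hsr hj
    obtain ⟨S, h1, h2⟩ := fillBody_spec (D := D) hw hb hr hρ hN hcs hsb hsr hj (by omega)
    have key : ∀ u, _ := fun u : Fin N => ih (j + 1) (S u) (by omega)
      (hcs.congr (L := 50) (by omega) (h2 u).2.1) (by rw [(h2 u).2.1 _ (by omega), hsb])
      (by rw [(h2 u).2.1 _ (by omega), hsc]) (by rw [(h2 u).2.1 _ (by omega), hsr]) (h2 u).2.2.1
    choose S' h3 h4 using key
    -- The store reveals the number drawn, so the rest of the run can be described by it.
    have hinj : ∀ u u', S u = S u' → u = u' := by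
      intro u u' h
      have e1 := (h2 u).2.2.2
      rw [h, (h2 u').2.2.2] at e1
      exact Fin.ext e1.symm
    have h5 : Tri w D (loop 50 c (fillBody b r)) s (1 + 20 + (i * 21 + 1))
        (((PMF.uniformOfFintype (Fin N)).map S).bind fun s' =>
          (PMF.uniformOfFintype (Fin i → Fin N)).map (S' (Function.invFun S s'))) := by
      refine Tri.loop_next (by omega) h1 ?_
      intro s' hs'
      rw [PMF.mem_support_map_iff] at hs'
      obtain ⟨u, _, rfl⟩ := hs'
      rw [Function.leftInverse_invFun hinj u]
      exact h3 u
    rw [PMF.bind_map] at h5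
    refine ⟨fun f => S' (f 0) (Fin.tail f), ?_, ?_⟩
    · rw [← uniform_fin_succ, PMF.map_bind]
      simp only [PMF.map_comp]
      refine Eq.mp ?_ (h5.mono (t' := (i + 1) * 21 + 1) (by omega))
      congr 2
      funext u
      simp only [Function.comp]
      rw [Function.leftInverse_invFun hinj u]
      rfl
    · intro f
      obtain ⟨e1, e2, e3, e4⟩ := h2 (f 0)
      obtain ⟨g1, g2, g3⟩ := h4 (f 0) (Fin.tail f)
      refine ⟨fun a ha => ?_, fun y hy => ?_, fun x => ?_⟩
      · rw [g1 a fun x hx => ha x (by omega), e1 a (ha j le_rfl)]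
      · rw [g2 y hy, e2 y hy]
      · refine Fin.cases ?_ (fun x => ?_) x
        · rw [Fin.val_zero, add_zero, Par.arr, g1 _ fun x hx => by omega]
          exact e4
        · rw [Fin.val_succ, show j + (x + 1 : ℕ) = j + 1 + x by omega]
          exact g3 x

theorem fillProg_spec (hw : P.Fits w) {b c r N L ρ : ℕ} [NeZero N] (hb : b < 30) (hc : c < 30)
    (hr : r < 30) (hρ : ρ < 8) (hN : N ≤ P.X) (hL : L ≤ P.X) {s : Store} (hcs : P.Consts s)
    (hsb : s.reg b = P.n + ρ) (hsc : s.reg c = L) (hsr : s.reg r = N) :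
    ∃ S : (Fin L → Fin N) → Store, Tri w D (fillProg b c r) s (L * 21 + 3)
      ((PMF.uniformOfFintype (Fin L → Fin N)).map S) ∧
      ∀ f, (∀ a, P.region a ≠ ρ → (S f).mem a = s.mem a) ∧
        (∀ y < 50, (S f).reg y = s.reg y) ∧ ∀ x : Fin L, P.arr (S f).mem ρ x = f x := by
  have h1 := triD_exec (w := w) (D := D) (const 50 0) s (by simp [Safe])
  have hur : ∀ y < 50, (exec D (const 50 0) s).reg y = s.reg y :=
    fun y hy => exec_reg_of_above _ s (by simp [Prog.Above]) y hy
  obtain ⟨S, h2, h3⟩ := fillLoop_spec (D := D) hw hb hc hr hρ hN hL L 0 (exec D (const 50 0) s)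
    (by omega) (hcs.congr (L := 50) (by omega) hur) (by rw [hur _ (by omega), hsb])
    (by rw [hur _ (by omega), hsc]) (by rw [hur _ (by omega), hsr]) (by simp [exec])
  refine ⟨S, (h1.seqTri h2).mono (by simp [Prog.time]; omega), fun f => ⟨fun a ha => ?_, fun y hy => ?_, fun x => ?_⟩⟩
  · rw [(h3 f).1 a]
    · rfl
    · rintro x _ rfl
      exact ha (Par.region_arr _ hρ)
  · rw [(h3 f).2.1 y hy, hur y hy]
  · have := (h3 f).2.2 x
    rwa [zero_add] at this

end Fill

/-! ### Proposals -/

section Generate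

open Prog BinOp

variable {P : Par} {w : ℕ} {D : Data P.n P.m}

theorem Par.MemOK.of_entries {μ : ℕ → ℕ} (h0 : ∀ x < P.k, P.arr μ 0 x < P.Q)
    (h2 : ∀ i < P.K + 1, ∀ j < P.K + 1, P.arr μ 2 (i * (P.K + 1) + j) ≤ 1) : P.MemOK μ := by
  refine ⟨h0, fun y hy => ?_⟩
  have h := h2 _ (Nat.div_lt_of_lt_mul hy) _ (Nat.mod_lt y (by omega))
  rwa [Nat.div_add_mod'] at h

/-- Set entry `reg 40` of the matrix. With truncated subtraction, `1 - ((i - j) + (j - i))` is `1`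
if `i = j` and `0` otherwise. -/
def initBody : Prog :=
  block [op div 41 40 7, op mod 42 40 7, op sub 43 41 42, op sub 44 42 41, op add 43 43 44,
    op sub 43 13 43, op mul 44 40 11, op add 44 44 20, store 44 43, op add 40 40 13]

/-- Set the matrix to the unit matrix. -/
def initProg : Prog := .seq (const 40 0) (loop 40 15 initBody)

theorem initProg_spec (hw : P.Fits w) {s : Store} (hc : P.Consts s) :
    ∃ s', TriD w D initProg s ((P.K + 1) * (P.K + 1) * 22 + 3) s' ∧
      (∀ a, P.region a ≠ 2 → s'.mem a = s.mem a) ∧ (∀ y < 40, s'.reg y = s.reg y) ∧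
      ∀ i < P.K + 1, ∀ j < P.K + 1,
        P.arr s'.mem 2 (i * (P.K + 1) + j) = if i = j then 1 else 0 := by
  have hw0 := hw.ne_zero
  unfold Par.Fits at hw
  have hX := P.eight_le_X
  have hXX : 8 * P.X ≤ P.X * P.X := Nat.mul_le_mul_right _ hX
  have hKX := P.K_lt_X
  have hKK : (P.K + 1) * (P.K + 1) ≤ P.X * P.X := Par.sq_le_X hKX hKX
  have hnX := P.n_le_X
  have h1 := triD_exec (w := w) (D := D) (const 40 0) s (by simp [Safe])
  have hur : ∀ y < 40, (exec D (const 40 0) s).reg y = s.reg y :=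
    fun y hy => exec_reg_of_above _ s (by simp [Prog.Above]) y hy
  let Inv : ℕ → Store → Prop := fun j t =>
    (∀ a, P.region a ≠ 2 → t.mem a = s.mem a) ∧
    (∀ y < 40, t.reg y = s.reg y) ∧ t.reg 40 = j ∧ j ≤ (P.K + 1) * (P.K + 1) ∧
    ∀ x < j, P.arr t.mem 2 x = if x / (P.K + 1) = x % (P.K + 1) then 1 else 0
  obtain ⟨s2, h2, t1, t2, t3, t4, t5⟩ : ∃ s', TriD w D (loop 40 15 initBody) (exec D (const 40 0) s)
      ((P.K + 1) * (P.K + 1) * (1 + 21) + 1) s' ∧ Inv ((P.K + 1) * (P.K + 1)) s' := by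
    refine TriD.forLoop Inv (fun j t ht => ⟨ht.2.2.1, by rw [ht.2.1 15 (by omega), hc.r15]⟩) ?_ ?_
    · rintro j hj t ⟨t1, t2, t3, t4, t5⟩
      have hct : P.Consts t := hc.congr (L := 40) (by omega) t2
      have e7 := hct.r7; have e11 := hct.r11; have e20 := hct.r20; have e13 := hct.r13
      have b1 : j / (P.K + 1) ≤ j := Nat.div_le_self _ _
      have b2 : j % (P.K + 1) ≤ j := Nat.mod_le _ _
      have b3 := Nat.sub_le (j % (P.K + 1)) (j / (P.K + 1))
      have b4 := Nat.sub_le (j / (P.K + 1)) (j % (P.K + 1))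
      refine ⟨exec D initBody t, (triD_exec _ _ ?_).mono (by simp [initBody, block, Prog.time]),
        ?_, ?_, ?_, hj, ?_⟩
      · simp [initBody, block, Safe, exec, BinOp.eval, e7, e11, e20, e13, t3]
        omega
      · intro a ha
        have h1 : a ≠ j * 8 + (P.n + 2) := by
          rintro rfl
          apply ha
          rw [show j * 8 + (P.n + 2) = P.n + 8 * j + 2 by ring, Par.region_arr _ (by omega)]
        simp [initBody, block, exec, BinOp.eval, e7, e11, e20, e13, t3, h1]
        exact t1 a ha
      · intro y hy
        rw [exec_reg_of_above (L := 40) _ _ (by simp [initBody, block, Prog.Above]) _ hy, t2 y hy]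
      · simp [initBody, block, exec, BinOp.eval, e13, t3]
      · intro x hx
        rw [Par.arr]
        simp [initBody, block, exec, BinOp.eval, e7, e11, e20, e13, t3]
        by_cases hxj : x = j
        · subst hxj
          rw [if_pos (by ring)]
          split_ifs with h
          · omega
          · omega
        · rw [if_neg (by omega)]
          exact t5 x (by omega)
    · exact ⟨fun _ _ => rfl, hur, by simp [exec], by omega, fun i hi => absurd hi (by omega)⟩
  refine ⟨s2, (h1.seq h2).mono (by simp [Prog.time]; omega), t1, t2, fun i hi j hj => ?_⟩
  rw [t5 _ (Par.idx_lt hi hj)]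
  have h3 : (i * (P.K + 1) + j) / (P.K + 1) = i := by
    rw [mul_comm, Nat.mul_add_div (by omega), Nat.div_eq_of_lt hj, add_zero]
  rw [h3, mul_comm, Nat.mul_add_mod, Nat.mod_eq_of_lt hj]

/-- Eliminate with chosen sample number `reg 40`. -/
def rowsBody : Prog :=
  .seq (block [op mul 41 40 11, op add 41 41 19, load 61 41]) (.seq elimProg (op add 40 40 13))

/-- Eliminate with all chosen samples. -/
def rowsProg : Prog := .seq (const 40 0) (loop 40 8 rowsBody)

theorem rowsProg_spec (hw : P.Fits w) {s : Store} (hc : P.Consts s) (hm : P.MemOK s.mem)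
    {F : ℕ → Vec P.n} {R : ℕ → ℕ} (hF : P.Rep s.mem F) (hR : ∀ t < P.r, P.arr s.mem 1 t = R t)
    (hR1 : ∀ t < P.r, R t < P.m1) :
    ∃ s', TriD w D rowsProg s (P.r * ((P.K + 1) * (P.K * 80 + 200) + 120) + 3) s' ∧
      (∀ a, P.region a ≠ 2 → P.region a ≠ 3 → s'.mem a = s.mem a) ∧
      (∀ y < 40, s'.reg y = s.reg y) ∧ P.MemOK s'.mem ∧
      P.Rep s'.mem (elimN P.K (fun t => row D (R t)) F P.r) := by
  have hw0 := hw.ne_zero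
  have hw' := hw
  unfold Par.Fits at hw
  have hX := P.eight_le_X
  have hXX : 8 * P.X ≤ P.X * P.X := Nat.mul_le_mul_right _ hX
  have hrX := P.r_le_X
  have hmX := P.m1_le_X
  have hnX := P.n_le_X
  have h1 := triD_exec (w := w) (D := D) (const 40 0) s (by simp [Safe])
  have hur : ∀ y < 40, (exec D (const 40 0) s).reg y = s.reg y :=
    fun y hy => exec_reg_of_above _ s (by simp [Prog.Above]) y hy
  let Inv : ℕ → Store → Prop := fun j t =>
    (∀ a, P.region a ≠ 2 → P.region a ≠ 3 → t.mem a = s.mem a) ∧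
    (∀ y < 40, t.reg y = s.reg y) ∧ t.reg 40 = j ∧ j ≤ P.r ∧ P.MemOK t.mem ∧
    P.Rep t.mem (elimN P.K (fun t => row D (R t)) F j)
  obtain ⟨s2, h2, t1, t2, t3, t4, t5, t6⟩ : ∃ s', TriD w D (loop 40 8 rowsBody)
      (exec D (const 40 0) s)
      (P.r * (1 + ((P.K + 1) * (P.K * 80 + 200) + 119)) + 1) s' ∧ Inv P.r s' := by
    refine TriD.forLoop Inv (fun j t ht => ⟨ht.2.2.1, by rw [ht.2.1 8 (by omega), hc.r8]⟩) ?_ ?_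
    · rintro j hj t ⟨t1, t2, t3, t4, t5, t6⟩
      have hct : P.Consts t := hc.congr (L := 40) (by omega) t2
      have e19 := hct.r19; have e11 := hct.r11; have e13 := hct.r13
      have c1 : t.mem (j * 8 + (P.n + 1)) = R j := by
        rw [← hR j hj, t1, Par.arr]
        · congr 1; ring
        all_goals
          rw [show j * 8 + (P.n + 1) = P.n + 8 * j + 1 by ring, Par.region_arr _ (by omega)]
          omega
      have c2 := hR1 j hj
      set pre := block [op mul 41 40 11, op add 41 41 19, load 61 41] with hpre
      have h1 := triD_exec (w := w) (D := D) pre t (by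
        simp [hpre, block, Safe, exec, BinOp.eval, e19, e11, t3, c1]; omega)
      have hur : ∀ y < 41, (exec D pre t).reg y = t.reg y :=
        fun y hy => exec_reg_of_above pre t (by simp [hpre, block, Prog.Above]) y hy
      obtain ⟨v, v1, v2, v3, v4⟩ := elimProg_spec (D := D) hw' (s := exec D pre t) (x := R j)
        (hct.congr (L := 41) (by omega) hur) t5
        (by simp [hpre, block, exec, BinOp.eval, e19, e11, t3, c1])
      have v40 : v.reg 40 = j := by rw [v3 _ (by omega), hur _ (by omega), t3]
      have v13 : v.reg 13 = 1 := by rw [v3 _ (by omega), hur _ (by omega), e13]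
      refine ⟨_, (TriD.seq h1 (TriD.seq v1 (triD_exec _ _ ?_))).mono ?_, ?_, ?_, ?_, hj, ?_, ?_⟩
      · simp [Safe, BinOp.eval, v40, v13]; omega
      · simp [hpre, block, Prog.time]; omega
      · intro a ha ha'
        exact (v2 a ha ha').trans (t1 a ha ha')
      · intro y hy
        rw [exec_reg_of_above (L := 40) _ _ (by simp [Prog.Above]) _ hy, v3 y (by omega),
          hur y (by omega), t2 y hy]
      · simp [exec, BinOp.eval, v40, v13]
      · refine Par.MemOK.of_entries (fun x hx => ?_) fun i hi j hj => ?_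
        · change P.arr v.mem 0 x < _
          rw [Par.arr_congr (by omega) fun a ha => v2 a (by omega) (by omega)]
          exact t5.blocks x hx
        · exact (v4 i hi j hj).trans_le (by omega)
      · exact Par.Rep.elim t6 (fun a ha => v2 a (by omega) (by omega)) v4
    · exact ⟨fun _ _ _ => rfl, hur, by simp [exec], by omega, hm, hF⟩
  exact ⟨s2, (h1.seq h2).mono (by simp [Prog.time]; ring_nf; omega), t1, t2, t5, t6⟩

/-- If row `reg 40` has last entry `1`, then write its number to register `45`. -/
def selectBody : Prog :=
  block [op mul 41 40 7, op add 41 41 6, op mul 41 41 11, op add 41 41 20, load 41 41,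
    op sub 42 40 45, op mul 42 42 41, op add 45 45 42, op add 40 40 13]

/-- Choose a row of the matrix that represents a pair with label `1`, and start testing it. -/
def selectProg : Prog :=
  .seq (block [const 40 0, const 45 0]) (.seq (loop 40 7 selectBody)
    (block [op add 31 45 12, op add 32 9 12, const 33 0, const 30 1]))

theorem selectProg_spec (hw : P.Fits w) {s : Store} (hc : P.Consts s) (hm : P.MemOK s.mem)
    {F : ℕ → Vec P.n} (hF : P.Rep s.mem F) :
    ∃ s', TriD w D selectProg s ((P.K + 1) * 20 + 30) s' ∧ s'.mem = s.mem ∧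
      (∀ y < 30, s'.reg y = s.reg y) ∧ s'.reg 34 = s.reg 34 ∧ s'.reg 35 = s.reg 35 ∧
      s'.reg 30 = 1 ∧ s'.reg 31 = lastIdx (fun i => (F i).2 ≠ 0) (P.K + 1) ∧ s'.reg 32 = P.m1 ∧
      s'.reg 33 = 0 := by
  have hw0 := hw.ne_zero
  obtain ⟨g, hg⟩ : ∃ g, g = lastIdx (fun i => (F i).2 ≠ 0) := ⟨_, rfl⟩
  have hg0 : g 0 = 0 := by rw [hg]; rfl
  rw [← hg]
  unfold Par.Fits at hw
  have hX := P.eight_le_X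
  have hXX : 8 * P.X ≤ P.X * P.X := Nat.mul_le_mul_right _ hX
  have hKX := P.K_lt_X
  have hmX := P.m1_le_X
  have hnX := P.n_le_X
  set pre := block [const 40 0, const 45 0] with hpre
  have h1 := triD_exec (w := w) (D := D) pre s (by simp [hpre, block, Safe])
  have hur : ∀ y < 40, (exec D pre s).reg y = s.reg y :=
    fun y hy => exec_reg_of_above _ s (by simp [hpre, block, Prog.Above]) y hy
  let Inv : ℕ → Store → Prop := fun j t => t.mem = s.mem ∧
    (∀ y < 40, t.reg y = s.reg y) ∧ t.reg 40 = j ∧ j ≤ P.K + 1 ∧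
    t.reg 45 = g j
  obtain ⟨s2, h2, t1, t2, t3, t4, t5⟩ : ∃ s', TriD w D (loop 40 7 selectBody) (exec D pre s)
      ((P.K + 1) * (1 + 19) + 1) s' ∧ Inv (P.K + 1) s' := by
    refine TriD.forLoop Inv (fun j t ht => ⟨ht.2.2.1, by rw [ht.2.1 7 (by omega), hc.r7]⟩) ?_ ?_
    · rintro j hj t ⟨t1, t2, t3, t4, t5⟩
      have hct : P.Consts t := hc.congr (L := 40) (by omega) t2
      have e6 := hct.r6; have e7 := hct.r7; have e11 := hct.r11; have e20 := hct.r20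
      have e13 := hct.r13
      have hjK : j * (P.K + 1) ≤ P.X * P.X := Par.sq_le_X (by omega) hKX
      have c1 : t.mem ((j * (P.K + 1) + P.K) * 8 + (P.n + 2)) =
          P.arr s.mem 2 (j * (P.K + 1) + P.K) := by
        rw [t1, Par.arr]; congr 1; ring
      have c2 := hm.matrix _ (Par.idx_lt hj (show P.K < P.K + 1 by omega))
      have c3 : g j < j + 1 := by rw [hg]; exact lastIdx_lt _ _
      have c4 : (j - g j) * P.arr s.mem 2 (j * (P.K + 1) + P.K) ≤
        (j - g j) * 1 := Nat.mul_le_mul_left _ c2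
      refine ⟨exec D selectBody t, (triD_exec _ _ ?_).mono (by simp [selectBody, block, Prog.time]),
        t1, ?_, ?_, hj, ?_⟩
      · simp [selectBody, block, Safe, exec, BinOp.eval, e6, e7, e11, e20, e13, t3, c1, t5]
        omega
      · intro y hy
        rw [exec_reg_of_above (L := 40) _ _ (by simp [selectBody, block, Prog.Above]) _ hy, t2 y hy]
      · simp [selectBody, block, exec, BinOp.eval, e13, t3]
      · have c5 : (F j).2 = (P.arr s.mem 2 (j * (P.K + 1) + P.K) : ZMod 2) := by
          rw [← hF j hj]; rfl
        have c6 : g (j + 1) = if (F j).2 ≠ 0 then j else g j := by rw [hg, lastIdx]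
        rw [c6, c5]
        simp [selectBody, block, exec, BinOp.eval, e6, e7, e11, e20, e13, t3, c1, t5]
        generalize P.arr s.mem 2 (j * (P.K + 1) + P.K) = b at *
        interval_cases b
        · simp
        · simp; omega
    · exact ⟨rfl, hur, by simp [hpre, block, exec], by omega, by simp [hpre, block, exec, hg0]⟩
  have hct : P.Consts s2 := hc.congr (L := 40) (by omega) t2
  have e12 := hct.r12; have e9 := hct.r9
  have c3 : g (P.K + 1) < P.K + 1 + 1 := by rw [hg]; exact lastIdx_lt _ _
  refine ⟨_, (h1.seq (h2.seq (triD_exec _ _ ?_))).mono ?_, t1, ?_, ?_, ?_, ?_, ?_, ?_, ?_⟩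
  · simp [block, Safe, exec, BinOp.eval, e12, e9, t5, hw0]; omega
  · simp [hpre, block, Prog.time]; omega
  · intro y hy
    rw [exec_reg_of_above (L := 30) _ _ (by simp [block, Prog.Above]) _ hy, t2 y (by omega)]
  · simp [block, exec, t2]
  · simp [block, exec, t2]
  · simp [block, exec]
  · simp [block, exec, BinOp.eval, e12, t5]
  · simp [block, exec, BinOp.eval, e12, e9]
  · simp [block, exec]

/-- Draw blocks and samples, and start testing the vector that elimination proposes. -/
def genProg : Prog :=
  .seq (fillProg 0 1 5) (.seq (fillProg 19 8 9) (.seq initProg (.seq rowsProg selectProg)))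

/-- The running time of `genProg`. -/
def Par.genTime (P : Par) : ℕ :=
  P.k * 21 + P.r * 21 + (P.K + 1) * (P.K + 1) * 22 +
    P.r * ((P.K + 1) * (P.K * 80 + 200) + 120) + (P.K + 1) * 20 + 50

instance : NeZero P.Q :=
  ⟨Nat.succ_ne_zero _ ∘ fun h => (by unfold Par.Q at h; omega : P.n / P.g + P.k + 1 = 0)⟩

/-- The random choices made for one proposal: blocks of coordinates and samples. -/
abbrev Par.Seed (P : Par) : Type := (Fin P.k → Fin P.Q) × (Fin P.r → Fin P.m1)

/-- Extend a sequence by zeros. -/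
def extend {L N : ℕ} (f : Fin L → Fin N) (x : ℕ) : ℕ := if h : x < L then f ⟨x, h⟩ else 0

/-- The vector proposed for given random choices. -/
def Par.prop (P : Par) (D : Data P.n P.m) (ω : P.Seed) : Fin P.n → ZMod 2 :=
  P.cand D (extend ω.1) (extend ω.2)

/-- The run of `genProg` is determined by the random choices `ω`, which are uniform, and the row of
the matrix that it selects represents the vector proposed for `ω`. -/
theorem genProg_spec [NeZero P.m1] (hw : P.Fits w) {s : Store} (hc : P.Consts s) :
    ∃ S : P.Seed → Store, Tri w D genProg s P.genTime ((PMF.uniformOfFintype P.Seed).map S) ∧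
      ∀ ω, (∀ a, 4 ≤ P.region a → (S ω).mem a = s.mem a) ∧
      (∀ y < 30, (S ω).reg y = s.reg y) ∧ (S ω).reg 34 = s.reg 34 ∧ (S ω).reg 35 = s.reg 35 ∧
      (S ω).reg 30 = 1 ∧ (S ω).reg 31 < P.K + 1 ∧ (S ω).reg 32 = P.m1 ∧
      (S ω).reg 33 = 0 ∧ P.MemOK (S ω).mem ∧
      P.rowVec (S ω).mem ((S ω).reg 31) = P.prop D ω := by
  obtain ⟨S1, h1, g1⟩ := fillProg_spec (D := D) hw (b := 0) (c := 1) (r := 5) (N := P.Q)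
    (L := P.k) (ρ := 0) (by omega) (by omega) (by omega) (by omega) P.Q_le_X P.k_le_X hc
    (by rw [hc.r0]; rfl) hc.r1 hc.r5
  have key1 := fun f => fillProg_spec (D := D) hw (b := 19) (c := 8) (r := 9) (N := P.m1)
    (L := P.r) (ρ := 1) (s := S1 f) (by omega) (by omega) (by omega) (by omega) P.m1_le_X P.r_le_X
    (hc.congr (L := 50) (by omega) (g1 f).2.1) (by rw [(g1 f).2.1 _ (by omega), hc.r19])
    (by rw [(g1 f).2.1 _ (by omega), hc.r8]) (by rw [(g1 f).2.1 _ (by omega), hc.r9])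
  choose S2 h2 g2 using key1
  have key2 : ∀ ω : P.Seed, ∃ s', TriD w D (.seq initProg (.seq rowsProg selectProg))
      (S2 ω.1 ω.2) ((P.K + 1) * (P.K + 1) * 22 +
        P.r * ((P.K + 1) * (P.K * 80 + 200) + 120) + (P.K + 1) * 20 + 40) s' ∧
      (∀ a, 4 ≤ P.region a → s'.mem a = s.mem a) ∧
      (∀ y < 30, s'.reg y = s.reg y) ∧ s'.reg 34 = s.reg 34 ∧ s'.reg 35 = s.reg 35 ∧
      s'.reg 30 = 1 ∧ s'.reg 31 < P.K + 1 ∧ s'.reg 32 = P.m1 ∧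
      s'.reg 33 = 0 ∧ P.MemOK s'.mem ∧ P.rowVec s'.mem (s'.reg 31) = P.prop D ω ∧
      (∀ x : Fin P.k, P.arr s'.mem 0 x = ω.1 x) ∧ (∀ x : Fin P.r, P.arr s'.mem 1 x = ω.2 x) := by
    rintro ⟨β, R⟩
    obtain ⟨a1, a2, a3⟩ := g1 β
    obtain ⟨b1, b2, b3⟩ := g2 β R
    have hc2 : P.Consts (S2 β R) := hc.congr (L := 50) (by omega)
      fun y hy => (b2 y hy).trans (a2 y hy)
    obtain ⟨u, u1, u2, u3, u4⟩ := initProg_spec (D := D) hw hc2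
    have hβ : ∀ x < P.k, P.arr u.mem 0 x = extend β x := by
      intro x hx
      rw [Par.arr_congr (by omega) fun a ha => (u2 a (by omega)).trans (b1 a (by omega)),
        extend, dif_pos hx]
      exact a3 ⟨x, hx⟩
    have hR : ∀ x < P.r, P.arr u.mem 1 x = extend R x := by
      intro x hx
      rw [Par.arr_congr (by omega) fun a ha => u2 a (by omega), extend, dif_pos hx]
      exact b3 ⟨x, hx⟩
    have hm : P.MemOK u.mem := by
      refine Par.MemOK.of_entries (fun x hx => ?_) fun i hi j hj => ?_
      · rw [hβ x hx, extend, dif_pos hx]; exact (β _).2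
      · rw [u4 i hi j hj]; split_ifs <;> omega
    have hcu : P.Consts u := hc2.congr (L := 40) (by omega) u3
    obtain ⟨v, v1, v2, v3, v4, v5⟩ := rowsProg_spec (D := D) hw hcu hm (P.rep_init hβ u4) hR
      (fun t ht => by rw [extend, dif_pos ht]; exact (R _).2)
    obtain ⟨z, z1, z2, z3, z4, z5, z6, z7, z8, z9⟩ := selectProg_spec (D := D) hw
      (hcu.congr (L := 40) (by omega) v3) v4 v5
    refine ⟨z, (u1.seq (v1.seq z1)).mono (by omega), ?_, ?_, ?_, ?_, z6, ?_, z8, z9, ?_, ?_, ?_, ?_⟩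
    · intro a ha
      rw [z2, v2 a (by omega) (by omega), u2 a (by omega), b1 a (by omega), a1 a (by omega)]
    · intro y hy
      rw [z3 y hy, v3 y (by omega), u3 y (by omega), b2 y (by omega), a2 y (by omega)]
    · rw [z4, v3 _ (by omega), u3 _ (by omega), b2 _ (by omega), a2 _ (by omega)]
    · rw [z5, v3 _ (by omega), u3 _ (by omega), b2 _ (by omega), a2 _ (by omega)]
    · rw [z7]; exact lastIdx_lt' _ _
    · rw [z2]; exact v4
    · rw [z2, z7]
      exact congrArg Prod.fst (v5 _ (lastIdx_lt' _ _))
    · intro x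
      rw [z2, Par.arr_congr (by omega) fun a ha => v2 a (by omega) (by omega), hβ x x.2, extend,
        dif_pos x.2]
    · intro x
      rw [z2, Par.arr_congr (by omega) fun a ha => v2 a (by omega) (by omega), hR x x.2, extend,
        dif_pos x.2]
  choose S3 h3 g3 using key2
  refine ⟨S3, ?_, fun ω => ?_⟩
  · -- The random choices can be read off the memory, so `S1` and `S2 β` are injective.
    have inj1 : Function.Injective S1 := fun β β' h => funext fun x => Fin.ext (by
      rw [← (g1 β).2.2 x, h, (g1 β').2.2 x])
    have inj2 : ∀ β, Function.Injective (S2 β) := fun β R R' h => funext fun x => Fin.ext (by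
      rw [← (g2 β R).2.2 x, h, (g2 β R').2.2 x])
    have h4 : ∀ β, Tri w D (.seq (fillProg 19 8 9) (.seq initProg (.seq rowsProg selectProg)))
        (S1 β) (1 + (P.r * 21 + 3) + ((P.K + 1) * (P.K + 1) * 22 +
        P.r * ((P.K + 1) * (P.K * 80 + 200) + 120) + (P.K + 1) * 20 + 40))
        ((PMF.uniformOfFintype (Fin P.r → Fin P.m1)).map fun R => S3 (β, R)) := by
      intro β
      have h5 := Tri.seq (ν := fun s' => PMF.pure (S3 (β, Function.invFun (S2 β) s'))) (h2 β) (by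
        intro s' hs'
        rw [PMF.mem_support_map_iff] at hs'
        obtain ⟨R, _, rfl⟩ := hs'
        rw [Function.leftInverse_invFun (inj2 β) R]
        exact h3 (β, R))
      rw [PMF.bind_map] at h5
      refine Eq.mp ?_ h5
      congr 1
      rw [← PMF.bind_pure_comp]
      congr 1
      funext R
      simp only [Function.comp]
      rw [Function.leftInverse_invFun (inj2 β) R]
    have h6 := Tri.seq (ν := fun s' => (PMF.uniformOfFintype (Fin P.r → Fin P.m1)).map
      fun R => S3 (Function.invFun S1 s', R)) h1 (by
        intro s' hs'
        rw [PMF.mem_support_map_iff] at hs'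
        obtain ⟨β, _, rfl⟩ := hs'
        rw [Function.leftInverse_invFun inj1 β]
        exact h4 β)
    rw [PMF.bind_map] at h6
    refine Eq.mp ?_ (h6.mono (t' := P.genTime) (by unfold Par.genTime; omega))
    congr 1
    rw [← uniform_bind_map (Equiv.refl (P.Seed)), PMF.map_bind]
    congr 1
    funext β
    simp only [Function.comp, PMF.map_comp]
    rw [Function.leftInverse_invFun inj1 β]
    rfl
  · obtain ⟨c1, c2, c3, c4, c5, c6, c7, c8, c9, c10, _⟩ := g3 ω
    exact ⟨c1, c2, c3, c4, c5, c6, c7, c8, c9, c10⟩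

end Generate

/-! ### Output -/

section Main

open Prog BinOp

variable {P : Par} {w : ℕ} {D : Data P.n P.m}

/-- Add entry `reg 50` of the row that starts at index `reg 51` to the output cell of the coordinate
it belongs to, unless this coordinate is out of range. -/
def outBody : Prog :=
  block [op div 52 50 4, op mul 52 52 11, op add 52 52 0, load 52 52, op mul 52 52 4,
    op mod 53 50 4, op add 52 52 53, op add 53 51 50, op mul 53 53 11, op add 53 53 20, load 53 53,
    branch 52 0 (block [load 54 52, op add 54 54 53, op mod 54 54 14, store 52 54]) skip,
    op add 50 50 13]

/-- Add the vector that row number `reg 31` of the matrix represents to the output cells. -/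
def outProg : Prog := .seq (block [const 50 0, op mul 51 31 7]) (loop 50 6 outBody)

theorem outProg_spec (hw : P.Fits w) {s : Store} (hc : P.Consts s) (hm : P.MemOK s.mem)
    {i : ℕ} (hi : s.reg 31 = i) (hiK : i < P.K + 1) (h0 : ∀ y < P.n, s.mem y = 0) :
    ∃ s', TriD w D outProg s (P.K * 50 + 20) s' ∧ (∀ a, P.region a ≠ 8 → s'.mem a = s.mem a) ∧
      (∀ y < 50, s'.reg y = s.reg y) ∧ ∀ y : Fin P.n, s'.mem y = (P.rowVec s.mem i y).val := by
  have hw0 := hw.ne_zero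
  unfold Par.Fits at hw
  have hX := P.eight_le_X
  have hXX : 8 * P.X ≤ P.X * P.X := Nat.mul_le_mul_right _ hX
  have hg := P.g_pos
  have hgX := P.g_le_X
  have hKX := P.K_lt_X
  have hQX := P.Q_le_X
  have hnX := P.n_le_X
  have e7 := hc.r7
  have hiK' : i * (P.K + 1) ≤ P.X * P.X := Par.sq_le_X (by omega) hKX
  set pre := block [const 50 0, op mul 51 31 7] with hpre
  have h1 := triD_exec (w := w) (D := D) pre s (by
    simp [hpre, block, Safe, exec, BinOp.eval, hi, e7]; omega)
  have hur : ∀ y < 50, (exec D pre s).reg y = s.reg y :=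
    fun y hy => exec_reg_of_above _ s (by simp [hpre, block, Prog.Above]) y hy
  let Inv : ℕ → Store → Prop := fun j t => (∀ a, P.region a ≠ 8 → t.mem a = s.mem a) ∧
    (∀ y < 50, t.reg y = s.reg y) ∧ t.reg 50 = j ∧ t.reg 51 = i * (P.K + 1) ∧ j ≤ P.K ∧
    ∀ y < P.n, t.mem y = (∑ x ∈ Finset.range j,
      if P.pos s.mem x = y then P.arr s.mem 2 (i * (P.K + 1) + x) else 0) % 2
  obtain ⟨s2, h2, t1, t2, t3, t4, t5, t6⟩ : ∃ s', TriD w D (loop 50 6 outBody) (exec D pre s)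
      (P.K * (1 + 37) + 1) s' ∧ Inv P.K s' := by
    refine TriD.forLoop Inv (fun j t ht => ⟨ht.2.2.1, by rw [ht.2.1 6 (by omega), hc.r6]⟩) ?_ ?_
    · rintro j hj t ⟨t1, t2, t3, t4, t5, t6⟩
      have hct : P.Consts t := hc.congr (L := 50) (by omega) t2
      have f0 := hct.r0; have f4 := hct.r4; have f11 := hct.r11; have f13 := hct.r13
      have f14 := hct.r14; have f20 := hct.r20
      have b1 : j / P.g < P.k := by
        rw [Nat.div_lt_iff_lt_mul hg]; exact hj
      have b2 : j % P.g < P.g := Nat.mod_lt _ hg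
      have b3 := hm.blocks _ b1
      have b4 := hm.matrix _ (Par.idx_lt hiK (show j < P.K + 1 by omega))
      have b5 : P.arr s.mem 0 (j / P.g) * P.g ≤ P.X * P.X := Par.sq_le_X (by omega) hgX
      have b6 : j / P.g ≤ j := Nat.div_le_self _ _
      have c1 : t.mem (j / P.g * 8 + P.n) = P.arr s.mem 0 (j / P.g) := by
        rw [show j / P.g * 8 + P.n = P.n + 8 * (j / P.g) + 0 by ring, t1, Par.arr]
        rw [Par.region_arr _ (by omega)]; omega
      have c2 : t.mem ((i * (P.K + 1) + j) * 8 + (P.n + 2)) =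
          P.arr s.mem 2 (i * (P.K + 1) + j) := by
        rw [show (i * (P.K + 1) + j) * 8 + (P.n + 2) = P.n + 8 * (i * (P.K + 1) + j) + 2 by ring,
          t1, Par.arr]
        rw [Par.region_arr _ (by omega)]; omega
      have c3 : P.arr s.mem 0 (j / P.g) * P.g + j % P.g = P.pos s.mem j := rfl
      by_cases hp : P.pos s.mem j < P.n
      · have b7 := t6 _ hp
        have b8 : t.mem (P.pos s.mem j) ≤ 1 := by rw [b7]; omega
        refine ⟨exec D outBody t, (triD_exec _ _ ?_).mono (by simp [outBody, block, Prog.time]), ?_, ?_, ?_, ?_, hj, ?_⟩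
        · simp [outBody, block, Safe, exec, BinOp.eval, f0, f4, f11, f13, f14, f20, t3, t4, c1, c2,
            c3, hp]
          omega
        · intro a ha
          have : a ≠ P.pos s.mem j := by
            rintro rfl; exact ha (Par.region_out hp)
          simp [outBody, block, exec, BinOp.eval, f0, f4, f11, f13, f14, f20, t3, t4, c1, c2, c3,
            hp, this]
          exact t1 a ha
        · intro y hy
          rw [exec_reg_of_above (L := 50) _ _ (by simp [outBody, block, Prog.Above]) _ hy, t2 y hy]
        · simp [outBody, block, exec, BinOp.eval, f0, f4, f11, f13, f14, f20, t3, t4, c1, c2, c3, hp]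
        · simp [outBody, block, exec, BinOp.eval, f0, f4, f11, f13, f14, f20, t3, t4, c1, c2, c3, hp]
        · intro y hy
          rw [Finset.sum_range_succ]
          simp [outBody, block, exec, BinOp.eval, f0, f4, f11, f13, f14, f20, t3, t4, c1, c2, c3, hp]
          by_cases hyp : y = P.pos s.mem j
          · subst hyp
            rw [if_pos rfl, if_pos rfl, b7]
            omega
          · rw [if_neg hyp, if_neg (fun h => hyp h.symm), t6 y hy, add_zero]
      · refine ⟨exec D outBody t, (triD_exec _ _ ?_).mono (by simp [outBody, block, Prog.time]), ?_, ?_, ?_, ?_, hj, ?_⟩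
        · simp [outBody, block, Safe, exec, BinOp.eval, f0, f4, f11, f13, f20, t3, t4, c1, c2,
            c3, hp]
          omega
        · intro a ha
          simp [outBody, block, exec, BinOp.eval, f0, f4, f11, f13, f20, t3, t4, c1, c2, c3,
            hp]
          exact t1 a ha
        · intro y hy
          rw [exec_reg_of_above (L := 50) _ _ (by simp [outBody, block, Prog.Above]) _ hy, t2 y hy]
        · simp [outBody, block, exec, BinOp.eval, f0, f4, f11, f13, f20, t3, t4, c1, c2, c3, hp]
        · simp [outBody, block, exec, BinOp.eval, f0, f4, f11, f13, f20, t3, t4, c1, c2, c3, hp]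
        · intro y hy
          rw [Finset.sum_range_succ, if_neg (by omega : ¬ P.pos s.mem j = y), add_zero, ← t6 y hy]
          simp [outBody, block, exec, BinOp.eval, f0, f4, f11, f13, f20, t3, t4, c1, c2, c3, hp]
    · refine ⟨fun _ _ => rfl, hur, by simp [hpre, block, exec], ?_, by omega, ?_⟩
      · simp [hpre, block, exec, hi, e7, BinOp.eval]
      · intro y hy
        simp only [Finset.range_zero, Finset.sum_empty, Nat.zero_mod]
        exact h0 y hy
  refine ⟨s2, (h1.seq h2).mono (by simp [hpre, block, Prog.time]; omega), t1, t2, fun y => ?_⟩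
  rw [t6 y y.2, ← ZMod.val_natCast, Par.rowVec]
  congr 1
  push_cast
  rfl

/-! ### The iteration counter -/

/-- The number held by the counter: the digits in array `4` and the leading digit in register `34`.
The counter stands for a number that may be far too large for a word. -/
def Par.cnt (P : Par) (s : Store) : ℕ :=
  ∑ x ∈ Finset.range P.k, P.arr s.mem 4 x * P.base ^ x + s.reg 34 * P.base ^ P.k

/-- Add the carry `reg 41` to digit `reg 40`. -/
def incBody : Prog :=
  block [op mul 42 40 11, op add 42 42 22, load 43 42, op add 43 43 41, op div 41 43 10,
    op mod 43 43 10, store 42 43, op add 40 40 13]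

/-- Increment the counter. -/
def incProg : Prog :=
  .seq (block [const 40 0, const 41 1]) (.seq (loop 40 1 incBody) (op add 34 34 41))

theorem incProg_spec (hw : P.Fits w) (hb : 0 < P.base) {s : Store} (hc : P.Consts s)
    (hdig : ∀ x < P.k, P.arr s.mem 4 x < P.base) (htop : s.reg 34 < P.s) :
    ∃ s', TriD w D incProg s (P.k * 20 + 20) s' ∧ (∀ a, P.region a ≠ 4 → s'.mem a = s.mem a) ∧
      (∀ y < 40, y ≠ 34 → s'.reg y = s.reg y) ∧ (∀ x < P.k, P.arr s'.mem 4 x < P.base) ∧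
      P.cnt s' = P.cnt s + 1 := by
  have hw0 := hw.ne_zero
  unfold Par.Fits at hw
  have hX := P.eight_le_X
  have hXX : 8 * P.X ≤ P.X * P.X := Nat.mul_le_mul_right _ hX
  have hbX := P.base_le_X
  have hkX := P.k_le_X
  have hnX := P.n_le_X
  have hsX := P.s_le_X
  set pre := block [const 40 0, const 41 1] with hpre
  have h1 := triD_exec (w := w) (D := D) pre s (by
    simp [hpre, block, Safe, hw0])
  have hur : ∀ y < 40, (exec D pre s).reg y = s.reg y :=
    fun y hy => exec_reg_of_above _ s (by simp [hpre, block, Prog.Above]) y hy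
  let Inv : ℕ → Store → Prop := fun j t => (∀ a, P.region a ≠ 4 → t.mem a = s.mem a) ∧
    (∀ y < 40, t.reg y = s.reg y) ∧ t.reg 40 = j ∧ j ≤ P.k ∧ t.reg 41 ≤ 1 ∧
    (∀ x < P.k, P.arr t.mem 4 x < P.base) ∧ (∀ x, j ≤ x → P.arr t.mem 4 x = P.arr s.mem 4 x) ∧
    ∑ x ∈ Finset.range j, P.arr t.mem 4 x * P.base ^ x + t.reg 41 * P.base ^ j =
      ∑ x ∈ Finset.range j, P.arr s.mem 4 x * P.base ^ x + 1
  obtain ⟨s2, h2, t1, t2, t3, t4, t5, t6, t7, t8⟩ : ∃ s', TriD w D (loop 40 1 incBody)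
      (exec D pre s) (P.k * (1 + 17) + 1) s' ∧ Inv P.k s' := by
    refine TriD.forLoop Inv (fun j t ht => ⟨ht.2.2.1, by rw [ht.2.1 1 (by omega), hc.r1]⟩) ?_ ?_
    · rintro j hj t ⟨t1, t2, t3, t4, t5, t6, t7, t8⟩
      have hct : P.Consts t := hc.congr (L := 40) (by omega) t2
      have f10 := hct.r10; have f11 := hct.r11; have f13 := hct.r13; have f22 := hct.r22
      have c1 : t.mem (j * 8 + (P.n + 4)) = P.arr t.mem 4 j := by
        rw [Par.arr]; congr 1; ring
      have c2 := t6 j hj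
      have c3 : (P.arr t.mem 4 j + t.reg 41) / P.base ≤ 1 := by
        rw [← Nat.lt_succ_iff, Nat.div_lt_iff_lt_mul hb]; omega
      have c4 : (P.arr t.mem 4 j + t.reg 41) % P.base < P.base := Nat.mod_lt _ hb
      have hmem : ∀ x, P.arr (exec D incBody t).mem 4 x =
          if x = j then (P.arr t.mem 4 j + t.reg 41) % P.base else P.arr t.mem 4 x := by
        intro x
        rw [Par.arr]
        simp [incBody, block, exec, BinOp.eval, f10, f11, f13, f22, t3, c1]
        by_cases hxj : x = j
        · subst hxj
          rw [if_pos (by ring), if_pos rfl]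
        · rw [if_neg (by omega), if_neg hxj, Par.arr]
      have hcar : (exec D incBody t).reg 41 = (P.arr t.mem 4 j + t.reg 41) / P.base := by
        simp [incBody, block, exec, BinOp.eval, f10, f11, f22, t3, c1]
      refine ⟨exec D incBody t, (triD_exec _ _ ?_).mono (by simp [incBody, block, Prog.time]),
        ?_, ?_, ?_, hj, ?_, ?_, ?_, ?_⟩
      · simp [incBody, block, Safe, exec, BinOp.eval, f10, f11, f13, f22, t3, c1]
        omega
      · intro a ha
        have : a ≠ j * 8 + (P.n + 4) := by
          rintro rfl
          apply ha
          rw [show j * 8 + (P.n + 4) = P.n + 8 * j + 4 by ring, Par.region_arr _ (by omega)]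
        simp [incBody, block, exec, BinOp.eval, f11, f22, t3, this]
        exact t1 a ha
      · intro y hy
        rw [exec_reg_of_above (L := 40) _ _ (by simp [incBody, block, Prog.Above]) _ hy, t2 y hy]
      · simp [incBody, block, exec, BinOp.eval, f13, t3]
      · rw [hcar]; exact c3
      · intro x hx
        rw [hmem]
        split_ifs
        · exact c4
        · exact t6 x hx
      · intro x hx
        rw [hmem, if_neg (by omega), t7 x (by omega)]
      · rw [Finset.sum_range_succ, Finset.sum_range_succ, hmem, if_pos rfl, hcar,
          Finset.sum_congr rfl (g := fun x => P.arr t.mem 4 x * P.base ^ x)]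
        · have h3 := Nat.mod_add_div (P.arr t.mem 4 j + t.reg 41) P.base
          have h4 := t7 j le_rfl
          rw [← h4]
          calc _ = ∑ x ∈ Finset.range j, P.arr t.mem 4 x * P.base ^ x +
                ((P.arr t.mem 4 j + t.reg 41) % P.base +
                P.base * ((P.arr t.mem 4 j + t.reg 41) / P.base)) * P.base ^ j := by ring
            _ = (∑ x ∈ Finset.range j, P.arr t.mem 4 x * P.base ^ x + t.reg 41 * P.base ^ j) +
                P.arr t.mem 4 j * P.base ^ j := by rw [h3]; ring
            _ = _ := by rw [t8]; ring
        · intro x hx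
          rw [hmem, if_neg (by have := Finset.mem_range.mp hx; omega)]
    · refine ⟨fun _ _ => rfl, hur, by simp [hpre, block, exec], by omega,
        by simp [hpre, block, exec], hdig, fun _ _ => rfl, by simp [hpre, block, exec]⟩
  have e34 : s2.reg 34 = s.reg 34 := t2 _ (by omega)
  refine ⟨_, (h1.seq (h2.seq (triD_exec _ _ ?_))).mono ?_, t1, ?_, t6, ?_⟩
  · simp [Safe, BinOp.eval, e34]; omega
  · simp [hpre, block, Prog.time]; omega
  · intro y hy hy'
    simp [exec, hy', t2 y hy]
  · unfold Par.cnt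
    have h3 : (exec D (op add 34 34 41) s2).mem = s2.mem := rfl
    have h4 : (exec D (op add 34 34 41) s2).reg 34 = s.reg 34 + s2.reg 41 := by
      simp [exec, BinOp.eval, e34]
    rw [h3, h4, add_mul, add_comm (s.reg 34 * _), ← add_assoc, t8]
    ring

/-! ### The main loop -/

/-- Test the proposed vector against one more sample. Registers `31`, `32` and `33` hold the row of
the vector, the number of the next sample and the number of disagreements. The vector is rejected by
setting register `30` to `0`; it is accepted by setting register `35`, the bound of the main loop, to
`0`. -/
def testProg : Prog :=
  .seq (block [op add 60 31 12, op add 61 32 12, const 62 1]) (.seq dotProg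
    (.seq (block [op add 33 33 63, op add 32 32 13, op mul 40 16 33, op sub 41 32 9, op mul 41 17 41,
      op add 41 41 18]) (.branch 41 40 (const 30 0) (.branch 32 3 skip (.seq outProg (const 35 0))))))

/-- The states of the search: a new vector has to be proposed, the vector `v` has passed the test
with the samples before sample `i`, `d` of which disagree with it, or `v` has been accepted. -/
inductive Phase (n : ℕ) : Type
  | idle
  | test (v : Fin n → ZMod 2) (i d : ℕ)
  | done (v : Fin n → ZMod 2)

/-- The number of disagreements, `0` or `1`, of sample `i` with the vector `v`. -/
def dis {n m : ℕ} (D : Data n m) (v : Fin n → ZMod 2) (i : ℕ) : ℕ :=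
  ((row D i).1 ⬝ᵥ v + (row D i).2).val

/-- Test `v` with sample `i`, given that `d` of the samples before disagree with it. -/
def Par.next (P : Par) (D : Data P.n P.m) (v : Fin P.n → ZMod 2) (i d : ℕ) : Phase P.n :=
  if P.C + P.p * (i + 1 - P.m1) < P.q * (d + dis D v i) then .idle
  else if i + 1 < P.m then .test v (i + 1) (d + dis D v i) else .done v

/-- The store represents a state of the search. The output cells stay `0` until a vector is
accepted. -/
def Par.Holds (P : Par) (s : Store) : Phase P.n → Prop
  | .idle => P.Consts s ∧ s.reg 30 = 0 ∧ s.reg 35 = P.s ∧ ∀ y < P.n, s.mem y = 0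
  | .test v i d => P.Consts s ∧ s.reg 30 = 1 ∧ s.reg 35 = P.s ∧ (∀ y < P.n, s.mem y = 0) ∧
      s.reg 32 = i ∧ s.reg 33 = d ∧ P.m1 ≤ i ∧ i < P.m ∧ d ≤ i ∧ P.MemOK s.mem ∧
      s.reg 31 < P.K + 1 ∧ P.rowVec s.mem (s.reg 31) = v
  | .done v => P.Consts s ∧ s.reg 35 = 0 ∧ ∀ y : Fin P.n, s.mem y = (v y).val

theorem Par.Holds.consts {s : Store} {x : Phase P.n} (h : P.Holds s x) : P.Consts s := by
  cases x <;> exact h.1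

theorem Par.Holds.congr {s s' : Store} {x : Phase P.n} (h : P.Holds s x)
    (hm : ∀ a, P.region a ≠ 4 → s'.mem a = s.mem a)
    (hr : ∀ y < 40, y ≠ 34 → s'.reg y = s.reg y) : P.Holds s' x := by
  have hc : P.Consts s' := h.consts.congr (L := 30) le_rfl fun y hy => hr y (by omega) (by omega)
  have ho : ∀ y < P.n, s'.mem y = s.mem y := fun y hy => hm y (by rw [Par.region_out hy]; omega)
  cases x with
  | idle =>
    obtain ⟨_, h1, h2, h3⟩ := h
    exact ⟨hc, by rw [hr _ (by omega) (by omega), h1], by rw [hr _ (by omega) (by omega), h2],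
      fun y hy => by rw [ho y hy, h3 y hy]⟩
  | test v i d =>
    obtain ⟨_, h1, h2, h3, h4, h5, h6, h7, h8, h9, h10, h11⟩ := h
    refine ⟨hc, by rw [hr _ (by omega) (by omega), h1], by rw [hr _ (by omega) (by omega), h2],
      fun y hy => by rw [ho y hy, h3 y hy], by rw [hr _ (by omega) (by omega), h4],
      by rw [hr _ (by omega) (by omega), h5], h6, h7, h8,
      h9.congr (fun a ha => hm a (by omega)) (fun a ha => hm a (by omega)),
      by rwa [hr _ (by omega) (by omega)], ?_⟩
    rw [hr _ (by omega) (by omega), ← h11]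
    funext y
    unfold Par.rowVec
    refine Finset.sum_congr rfl fun j _ => ?_
    rw [Par.pos_congr fun a ha => hm a (by omega), Par.arr_congr (by omega) fun a ha => hm a (by omega)]
  | done v =>
    obtain ⟨_, h1, h2⟩ := h
    exact ⟨hc, by rw [hr _ (by omega) (by omega), h1], fun y => by rw [ho y y.2, h2 y]⟩

theorem dotNat_eq_dis (s : Store) (i x : ℕ) :
    P.dotNat D s.mem i x 1 = dis D (P.rowVec s.mem i) x := by
  unfold dis
  have h1 := P.cast_dotNat (D := D) s.mem i x 1
  rw [Nat.cast_one, mul_one] at h1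
  rw [← h1, ZMod.val_natCast, Nat.mod_eq_of_lt]
  exact Nat.lt_succ_of_le (P.dotNat_le ..)

theorem testProg_spec (hw : P.Fits w) {s : Store} {v : Fin P.n → ZMod 2} {i d : ℕ}
    (h : P.Holds s (.test v i d)) :
    ∃ s', TriD w D testProg s (P.K * 90 + 90) s' ∧ P.Holds s' (P.next D v i d) ∧
      (∀ a, P.region a = 4 → s'.mem a = s.mem a) ∧ s'.reg 34 = s.reg 34 := by
  obtain ⟨hc, h1, h2, h3, h4, h5, h6, h7, h8, h9, h10, h11⟩ := h
  have hw0 := hw.ne_zero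
  have hw' := hw
  unfold Par.Fits at hw
  have hX := P.eight_le_X
  have hXX : 8 * P.X ≤ P.X * P.X := Nat.mul_le_mul_right _ hX
  have hKX := P.K_lt_X
  have hmX := P.m_le_X
  have hqX : P.q ≤ P.X := by unfold Par.X; omega
  have hpX : P.p ≤ P.X := by unfold Par.X; omega
  have hCX : P.C ≤ P.X := by unfold Par.X; omega
  have e12 := hc.r12
  set pre := block [op add 60 31 12, op add 61 32 12, const 62 1] with hpre
  have g1 := triD_exec (w := w) (D := D) pre s (by
    simp [hpre, block, Safe, exec, BinOp.eval, e12, h4, hw0]; omega)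
  have hur : ∀ y < 60, (exec D pre s).reg y = s.reg y :=
    fun y hy => exec_reg_of_above _ s (by simp [hpre, block, Prog.Above]) y hy
  obtain ⟨u, u1, u2, u3, u4⟩ := dotProg_spec (D := D) hw' (s := exec D pre s) (i := s.reg 31)
    (x := i) (l := 1) (hc.congr (L := 60) (by omega) hur) h9
    (by simp [hpre, block, exec, BinOp.eval, e12]) h10
    (by simp [hpre, block, exec, BinOp.eval, e12, h4]) (by simp [hpre, block, exec]) le_rfl
  replace u3 : ∀ y < 60, u.reg y = s.reg y := fun y hy => (u3 y (by omega)).trans (hur y hy)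
  change u.mem = s.mem at u2
  change u.reg 63 = P.dotNat D s.mem _ _ _ at u4
  rw [dotNat_eq_dis, h11] at u4
  have hdis : dis D v i ≤ 1 := Nat.le_of_lt_succ (ZMod.val_lt _)
  have hcu : P.Consts u := hc.congr (L := 60) (by omega) u3
  have e13 := hcu.r13; have e16 := hcu.r16; have e9 := hcu.r9; have e17 := hcu.r17
  have e18 := hcu.r18
  have f33 := (u3 33 (by omega)).trans h5
  have f32 := (u3 32 (by omega)).trans h4
  have b1 : P.q * (d + dis D v i) ≤ P.X * P.X := Par.sq_le_X hqX (by omega)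
  have b2 : P.p * (i + 1 - P.m1) ≤ P.X * P.X := Par.sq_le_X hpX (by omega)
  set mid := block [op add 33 33 63, op add 32 32 13, op mul 40 16 33, op sub 41 32 9,
      op mul 41 17 41, op add 41 41 18] with hmid
  have g2 := triD_exec (w := w) (D := D) mid u (by
    simp [hmid, block, Safe, exec, BinOp.eval, e13, e16, e9, e17, e18, f33, f32, u4]; omega)
  set z := exec D mid u with hz
  have zr : ∀ y < 40, y ≠ 32 → y ≠ 33 → z.reg y = s.reg y := by
    intro y hy hy1 hy2
    rw [← u3 y (by omega)]
    simp [hz, hmid, block, exec, hy1, hy2, show y ≠ 40 by omega, show y ≠ 41 by omega]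
  have z32 : z.reg 32 = i + 1 := by simp [hz, hmid, block, exec, BinOp.eval, f32, e13]
  have z33 : z.reg 33 = d + dis D v i := by simp [hz, hmid, block, exec, BinOp.eval, f33, u4]
  have z40 : z.reg 40 = P.q * (d + dis D v i) := by
    simp [hz, hmid, block, exec, BinOp.eval, f33, u4, e16]
  have z41 : z.reg 41 = P.C + P.p * (i + 1 - P.m1) := by
    simp [hz, hmid, block, exec, BinOp.eval, f32, e13, e9, e17, e18]; omega
  have zm : z.mem = s.mem := u2
  have hcz : P.Consts z := hc.congr (L := 30) le_rfl fun y hy => zr y (by omega) (by omega) (by omega)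
  by_cases hrej : P.C + P.p * (i + 1 - P.m1) < P.q * (d + dis D v i)
  · rw [Par.next, if_pos hrej]
    refine ⟨exec D (const 30 0) z, (g1.seq (u1.seq (g2.seq (Tri.branch_pos (by rw [z40, z41]; exact hrej)
      (triD_exec _ _ ?_))))).mono ?_, ⟨?_, ?_, ?_, ?_⟩, ?_, ?_⟩
    · simp [Safe]
    · simp [hpre, hmid, block, Prog.time]; omega
    · exact hcz.congr (L := 30) le_rfl fun y hy =>
        exec_reg_of_above _ _ (by simp [Prog.Above]) _ hy
    · simp [exec]
    · simp [exec, zr 35, h2]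
    · exact fun y hy => (congrFun zm y).trans (h3 y hy)
    · exact fun a _ => congrFun zm a
    · simp [exec, zr 34]
  · by_cases hlt : i + 1 < P.m
    · rw [Par.next, if_neg hrej, if_pos hlt]
      refine ⟨z, (g1.seq (u1.seq (g2.seq (Tri.branch_neg (by rw [z40, z41]; exact hrej)
        (Tri.branch_pos (by rw [z32, hcz.r3]; exact hlt) (triD_exec _ _ ?_)))))).mono ?_,
        ⟨hcz, ?_, ?_, ?_, z32, z33, by omega, hlt, by omega, ?_, ?_, ?_⟩, ?_, ?_⟩
      · simp [Safe]
      · simp [hpre, hmid, block, Prog.time]; omega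
      · rw [zr _ (by omega) (by omega) (by omega), h1]
      · rw [zr _ (by omega) (by omega) (by omega), h2]
      · exact fun y hy => (congrFun zm y).trans (h3 y hy)
      · rw [zm]; exact h9
      · rw [zr _ (by omega) (by omega) (by omega)]; exact h10
      · rw [zm, zr _ (by omega) (by omega) (by omega)]; exact h11
      · exact fun a _ => congrFun zm a
      · rw [zr _ (by omega) (by omega) (by omega)]
    · rw [Par.next, if_neg hrej, if_neg hlt]
      obtain ⟨y, y1, y2, y3, y4⟩ := outProg_spec (D := D) hw' (s := z) hcz (by rw [zm]; exact h9)
        (i := s.reg 31) (zr _ (by omega) (by omega) (by omega)) h10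
        (fun y hy => (congrFun zm y).trans (h3 y hy))
      refine ⟨exec D (const 35 0) y, (g1.seq (u1.seq (g2.seq (Tri.branch_neg (by rw [z40, z41]; exact hrej)
        (Tri.branch_neg (by rw [z32, hcz.r3]; exact hlt) (y1.seq (triD_exec _ _ ?_))))))).mono ?_,
        ⟨?_, ?_, ?_⟩, ?_, ?_⟩
      · simp [Safe]
      · simp [hpre, hmid, block, Prog.time]; omega
      · exact hcz.congr (L := 30) le_rfl fun a ha =>
          (exec_reg_of_above (L := 30) _ _ (by simp [Prog.Above]) _ ha).trans (y3 a (by omega))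
      · simp [exec]
      · intro a
        rw [← h11, ← zm]
        exact y4 a
      · intro a ha
        rw [← zm]
        exact y2 a (by omega)
      · simp [exec, y3 34, zr 34]

end Main

/-! ### One iteration -/

section Loop

open Prog BinOp

variable {P : Par} {w : ℕ} {D : Data P.n P.m}

/-- One iteration of the search. -/
def iterProg : Prog := .seq (.branch 12 30 testProg genProg) incProg

/-- The running time of one iteration. -/
def Par.iterTime (P : Par) : ℕ := P.genTime + P.K * 90 + P.k * 20 + 150

/-- The digits of the counter are in their range, and the counter stands at `c`. -/
def Par.Counter (P : Par) (s : Store) (c : ℕ) : Prop :=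
  (∀ x < P.k, P.arr s.mem 4 x < P.base) ∧ P.cnt s = c

/-- The number of iterations. -/
def Par.iters (P : Par) : ℕ := P.s * P.base ^ P.k

theorem Par.Counter.congr {s s' : Store} {c : ℕ} (h : P.Counter s c)
    (hm : ∀ a, P.region a = 4 → s'.mem a = s.mem a) (hr : s'.reg 34 = s.reg 34) :
    P.Counter s' c := by
  refine ⟨fun x hx => ?_, ?_⟩
  · rw [Par.arr_congr (by omega) hm]; exact h.1 x hx
  · rw [← h.2]
    unfold Par.cnt
    rw [hr]
    congr 1
    exact Finset.sum_congr rfl fun x _ => by rw [Par.arr_congr (by omega) hm]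

theorem Par.Counter.sum_lt {s : Store} {c : ℕ} (h : P.Counter s c) :
    ∑ x ∈ Finset.range P.k, P.arr s.mem 4 x * P.base ^ x < P.base ^ P.k := by
  have key : ∀ j ≤ P.k, ∑ x ∈ Finset.range j, P.arr s.mem 4 x * P.base ^ x < P.base ^ j := by
    intro j
    induction j with
    | zero => intro _; simp
    | succ j ih =>
      intro hj
      rw [Finset.sum_range_succ, pow_succ]
      have h1 := ih (by omega)
      have h2 : (P.arr s.mem 4 j + 1) * P.base ^ j ≤ P.base * P.base ^ j :=
        Nat.mul_le_mul_right _ (h.1 j (by omega))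
      linarith
  exact key P.k le_rfl

/-- The leading digit tells whether iterations are left. -/
theorem Par.Counter.top_lt_iff {s : Store} {c : ℕ} (h : P.Counter s c) :
    s.reg 34 < P.s ↔ c < P.iters := by
  have h1 := h.sum_lt
  have h2 := h.2
  unfold Par.cnt at h2
  unfold Par.iters
  constructor
  · intro h3
    have h4 : (s.reg 34 + 1) * P.base ^ P.k ≤ P.s * P.base ^ P.k := Nat.mul_le_mul_right _ h3
    linarith
  · intro h3
    by_contra h4
    have h5 : P.s * P.base ^ P.k ≤ s.reg 34 * P.base ^ P.k := Nat.mul_le_mul_right _ (by omega)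
    omega

theorem incProg_holds (hw : P.Fits w) (hb : 0 < P.base) {s : Store} {c : ℕ}
    (hc : P.Consts s) (hcnt : P.Counter s c) (hlt : s.reg 34 < P.s) :
    ∃ s', TriD w D incProg s (P.k * 20 + 20) s' ∧ (∀ x, P.Holds s x → P.Holds s' x) ∧
      P.Counter s' (c + 1) := by
  obtain ⟨u, u1, u2, u3, u4, u5⟩ := incProg_spec (D := D) hw hb hc hcnt.1 hlt
  exact ⟨u, u1, fun x h => h.congr u2 u3, u4, by rw [u5, hcnt.2]⟩

theorem iterProg_test (hw : P.Fits w) (hb : 0 < P.base) {s : Store} {v : Fin P.n → ZMod 2}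
    {i d c : ℕ} (h : P.Holds s (.test v i d)) (hcnt : P.Counter s c) (hlt : s.reg 34 < P.s) :
    ∃ s', TriD w D iterProg s P.iterTime s' ∧ P.Holds s' (P.next D v i d) ∧
      P.Counter s' (c + 1) := by
  obtain ⟨u, u1, u2, u3, u4⟩ := testProg_spec (D := D) hw h
  obtain ⟨z, z1, z2, z3⟩ := incProg_holds (D := D) hw hb u2.consts (hcnt.congr u3 u4) (by rwa [u4])
  refine ⟨z, (TriD.seq (Tri.branch_pos ?_ u1) z1).mono ?_, z2 _ u2, z3⟩
  · rw [h.consts.r12, h.2.1]; omega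
  · unfold Par.iterTime; omega

theorem iterProg_idle [NeZero P.m1] (hw : P.Fits w) (hb : 0 < P.base) (hm : P.m1 < P.m)
    {s : Store} {c : ℕ} (h : P.Holds s .idle) (hcnt : P.Counter s c) (hlt : s.reg 34 < P.s) :
    ∃ S : P.Seed → Store, Tri w D iterProg s P.iterTime ((PMF.uniformOfFintype P.Seed).map S) ∧
      ∀ ω, P.Holds (S ω) (.test (P.prop D ω) P.m1 0) ∧ P.Counter (S ω) (c + 1) := by
  obtain ⟨S, h1, h2⟩ := genProg_spec (D := D) hw h.consts
  have hS : ∀ ω, P.Holds (S ω) (.test (P.prop D ω) P.m1 0) := by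
    intro ω
    obtain ⟨a1, a2, a3, a4, a5, a6, a7, a8, a9, a10⟩ := h2 ω
    refine ⟨h.consts.congr le_rfl a2, a5, by rw [a4, h.2.2.1], fun y hy => ?_, a7, a8, le_rfl, hm,
      Nat.zero_le _, a9, a6, a10⟩
    rw [a1 y (by rw [Par.region_out hy]; omega), h.2.2.2 y hy]
  have key : ∀ t, ∃ t', (∃ ω, t = S ω) → TriD w D incProg t (P.k * 20 + 20) t' ∧
      (∀ x, P.Holds t x → P.Holds t' x) ∧ P.Counter t' (c + 1) := by
    intro t
    by_cases ht : ∃ ω, t = S ω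
    · obtain ⟨ω, rfl⟩ := ht
      obtain ⟨t', ht'⟩ := incProg_holds (D := D) hw hb (hS ω).consts
        (hcnt.congr (fun a ha => (h2 ω).1 a (by omega)) (h2 ω).2.2.1)
        (by rw [(h2 ω).2.2.1]; exact hlt)
      exact ⟨t', fun _ => ht'⟩
    · exact ⟨t, fun h => absurd h ht⟩
  choose f hf using key
  refine ⟨f ∘ S, ?_, fun ω => ⟨(hf _ ⟨ω, rfl⟩).2.1 _ (hS ω), (hf _ ⟨ω, rfl⟩).2.2⟩⟩
  have h3 := Tri.seq (ν := fun t => PMF.pure (f t)) (Tri.branch_neg (a := 12) (b := 30)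
    (P := testProg) (by rw [h.consts.r12, h.2.1]; omega) h1) (t' := P.k * 20 + 20)
    (Q := incProg) (by
      intro t ht
      rw [PMF.mem_support_map_iff] at ht
      obtain ⟨ω, _, rfl⟩ := ht
      exact (hf _ ⟨ω, rfl⟩).1)
  rw [PMF.bind_map] at h3
  refine Eq.mp ?_ (h3.mono (t' := P.iterTime) (by unfold Par.iterTime; omega))
  congr 1

/-! ### The search as a Markov chain -/

open Classical in
/-- The probability that the search has accepted `v` after `τ` iterations from a given state. -/
noncomputable def Par.succ (P : Par) [NeZero P.m1] (D : Data P.n P.m) (v : Fin P.n → ZMod 2) :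
    ℕ → Phase P.n → ℝ
  | _, .done u => if u = v then 1 else 0
  | 0, _ => 0
  | τ + 1, .idle =>
      (∑ ω : P.Seed, P.succ D v τ (.test (P.prop D ω) P.m1 0)) / Fintype.card P.Seed
  | τ + 1, .test u i d => P.succ D v τ (P.next D u i d)

theorem Par.succ_nonneg [NeZero P.m1] (v : Fin P.n → ZMod 2) (τ : ℕ) (x : Phase P.n) :
    0 ≤ P.succ D v τ x := by
  induction τ generalizing x with
  | zero => cases x <;> simp only [Par.succ] <;> [exact le_rfl; exact le_rfl; positivity]
  | succ τ ih =>
    cases x with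
    | done u => simp only [Par.succ]; positivity
    | idle => exact div_nonneg (Finset.sum_nonneg fun ω _ => ih _) (Nat.cast_nonneg _)
    | test u i d => exact ih _

/-- For fixed samples, the main loop accepts `v` at least as often as the Markov chain does. The
loop stops when the counter reaches `iters` or when a vector is accepted, both at the same test
`reg 34 < reg 35`. -/
theorem loop_spec [NeZero P.m1] (hw : P.Fits w) (hb : 0 < P.base) (hm : P.m1 < P.m)
    (v : Fin P.n → ZMod 2) (τ : ℕ) : ∀ (s : Store) (x : Phase P.n), P.Holds s x →
      ((∃ u, x = .done u) ∨ ∃ c, P.Counter s c ∧ c + τ = P.iters) →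
      ∃ μ, Tri w D (loop 34 35 iterProg) s (τ * (P.iterTime + 1) + 1) μ ∧
        ENNReal.ofReal (P.succ D v τ x) ≤
          μ.toOuterMeasure {s | ∀ y : Fin P.n, s.mem y = (v y).val} := by
  have hdone : ∀ (τ : ℕ) (s : Store) (u : Fin P.n → ZMod 2), P.Holds s (.done u) →
      ∃ μ, Tri w D (loop 34 35 iterProg) s (τ * (P.iterTime + 1) + 1) μ ∧
        ENNReal.ofReal (P.succ D v τ (.done u)) ≤
          μ.toOuterMeasure {s | ∀ y : Fin P.n, s.mem y = (v y).val} := by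
    rintro τ s u ⟨h1, h2, h3⟩
    refine ⟨PMF.pure s, (TriD.loop_done (by omega)).mono (by omega), ?_⟩
    rw [Par.succ, PMF.toOuterMeasure_pure_apply]
    split_ifs with h4 h5
    · simp
    · exact absurd (by rw [h4] at h3; exact h3) h5
    · simp
    · simp
  induction τ with
  | zero =>
    intro s x hx hc
    cases x with
    | done u => exact hdone 0 s u hx
    | idle =>
      refine ⟨PMF.pure s, (TriD.loop_done ?_).mono (by omega), by simp [Par.succ]⟩
      obtain ⟨u, hu⟩ | ⟨c, h1, h2⟩ := hc
      · cases hu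
      · rw [hx.2.2.1, h1.top_lt_iff]; omega
    | test u i d =>
      refine ⟨PMF.pure s, (TriD.loop_done ?_).mono (by omega), by simp [Par.succ]⟩
      obtain ⟨u, hu⟩ | ⟨c, h1, h2⟩ := hc
      · cases hu
      · rw [hx.2.2.1, h1.top_lt_iff]; omega
  | succ τ ih =>
    intro s x hx hc
    cases x with
    | done u => exact hdone (τ + 1) s u hx
    | idle =>
      obtain ⟨u, hu⟩ | ⟨c, h1, h2⟩ := hc
      · cases hu
      have hlt : s.reg 34 < P.s := h1.top_lt_iff.mpr (by omega)
      have hab : s.reg 34 < s.reg 35 := by rw [hx.2.2.1]; exact hlt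
      obtain ⟨S, g1, g2⟩ := iterProg_idle (D := D) hw hb hm hx h1 hlt
      have key : ∀ t, ∃ μ, (∃ ω, t = S ω) →
          Tri w D (loop 34 35 iterProg) t (τ * (P.iterTime + 1) + 1) μ ∧
          ∀ ω, t = S ω → ENNReal.ofReal (P.succ D v τ (.test (P.prop D ω) P.m1 0)) ≤
          μ.toOuterMeasure {s | ∀ y : Fin P.n, s.mem y = (v y).val} := by
        intro t
        by_cases ht : ∃ ω, t = S ω
        · obtain ⟨ω, rfl⟩ := ht
          obtain ⟨μ, hμ, hμ'⟩ := ih (S ω) _ (g2 ω).1 (Or.inr ⟨c + 1, (g2 ω).2, by omega⟩)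
          refine ⟨μ, fun _ => ⟨hμ, fun ω' h => ?_⟩⟩
          have e1 := (g2 ω).1.2.2.2.2.2.2.2.2.2.2.2
          have e2 := (g2 ω').1.2.2.2.2.2.2.2.2.2.2.2
          rw [← e2, ← h, e1]
          exact hμ'
        · exact ⟨PMF.pure t, fun h => absurd h ht⟩
      choose ν hν using key
      have h3 := Tri.loop_next (ν := ν) hab g1
        (t' := τ * (P.iterTime + 1) + 1) (by
          intro t ht
          rw [PMF.mem_support_map_iff] at ht
          obtain ⟨ω, _, rfl⟩ := ht
          exact (hν _ ⟨ω, rfl⟩).1)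
      refine ⟨_, h3.mono (by ring_nf; omega), ?_⟩
      rw [PMF.bind_map, PMF.toOuterMeasure_bind_apply, tsum_fintype, Par.succ,
        ENNReal.ofReal_div_of_pos (by exact_mod_cast Fintype.card_pos), ENNReal.ofReal_natCast,
        ENNReal.ofReal_sum_of_nonneg fun ω _ => Par.succ_nonneg .., ENNReal.div_eq_inv_mul,
        Finset.mul_sum]
      refine Finset.sum_le_sum fun ω _ => ?_
      rw [PMF.uniformOfFintype_apply]
      gcongr
      exact (hν (S ω) ⟨ω, rfl⟩).2 ω rfl
    | test u i d =>
      obtain ⟨u, hu⟩ | ⟨c, h1, h2⟩ := hc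
      · cases hu
      have hlt : s.reg 34 < P.s := h1.top_lt_iff.mpr (by omega)
      have hab : s.reg 34 < s.reg 35 := by rw [hx.2.2.1]; exact hlt
      obtain ⟨t, t1, t2, t3⟩ := iterProg_test (D := D) hw hb hx h1 hlt
      obtain ⟨μ, hμ, hμ'⟩ := ih t _ t2 (Or.inr ⟨c + 1, t3, by omega⟩)
      refine ⟨μ, ?_, hμ'⟩
      have h3 := Tri.loop_next (ν := fun _ => μ) hab t1
        (t' := τ * (P.iterTime + 1) + 1) (by
          intro t' ht
          obtain rfl : t' = t := by simpa using ht
          exact hμ)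
      rw [PMF.pure_bind] at h3
      exact h3.mono (by ring_nf; omega)

/-! ### The whole program -/

/-- Compute the parameters of the run. -/
def setupProg (p q C a : ℕ) : Prog :=
  block [const 12 0, const 13 1, const 14 2, const 11 8, const 16 q, const 17 p, const 18 C,
    op div 4 2 1, op add 4 4 13, op div 5 0 4, op add 5 5 13, op add 5 5 1, op mul 6 1 4,
    op add 7 6 13, const 40 7, op mul 8 40 7, const 40 200, op mul 9 40 2, op div 10 0 2,
    const 40 a, op mul 10 40 10, op mul 15 7 7, op add 19 0 13, op add 20 0 14, op add 21 20 13,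
    op add 22 21 13, op add 35 2 12]

/-- The program that solves the learning problem. -/
def learnProg (p q C a : ℕ) : Prog := .seq (setupProg p q C a) (loop 34 35 iterProg)

/-- The running time of the program. -/
def Par.totalTime (P : Par) : ℕ := P.iters * (P.iterTime + 1) + 100

theorem start_eq (hw : P.Fits w) (Pr : Prog) : start w Pr P.n P.k P.s P.m =
    ([Pr], ((((⟨fun _ => 0, fun _ => 0⟩ : Store).put 0 P.n).put 1 P.k).put 2 P.s).put 3 P.m) := by
  unfold Par.Fits at hw
  have hX := P.eight_le_X
  have hXX : 8 * P.X ≤ P.X * P.X := Nat.mul_le_mul_right _ hX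
  have h1 := P.n_le_X; have h2 := P.k_le_X; have h3 := P.s_le_X; have h4 := P.m_le_X
  unfold start
  rw [Store.setReg_eq (by omega), Store.setReg_eq (by omega), Store.setReg_eq (by omega),
    Store.setReg_eq (by omega)]

theorem learnProg_spec [NeZero P.m1] (hw : P.Fits w) (hb : 0 < P.base) (hs : 0 < P.s)
    (hm : P.m1 < P.m) (D : Data P.n P.m) (v : Fin P.n → ZMod 2) :
    ∃ μ, Ends w D (start w (learnProg P.p P.q P.C P.a) P.n P.k P.s P.m) P.totalTime μ ∧
      ENNReal.ofReal (P.succ D v P.iters .idle) ≤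
        μ.toOuterMeasure {s | ∀ y : Fin P.n, s.mem y = (v y).val} := by
  rw [start_eq hw]
  have hw0 := hw.ne_zero
  have hw' := hw
  unfold Par.Fits at hw
  have hX := P.eight_le_X
  have hXX : 8 * P.X ≤ P.X * P.X := Nat.mul_le_mul_right _ hX
  have hq : P.q ≤ P.X := by unfold Par.X; omega
  have hp : P.p ≤ P.X := by unfold Par.X; omega
  have hC : P.C ≤ P.X := by unfold Par.X; omega
  have h1 := P.n_le_X; have h2 := P.k_le_X; have h3 := P.s_le_X; have h4 := P.m_le_X
  have h5 := P.g_le_X; have h6 := P.Q_le_X; have h7 := P.K_lt_X; have h8 := P.m1_le_X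
  have h9 := P.base_le_X; have h10 := P.r_le_X
  have h11 : (P.K + 1) * (P.K + 1) ≤ P.X * P.X := Par.sq_le_X h7 h7
  have ha : P.a ≤ P.base := Nat.le_mul_of_pos_right _
    (Nat.pos_of_ne_zero fun h => by unfold Par.base at hb; rw [h] at hb; simp at hb)
  have g1 : P.s / P.k + 1 = P.g := rfl
  have g2 : P.n / P.g + 1 + P.k = P.Q := rfl
  have g3 : P.k * P.g = P.K := rfl
  have g4 : 7 * (P.K + 1) = P.r := rfl
  have g5 : 200 * P.s = P.m1 := rfl
  have g6 : P.a * (P.n / P.s) = P.base := rfl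
  set s0 : Store := ((((⟨fun _ => 0, fun _ => 0⟩ : Store).put 0 P.n).put 1 P.k).put 2 P.s).put 3 P.m
    with hs0
  have ns : P.n / P.s ≤ P.n := Nat.div_le_self _ _
  have e1 := triD_exec (w := w) (D := D) (setupProg P.p P.q P.C P.a) s0 (by
    simp [setupProg, block, Safe, exec, BinOp.eval, hs0, g1, g2, g3, g4, g5, g6, hw0]
    omega)
  set s1 := exec D (setupProg P.p P.q P.C P.a) s0 with hs1
  have hc : P.Consts s1 := by
    constructor <;>
      simp [hs1, setupProg, block, exec, BinOp.eval, hs0, g1, g2, g3, g4, g5, g6]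
  have hmem : s1.mem = fun _ => 0 := rfl
  have h34 : s1.reg 34 = 0 := by simp [hs1, setupProg, block, exec, hs0]
  have hh : P.Holds s1 .idle := by
    refine ⟨hc, ?_, ?_, fun y _ => by rw [hmem]⟩
    · simp [hs1, setupProg, block, exec, hs0]
    · simp [hs1, setupProg, block, exec, BinOp.eval, hs0]
  have hcnt : P.Counter s1 0 := by
    refine ⟨fun x _ => ?_, ?_⟩
    · rw [hmem]; exact hb
    · unfold Par.cnt
      rw [hmem, h34]
      simp [Par.arr]
  obtain ⟨μ, h12, h13⟩ := loop_spec (D := D) hw' hb hm v P.iters s1 .idle hh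
    (Or.inr ⟨0, hcnt, zero_add _⟩)
  refine ⟨μ, ?_, h13⟩
  have h14 := (e1.seqTri h12) [] 0 PMF.pure fun s' _ T _ => by
    rw [run_nil, PMF.pure_map]
  rw [PMF.bind_pure] at h14
  refine h14.mono ?_
  simp [setupProg, block, Prog.time, Par.totalTime]
  omega

end Loop

/-! ### Expectations over independent samples -/

section Expectation

variable {α : Type*} [Fintype α]

/-- The expectation of `f` over `m` independent draws with weights `μ`. -/
noncomputable def ex (μ : α → ℝ) (m : ℕ) (f : (Fin m → α) → ℝ) : ℝ :=
  ∑ D : Fin m → α, (∏ i, μ (D i)) * f D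

variable {μ : α → ℝ} {m : ℕ}

theorem ex_mono (hμ : ∀ a, 0 ≤ μ a) {f g : (Fin m → α) → ℝ} (h : ∀ D, f D ≤ g D) :
    ex μ m f ≤ ex μ m g :=
  Finset.sum_le_sum fun D _ =>
    mul_le_mul_of_nonneg_left (h D) (Finset.prod_nonneg fun _ _ => hμ _)

theorem ex_add (f g : (Fin m → α) → ℝ) : ex μ m (fun D => f D + g D) = ex μ m f + ex μ m g := by
  simp [ex, mul_add, Finset.sum_add_distrib]

theorem ex_const_mul (c : ℝ) (f : (Fin m → α) → ℝ) : ex μ m (fun D => c * f D) = c * ex μ m f := by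
  rw [ex, ex, Finset.mul_sum]
  exact Finset.sum_congr rfl fun D _ => by ring

theorem ex_sum {ι : Type*} (S : Finset ι) (f : ι → (Fin m → α) → ℝ) :
    ex μ m (fun D => ∑ i ∈ S, f i D) = ∑ i ∈ S, ex μ m (f i) := by
  simp only [ex, Finset.mul_sum]
  exact Finset.sum_comm

theorem ex_prod (f : Fin m → α → ℝ) :
    ex μ m (fun D => ∏ i, f i (D i)) = ∏ i, ∑ a, μ a * f i a := by
  classical
  rw [Finset.prod_univ_sum, Fintype.piFinset_univ]
  exact Finset.sum_congr rfl fun D _ => Finset.prod_mul_distrib.symm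

theorem ex_const (h1 : ∑ a, μ a = 1) (c : ℝ) : ex μ m (fun _ => c) = c := by
  have := ex_prod (μ := μ) (m := m) fun _ _ => 1
  simp only [Finset.prod_const_one, mul_one, h1] at this
  have h2 := ex_const_mul (μ := μ) (m := m) c fun _ => 1
  simp only [mul_one] at h2
  rw [h2, this, mul_one]

/-- A function of the draws in `p` is independent of the other draws. -/
theorem ex_mul_prod (h1 : ∑ a, μ a = 1) (p : Fin m → Prop) {h : (Fin m → α) → ℝ}
    (hh : ∀ D D', (∀ i, p i → D i = D' i) → h D = h D') (f : Fin m → α → ℝ)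
    (hf : ∀ i, p i → f i = 1) :
    ex μ m (fun D => h D * ∏ i, f i (D i)) = ex μ m h * ∏ i, ∑ a, μ a * f i a := by
  classical
  have hne : Nonempty α := by
    by_contra hc
    rw [not_nonempty_iff] at hc
    simp at h1
  let e := Equiv.piEquivPiSubtypeProd p fun _ : Fin m => α
  have key : ∀ f : Fin m → α → ℝ, (∀ i, p i → f i = 1) →
      ex μ m (fun D => h D * ∏ i, f i (D i)) =
        (∑ D1 : {i // p i} → α, (∏ i, μ (D1 i)) * h (e.symm (D1, fun _ => Classical.arbitrary α))) *
          ∏ i, ∑ a, μ a * f i a := by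
    intro f hf
    have h2 : ∏ i, ∑ a, μ a * f i a = ∏ i : {i // ¬ p i}, ∑ a, μ a * f i a := by
      rw [← Fintype.prod_subtype_mul_prod_subtype p, Finset.prod_eq_one, one_mul]
      intro i _
      simp [hf i i.2, h1]
    rw [h2, Finset.prod_univ_sum, Fintype.piFinset_univ, Finset.sum_mul_sum, ex,
      ← Fintype.sum_prod_type', ← Equiv.sum_comp e.symm]
    refine Finset.sum_congr rfl fun D _ => ?_
    obtain ⟨D1, D2⟩ := D
    have a1 : ∀ i : {i // p i}, e.symm (D1, D2) i = D1 i := fun i => by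
      simp [e, Equiv.piEquivPiSubtypeProd, i.2]
    have a2 : ∀ i : {i // ¬ p i}, e.symm (D1, D2) i = D2 i := fun i => by
      simp [e, Equiv.piEquivPiSubtypeProd, i.2]
    have a3 : h (e.symm (D1, D2)) = h (e.symm (D1, fun _ => Classical.arbitrary α)) :=
      hh _ _ fun i hi => by simp [e, Equiv.piEquivPiSubtypeProd, hi]
    rw [a3, ← Fintype.prod_subtype_mul_prod_subtype p,
      ← Fintype.prod_subtype_mul_prod_subtype p fun i => f i _, Finset.prod_mul_distrib]
    simp only [a1, a2]
    rw [Finset.prod_eq_one (f := fun i : {i // p i} => f i (D1 i))]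
    · ring
    · intro i _
      rw [hf i i.2]; rfl
  rw [key f hf]
  congr 1
  have := key (fun _ => 1) fun _ _ => rfl
  simpa [h1] using this.symm

end Expectation

/-! ### The law of a sample -/

section Sample

variable {n : ℕ} {η : ℝ} (hη : η ∈ Set.Icc (0 : ℝ) 1) (secret : Fin n → ZMod 2)

/-- The probability of a sample, as a real number. -/
noncomputable def weight (a : Vec n) : ℝ := (sample η hη secret a).toReal

theorem weight_nonneg (a : Vec n) : 0 ≤ weight hη secret a := ENNReal.toReal_nonneg

theorem weight_eq (x : Fin n → ZMod 2) (y : ZMod 2) : weight hη secret (x, y) =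
    (if y = x ⬝ᵥ secret then 1 - η else η) / 2 ^ n := by
  classical
  have h0 := hη.1
  have h1 := hη.2
  unfold weight sample
  rw [PMF.bind_apply, tsum_fintype, Finset.sum_eq_single x]
  · rw [PMF.map_apply, tsum_fintype, Finset.sum_eq_single (y - x ⬝ᵥ secret)]
    · rw [if_pos (by simp), PMF.uniformOfFintype_apply, noise, PMF.ofFintype_apply]
      have h2 : (y - x ⬝ᵥ secret = 1) ↔ ¬ (y = x ⬝ᵥ secret) := by
        generalize x ⬝ᵥ secret = z
        revert y z
        decide
      rw [ENNReal.toReal_mul, ENNReal.toReal_inv, div_eq_inv_mul]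
      congr 1
      · simp
      · by_cases h3 : y = x ⬝ᵥ secret
        · rw [if_neg (by rwa [h2, not_not]), if_pos h3, ENNReal.toReal_ofReal (by linarith)]
        · rw [if_pos (h2.mpr h3), if_neg h3, ENNReal.toReal_ofReal h0]
    · intro e _ he
      rw [if_neg]
      intro h
      apply he
      rw [(Prod.mk.inj h).2]
      ring
    · simp
  · intro x' _ hx'
    rw [PMF.map_apply, tsum_fintype, Finset.sum_eq_zero, mul_zero]
    intro e _
    rw [if_neg]
    intro h
    exact hx' (Prod.mk.inj h).1.symm
  · simp

theorem sum_weight_mul (f : Vec n → ℝ) : ∑ a, weight hη secret a * f a =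
    (∑ x, ((1 - η) * f (x, x ⬝ᵥ secret) + η * f (x, x ⬝ᵥ secret + 1))) / 2 ^ n := by
  rw [Fintype.sum_prod_type, Finset.sum_div]
  refine Finset.sum_congr rfl fun x _ => ?_
  have h : ∀ g : ZMod 2 → ℝ, ∑ e, g e = g (x ⬝ᵥ secret) + g (x ⬝ᵥ secret + 1) := by
    intro g
    have h2 : ∑ e, g e = g 0 + g 1 := Fin.sum_univ_two g
    rw [h2]
    obtain h3 | h3 : x ⬝ᵥ secret = 0 ∨ x ⬝ᵥ secret = 1 := by
      generalize x ⬝ᵥ secret = z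
      revert z; decide
    · rw [h3, zero_add]
    · rw [h3, show (1 + 1 : ZMod 2) = 0 by decide, add_comm]
  rw [h, weight_eq, weight_eq, if_pos rfl, if_neg (by simp)]
  ring

theorem sum_weight : ∑ a, weight hη secret a = 1 := by
  have := sum_weight_mul hη secret fun _ => 1
  simp only [mul_one] at this
  rw [this]
  simp

/-- The scalar product with a nonzero vector is a uniform bit. -/
theorem sum_dotProduct {w : Fin n → ZMod 2} (hw : w ≠ 0) (f : ZMod 2 → ℝ) :
    ∑ x : Fin n → ZMod 2, f (x ⬝ᵥ w) = (f 0 + f 1) / 2 * 2 ^ n := by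
  classical
  obtain ⟨j, hj⟩ := Function.ne_iff.mp hw
  have hj1 : w j = 1 := zmod_two_eq_one hj
  have h1 : ∑ x : Fin n → ZMod 2, f (x ⬝ᵥ w) = ∑ x : Fin n → ZMod 2, f (x ⬝ᵥ w + 1) := by
    rw [← Equiv.sum_comp (Equiv.addRight (Pi.single j (1 : ZMod 2)))]
    refine Finset.sum_congr rfl fun x _ => ?_
    simp [add_dotProduct, hj1]
  have h2 : ∀ z : ZMod 2, f z + f (z + 1) = f 0 + f 1 := by
    intro z
    obtain rfl | rfl : z = 0 ∨ z = 1 := by revert z; decide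
    · rw [zero_add]
    · rw [show (1 + 1 : ZMod 2) = 0 by decide, add_comm]
  have h3 : ∑ x : Fin n → ZMod 2, f (x ⬝ᵥ w) + ∑ x : Fin n → ZMod 2, f (x ⬝ᵥ w + 1) =
      (f 0 + f 1) * 2 ^ n := by
    rw [← Finset.sum_add_distrib]
    simp only [h2]
    simp
    ring
  rw [← h1] at h3
  linarith

end Sample

/-! ### The expected length of the search -/

section Chain

open Classical

variable {P : Par} (D : Data P.n P.m)

/-- The number of disagreements of the first `j` test samples with `v`. -/
def Par.disCount (P : Par) (D : Data P.n P.m) (v : Fin P.n → ZMod 2) (j : ℕ) : ℕ :=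
  ∑ i ∈ Finset.range j, dis D v (P.m1 + i)

/-- The vector `v` is not rejected after the first `j` test samples. -/
def Par.Alive (P : Par) (D : Data P.n P.m) (v : Fin P.n → ZMod 2) (j : ℕ) : Prop :=
  P.q * P.disCount D v j ≤ P.C + P.p * j

/-- The cost of testing a wrong vector: the number of iterations it takes, where accepting it counts
as all iterations. -/
noncomputable def Par.cost (P : Par) (D : Data P.n P.m) (v : Fin P.n → ZMod 2) : ℝ :=
  (∑ l ∈ Finset.Ioc 0 (P.m - P.m1), if P.Alive D v l then (1 : ℝ) else 0) +
    P.iters * if P.Alive D v (P.m - P.m1) then (1 : ℝ) else 0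

/-- The probability that the vector `s` is proposed. -/
noncomputable def Par.hit [NeZero P.m1] (D : Data P.n P.m) (s : Fin P.n → ZMod 2) : ℝ :=
  (∑ ω : P.Seed, if P.prop D ω = s then (1 : ℝ) else 0) / Fintype.card P.Seed

/-- The expected cost of the wrong vectors in one proposal. -/
noncomputable def Par.wrongCost [NeZero P.m1] (D : Data P.n P.m) (s : Fin P.n → ZMod 2) : ℝ :=
  (∑ ω : P.Seed, if P.prop D ω = s then 0 else P.cost D (P.prop D ω)) / Fintype.card P.Seed

/-- A bound, in terms of a bound `R` for the state `idle`, on the expected number of iterations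
before `s` is accepted. -/
noncomputable def Par.pot (P : Par) (D : Data P.n P.m) (s : Fin P.n → ZMod 2) (R : ℝ) :
    Phase P.n → ℝ
  | .done u => if u = s then 0 else P.iters
  | .idle => R
  | .test u i _ => if u = s then (P.m : ℝ) - i else
      (∑ l ∈ Finset.Ioc (i - P.m1) (P.m - P.m1), if P.Alive D u l then (1 : ℝ) else 0) +
        P.iters * (if P.Alive D u (P.m - P.m1) then (1 : ℝ) else 0) + 1 + R

variable {D}

/-- A test lowers the potential by `1`. -/
theorem Par.pot_next {s : Fin P.n → ZMod 2} {R : ℝ} (hR : 0 ≤ R)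
    (hs : ∀ l, 0 < l → l ≤ P.m - P.m1 → P.Alive D s l) {u : Fin P.n → ZMod 2} {i : ℕ}
    (hi : P.m1 ≤ i) (him : i < P.m) :
    P.pot D s R (P.next D u i (P.disCount D u (i - P.m1))) + 1 ≤
      P.pot D s R (.test u i (P.disCount D u (i - P.m1))) := by
  have hcount : P.disCount D u (i - P.m1) + dis D u i = P.disCount D u (i + 1 - P.m1) := by
    rw [show i + 1 - P.m1 = i - P.m1 + 1 by omega, Par.disCount, Par.disCount,
      Finset.sum_range_succ, show P.m1 + (i - P.m1) = i by omega]
  have hdead : (P.C + P.p * (i + 1 - P.m1) < P.q * P.disCount D u (i + 1 - P.m1)) ↔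
      ¬ P.Alive D u (i + 1 - P.m1) := by
    unfold Par.Alive; omega
  have hsum : ∀ S : Finset ℕ, (0 : ℝ) ≤ ∑ l ∈ S, if P.Alive D u l then (1 : ℝ) else 0 := fun S =>
    Finset.sum_nonneg fun l _ => by split_ifs <;> norm_num
  have hI : (0 : ℝ) ≤ P.iters := Nat.cast_nonneg _
  have hlast : (0 : ℝ) ≤ P.iters * (if P.Alive D u (P.m - P.m1) then (1 : ℝ) else 0) :=
    mul_nonneg hI (by split_ifs <;> norm_num)
  unfold Par.next
  rw [hcount]
  simp only [hdead]
  by_cases hal : P.Alive D u (i + 1 - P.m1)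
  · rw [if_neg (not_not.mpr hal)]
    by_cases hlt : i + 1 < P.m
    · rw [if_pos hlt]
      simp only [Par.pot]
      split_ifs with h1
      · push_cast; linarith
      all_goals
        have h3 : Finset.Ioc (i - P.m1) (P.m - P.m1) =
            insert (i + 1 - P.m1) (Finset.Ioc (i + 1 - P.m1) (P.m - P.m1)) := by
          ext l; simp only [Finset.mem_Ioc, Finset.mem_insert]; omega
        rw [h3, Finset.sum_insert (by simp), if_pos hal]
        linarith
    · rw [if_neg hlt]
      have h3 : i + 1 = P.m := by omega
      rw [h3] at hal
      simp only [Par.pot, if_pos hal]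
      have h4 : (P.m : ℝ) = i + 1 := by exact_mod_cast h3.symm
      split_ifs with h1
      · linarith
      · have := hsum (Finset.Ioc (i - P.m1) (P.m - P.m1))
        linarith
  · rw [if_pos hal]
    simp only [Par.pot]
    split_ifs with h1
    · exact absurd (h1 ▸ hs _ (by omega) (by omega)) hal
    all_goals
      have := hsum (Finset.Ioc (i - P.m1) (P.m - P.m1))
      linarith

/-- If the tests never reject `s`, the search fails to accept `s` with a probability that is small
when there are many iterations. -/
theorem Par.succ_bound [NeZero P.m1] (hm : P.m1 < P.m) {s : Fin P.n → ZMod 2}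
    (hs : ∀ l, 0 < l → l ≤ P.m - P.m1 → P.Alive D s l) (hhit : 0 < P.hit D s) :
    P.iters * (1 - P.succ D s P.iters .idle) ≤
      (2 + P.wrongCost D s) / P.hit D s + (P.m - P.m1 : ℕ) := by
  set R : ℝ := (2 + P.wrongCost D s) / P.hit D s + (P.m - P.m1 : ℕ) with hRdef
  have hcard : (0 : ℝ) < Fintype.card P.Seed := by exact_mod_cast Fintype.card_pos
  have hcost : ∀ u, 0 ≤ P.cost D u := fun u => by
    unfold Par.cost
    refine add_nonneg (Finset.sum_nonneg fun l _ => by split_ifs <;> norm_num)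
      (mul_nonneg (Nat.cast_nonneg _) (by split_ifs <;> norm_num))
  have hwc : 0 ≤ P.wrongCost D s := div_nonneg (Finset.sum_nonneg fun ω _ => by
    split_ifs
    · exact le_rfl
    · exact hcost _) hcard.le
  have hR : 0 ≤ R := by positivity
  -- One proposal lowers the potential of the idle state by `1` in the mean.
  have hidle : (∑ ω : P.Seed, P.pot D s R (.test (P.prop D ω) P.m1 0)) / Fintype.card P.Seed + 1
      ≤ R := by
    have h1 : ∀ ω : P.Seed, P.pot D s R (.test (P.prop D ω) P.m1 0) ≤
        (P.m - P.m1 : ℕ) * (if P.prop D ω = s then (1 : ℝ) else 0) +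
        ((if P.prop D ω = s then 0 else P.cost D (P.prop D ω)) +
        (1 + R) - R * (if P.prop D ω = s then (1 : ℝ) else 0)) := by
      intro ω
      simp only [Par.pot, Nat.sub_self]
      split_ifs
      · rw [Nat.cast_sub hm.le]; linarith
      all_goals
        simp_all [Par.cost]
        try linarith
    have h2 := Finset.sum_le_sum fun ω (_ : ω ∈ Finset.univ) => h1 ω
    rw [Finset.sum_add_distrib, Finset.sum_sub_distrib, Finset.sum_add_distrib, ← Finset.mul_sum,
      ← Finset.mul_sum, Finset.sum_const, Finset.card_univ, nsmul_eq_mul] at h2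
    have h3 := div_le_div_of_nonneg_right h2 hcard.le
    have h4 : ((P.m - P.m1 : ℕ) * (∑ ω : P.Seed, if P.prop D ω = s then (1 : ℝ) else 0) +
        ((∑ ω : P.Seed, if P.prop D ω = s then 0 else P.cost D (P.prop D ω)) +
        Fintype.card P.Seed * (1 + R) - R * ∑ ω : P.Seed, if P.prop D ω = s then (1 : ℝ) else 0)) /
        Fintype.card P.Seed =
        (P.m - P.m1 : ℕ) * P.hit D s + (P.wrongCost D s + (1 + R) - R * P.hit D s) := by
      unfold Par.hit Par.wrongCost
      field_simp
    rw [h4] at h3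
    have h5 : R * P.hit D s = 2 + P.wrongCost D s + (P.m - P.m1 : ℕ) * P.hit D s := by
      rw [hRdef]; field_simp
    linarith
  have key : ∀ T ≤ P.iters, ∀ x : Phase P.n,
      (∀ u i d, x = .test u i d → P.m1 ≤ i ∧ i < P.m ∧ d = P.disCount D u (i - P.m1)) →
      T * (1 - P.succ D s T x) ≤ P.pot D s R x := by
    intro T
    induction T with
    | zero =>
      intro _ x hx
      rw [Nat.cast_zero, zero_mul]
      cases x with
      | done u => simp only [Par.pot]; split_ifs <;> positivity
      | idle => exact hR
      | test u i d =>
        obtain ⟨_, h2, _⟩ := hx u i d rfl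
        have h3 : (i : ℝ) < P.m := by exact_mod_cast h2
        simp only [Par.pot]
        split_ifs <;> first | linarith | positivity
    | succ T ih =>
      intro hT x hx
      cases x with
      | done u =>
        simp only [Par.pot, Par.succ]
        split_ifs
        · simp
        · have : ((T + 1 : ℕ) : ℝ) ≤ P.iters := by exact_mod_cast hT
          linarith
      | test u i d =>
        obtain ⟨h1, h2, rfl⟩ := hx u i d rfl
        have h3 := Par.pot_next (D := D) hR hs (u := u) h1 h2
        have h4 := P.succ_nonneg (D := D) s T (P.next D u i (P.disCount D u (i - P.m1)))
        have h5 := ih (by omega) (P.next D u i (P.disCount D u (i - P.m1))) (by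
          intro u' i' d' h
          unfold Par.next at h
          split_ifs at h with h6 h7
          obtain ⟨rfl, rfl, rfl⟩ := Phase.test.inj h
          refine ⟨by omega, h7, ?_⟩
          rw [show i + 1 - P.m1 = i - P.m1 + 1 by omega, Par.disCount, Par.disCount,
            Finset.sum_range_succ, show P.m1 + (i - P.m1) = i by omega])
        rw [Par.succ]
        push_cast
        linarith
      | idle =>
        rw [Par.succ]
        have h1 : ∀ ω : P.Seed, ((T + 1 : ℕ) : ℝ) *
            (1 - P.succ D s T (.test (P.prop D ω) P.m1 0)) ≤
            P.pot D s R (.test (P.prop D ω) P.m1 0) + 1 := by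
          intro ω
          have h4 := P.succ_nonneg (D := D) s T (.test (P.prop D ω) P.m1 0)
          have h5 := ih (by omega) (.test (P.prop D ω) P.m1 0) (by
            intro u' i' d' h
            obtain ⟨rfl, rfl, rfl⟩ := Phase.test.inj h
            exact ⟨le_rfl, hm, by simp [Par.disCount]⟩)
          push_cast
          linarith
        have h2 := Finset.sum_le_sum fun ω (_ : ω ∈ Finset.univ) => h1 ω
        rw [← Finset.mul_sum, Finset.sum_sub_distrib, Finset.sum_add_distrib, Finset.sum_const,
          Finset.card_univ, nsmul_eq_mul, mul_one] at h2
        have h3 := div_le_div_of_nonneg_right h2 hcard.le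
        rw [add_div, div_self hcard.ne'] at h3
        refine le_trans (le_of_eq ?_) (h3.trans hidle)
        field_simp
  exact key P.iters le_rfl .idle (by simp)

end Chain

/-! ### Exponential moments -/

section Moments

open Classical

/-- Whether a sample disagrees with `v`, as a number. -/
def disVec {n : ℕ} (v : Fin n → ZMod 2) (a : Vec n) : ℕ := (a.1 ⬝ᵥ v + a.2).val

theorem dis_eq {n m : ℕ} (D : Data n m) (v : Fin n → ZMod 2) (i : ℕ) :
    dis D v i = disVec v (row D i) := rfl

/-- Samples with numbers in `S` are independent, and independent of the other samples. -/
theorem ex_mul_prod_row {n m : ℕ} {μ : Vec n → ℝ} (h1 : ∑ a, μ a = 1) {S : Finset ℕ}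
    (hS : S ⊆ Finset.range m) {h : Data n m → ℝ}
    (hh : ∀ D D' : Data n m, (∀ i ∉ S, row D i = row D' i) → h D = h D') (φ : Vec n → ℝ) :
    ex μ m (fun D => h D * ∏ i ∈ S, φ (row D i)) = ex μ m h * (∑ a, μ a * φ a) ^ S.card := by
  have key := ex_mul_prod (m := m) h1 (fun i => (i : ℕ) ∉ S) (h := h)
    (fun D D' hD => hh D D' fun i hi => by
      unfold row
      split_ifs with hm
      · exact hD ⟨i, hm⟩ hi
      · rfl)
    (fun i => if (i : ℕ) ∈ S then φ else 1) (fun i hi => if_neg hi)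
  have h2 : ∀ D : Data n m, ∏ i : Fin m, (if (i : ℕ) ∈ S then φ else 1) (D i) =
      ∏ i ∈ S, φ (row D i) := by
    intro D
    rw [← Finset.inter_eq_right.mpr hS, ← Finset.prod_ite_mem, Finset.prod_range]
    refine Finset.prod_congr rfl fun i _ => ?_
    have h3 : row D i = D i := by
      unfold row
      rw [dif_pos i.2]
    rw [h3, Finset.inter_eq_right.mpr hS]
    split_ifs <;> rfl
  simp only [h2] at key
  rw [key]
  congr 1
  rw [← Finset.prod_const, ← Finset.inter_eq_right.mpr hS, ← Finset.prod_ite_mem,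
    Finset.prod_range]
  refine Finset.prod_congr rfl fun i _ => ?_
  rw [Finset.inter_eq_right.mpr hS]
  split_ifs
  · rfl
  · simpa using h1

theorem ex_prod_row {n m : ℕ} {μ : Vec n → ℝ} (h1 : ∑ a, μ a = 1) {S : Finset ℕ}
    (hS : S ⊆ Finset.range m) (φ : Vec n → ℝ) :
    ex μ m (fun D => ∏ i ∈ S, φ (row D i)) = (∑ a, μ a * φ a) ^ S.card := by
  have h := ex_mul_prod_row (m := m) h1 hS (h := fun _ => 1) (fun _ _ _ => rfl) φ
  rw [ex_const h1, one_mul] at h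
  rw [← h]
  congr 1
  funext D
  rw [one_mul]

variable {n : ℕ} {η : ℝ} (hη : η ∈ Set.Icc (0 : ℝ) 1) (s : Fin n → ZMod 2)

/-- A sample disagrees with the secret with probability `η`. -/
theorem sum_weight_disVec_secret (g : ℕ → ℝ) :
    ∑ a, weight hη s a * g (disVec s a) = (1 - η) * g 0 + η * g 1 := by
  have h1 : ∀ x : Fin n → ZMod 2, disVec s (x, x ⬝ᵥ s) = 0 := fun x => by
    simp only [disVec]
    generalize x ⬝ᵥ s = z
    revert z; decide
  have h2 : ∀ x : Fin n → ZMod 2, disVec s (x, x ⬝ᵥ s + 1) = 1 := fun x => by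
    simp only [disVec]
    generalize x ⬝ᵥ s = z
    revert z; decide
  rw [sum_weight_mul]
  simp only [h1, h2]
  simp
  field_simp

/-- A sample disagrees with a wrong vector with probability `1 / 2`. -/
theorem sum_weight_disVec {v : Fin n → ZMod 2} (hv : v ≠ s) (g : ℕ → ℝ) :
    ∑ a, weight hη s a * g (disVec v a) = (g 0 + g 1) / 2 := by
  have hw : v + s ≠ 0 := by
    intro h
    apply hv
    funext j
    have := congrFun h j
    simp only [Pi.add_apply, Pi.zero_apply] at this
    generalize v j = a at *
    generalize s j = b at *
    revert a b; decide
  rw [sum_weight_mul]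
  have h1 : ∀ x : Fin n → ZMod 2, disVec v (x, x ⬝ᵥ s) = (x ⬝ᵥ (v + s)).val := fun x => by
    simp [disVec, dotProduct_add]
  have h2 : ∀ x : Fin n → ZMod 2, disVec v (x, x ⬝ᵥ s + 1) = (x ⬝ᵥ (v + s) + 1).val := fun x => by
    simp [disVec, dotProduct_add, add_assoc]
  simp only [h1, h2]
  rw [Finset.sum_add_distrib, ← Finset.mul_sum, ← Finset.mul_sum,
    sum_dotProduct hw fun z => g z.val, sum_dotProduct hw fun z => g (z + 1).val]
  have e0 : (0 : ZMod 2).val = 0 := rfl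
  have e1 : (1 : ZMod 2).val = 1 := rfl
  have e2 : (0 + 1 : ZMod 2).val = 1 := rfl
  have e3 : (1 + 1 : ZMod 2).val = 0 := rfl
  rw [e0, e1, e2, e3]
  field_simp
  ring

end Moments

/-! ### Tests -/

section Tests

open Classical

variable {P : Par} {η : ℝ} (hη : η ∈ Set.Icc (0 : ℝ) 1) (s : Fin P.n → ZMod 2)

theorem exp_disCount (D : Data P.n P.m) (v : Fin P.n → ZMod 2) (l : ℕ) (t : ℝ) :
    ∏ i ∈ Finset.Ico P.m1 (P.m1 + l), Real.exp (t * (P.q * disVec v (row D i) - P.p)) =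
      Real.exp (t * (P.q * P.disCount D v l - P.p * l)) := by
  rw [← Real.exp_sum, Finset.sum_Ico_eq_sum_range, Nat.add_sub_cancel_left, ← Finset.mul_sum,
    Finset.sum_sub_distrib, ← Finset.mul_sum, Finset.sum_const, Finset.card_range, nsmul_eq_mul,
    Par.disCount]
  push_cast
  rw [mul_comm (l : ℝ)]
  rfl

/-- The secret is unlikely to be rejected after `l` tests. -/
theorem ex_not_alive_le {l : ℕ} (hl : P.m1 + l ≤ P.m) {t : ℝ} (ht : 0 ≤ t) :
    ex (weight hη s) P.m (fun D => if P.Alive D s l then 0 else 1) ≤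
      Real.exp (-t * P.C) * ((1 - η) * Real.exp (t * (0 - P.p)) + η * Real.exp (t * (P.q - P.p))) ^ l := by
  have h1 : ∀ D : Data P.n P.m, (if P.Alive D s l then (0 : ℝ) else 1) ≤
      Real.exp (-t * P.C) *
        ∏ i ∈ Finset.Ico P.m1 (P.m1 + l), Real.exp (t * (P.q * disVec s (row D i) - P.p)) := by
    intro D
    split_ifs with h
    · exact mul_nonneg (Real.exp_nonneg _) (Finset.prod_nonneg fun _ _ => Real.exp_nonneg _)
    · rw [exp_disCount, ← Real.exp_add]
      apply Real.one_le_exp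
      have h2 : (P.C : ℝ) + P.p * l ≤ P.q * P.disCount D s l := by
        unfold Par.Alive at h
        push Not at h
        exact_mod_cast h.le
      nlinarith
  refine (ex_mono (weight_nonneg hη s) h1).trans (le_of_eq ?_)
  rw [ex_const_mul, ex_prod_row (sum_weight hη s)
    (fun i hi => by simp only [Finset.mem_Ico, Finset.mem_range] at *; omega)
    (fun a => Real.exp (t * (P.q * disVec s a - P.p))),
    sum_weight_disVec_secret hη s fun d => Real.exp (t * (P.q * d - P.p))]
  simp

/-- Proposals depend on the first `m1` samples only. -/
theorem prop_congr [NeZero P.m1] {D D' : Data P.n P.m} (ω : P.Seed)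
    (h : ∀ i < P.m1, row D i = row D' i) : P.prop D ω = P.prop D' ω := by
  unfold Par.prop Par.cand solve
  have : ∀ t < P.r, row D (extend ω.2 t) = row D' (extend ω.2 t) := fun t ht => by
    refine h _ ?_
    rw [extend, dif_pos ht]
    exact (ω.2 _).2
  rw [elimN_congr this]

/-- A wrong proposal is unlikely to survive `l` tests, since it does not depend on them. -/
theorem ex_alive_le [NeZero P.m1] {l : ℕ} (hl : P.m1 + l ≤ P.m) {t : ℝ} (ht : 0 ≤ t) (ω : P.Seed) :
    ex (weight hη s) P.m (fun D => if P.prop D ω = s then 0 else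
      if P.Alive D (P.prop D ω) l then 1 else 0) ≤
      Real.exp (t * P.C) * ((Real.exp (-t * (0 - P.p)) + Real.exp (-t * (P.q - P.p))) / 2) ^ l := by
  set ρ := (Real.exp (-t * (0 - P.p)) + Real.exp (-t * (P.q - P.p))) / 2 with hρ
  -- Sum over the possible proposals `u`, each of which is fixed by the first `m1` samples.
  have h1 : ∀ D : Data P.n P.m, (if P.prop D ω = s then (0 : ℝ) else
      if P.Alive D (P.prop D ω) l then 1 else 0) ≤
      ∑ u ∈ Finset.univ.erase s, (if P.prop D ω = u then Real.exp (t * P.C) else 0) *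
        ∏ i ∈ Finset.Ico P.m1 (P.m1 + l), Real.exp (-t * (P.q * disVec u (row D i) - P.p)) := by
    intro D
    have hnn : ∀ u : Fin P.n → ZMod 2, 0 ≤ (if P.prop D ω = u then Real.exp (t * P.C) else 0) *
        ∏ i ∈ Finset.Ico P.m1 (P.m1 + l), Real.exp (-t * (P.q * disVec u (row D i) - P.p)) :=
      fun u => mul_nonneg (by positivity) (Finset.prod_nonneg fun _ _ => Real.exp_nonneg _)
    split_ifs with h h'
    · exact Finset.sum_nonneg fun u _ => hnn u
    · refine le_trans ?_ (Finset.single_le_sum (fun u _ => hnn u)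
        (Finset.mem_erase.mpr ⟨h, Finset.mem_univ _⟩))
      rw [if_pos rfl, exp_disCount, ← Real.exp_add]
      apply Real.one_le_exp
      have h2 : P.q * P.disCount D (P.prop D ω) l ≤ (P.C : ℝ) + P.p * l := by
        unfold Par.Alive at h'
        exact_mod_cast h'
      nlinarith
    · exact Finset.sum_nonneg fun u _ => hnn u
  refine (ex_mono (weight_nonneg hη s) h1).trans ?_
  rw [ex_sum]
  have h2 : ∀ u ∈ Finset.univ.erase s, ex (weight hη s) P.m (fun D =>
      (if P.prop D ω = u then Real.exp (t * P.C) else 0) *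
        ∏ i ∈ Finset.Ico P.m1 (P.m1 + l), Real.exp (-t * (P.q * disVec u (row D i) - P.p))) =
      ex (weight hη s) P.m (fun D => if P.prop D ω = u then Real.exp (t * P.C) else 0) * ρ ^ l := by
    intro u hu
    rw [ex_mul_prod_row (sum_weight hη s)
      (fun i hi => by simp only [Finset.mem_Ico, Finset.mem_range] at *; omega)
      (fun D D' h => by rw [prop_congr ω fun i hi => h i (by simp only [Finset.mem_Ico]; omega)])
      (fun a => Real.exp (-t * (P.q * disVec u a - P.p))),
      sum_weight_disVec hη s (Finset.ne_of_mem_erase hu) fun d => Real.exp (-t * (P.q * d - P.p))]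
    simp [hρ]
  rw [Finset.sum_congr rfl h2, ← Finset.sum_mul, ← ex_sum]
  have hρ0 : 0 ≤ ρ := by positivity
  refine mul_le_mul_of_nonneg_right ?_ (by positivity)
  refine (ex_mono (weight_nonneg hη s) fun D => ?_).trans
    (ex_const (sum_weight hη s) (Real.exp (t * P.C))).le
  refine (Finset.sum_le_sum_of_subset_of_nonneg (Finset.erase_subset _ _)
    (fun u _ _ => by positivity)).trans ?_
  simp

/-- The wrong vectors of one proposal cost little in the mean: a bounded number of tests, and almost
nothing for the risk to accept them. -/
theorem ex_wrongCost_le [NeZero P.m1] (hm : P.m1 ≤ P.m) {t : ℝ} (ht : 0 ≤ t) {ρ : ℝ}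
    (hρ : (Real.exp (-t * (0 - P.p)) + Real.exp (-t * (P.q - P.p))) / 2 ≤ ρ) (hρ1 : ρ < 1) :
    ex (weight hη s) P.m (fun D => P.wrongCost D s) ≤
      Real.exp (t * P.C) * (1 / (1 - ρ) + P.iters * ρ ^ (P.m - P.m1)) := by
  have hρ0 : 0 ≤ ρ := le_trans (by positivity) hρ
  have hal : ∀ (ω : P.Seed) (l : ℕ), P.m1 + l ≤ P.m →
      ex (weight hη s) P.m (fun D => if P.prop D ω = s then 0 else
      if P.Alive D (P.prop D ω) l then 1 else 0) ≤ Real.exp (t * P.C) * ρ ^ l :=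
    fun ω l hl => (ex_alive_le hη s hl ht ω).trans (by gcongr)
  have h1 : ∀ D : Data P.n P.m, P.wrongCost D s = (1 / Fintype.card P.Seed : ℝ) *
      ∑ ω : P.Seed, (∑ l ∈ Finset.Ioc 0 (P.m - P.m1), (if P.prop D ω = s then (0 : ℝ) else
        if P.Alive D (P.prop D ω) l then 1 else 0) +
      P.iters * (if P.prop D ω = s then (0 : ℝ) else
        if P.Alive D (P.prop D ω) (P.m - P.m1) then 1 else 0)) := by
    intro D
    rw [Par.wrongCost, div_eq_inv_mul, one_div]
    congr 1
    refine Finset.sum_congr rfl fun ω _ => ?_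
    unfold Par.cost
    split_ifs <;> simp
  have h2 : ∀ ω : P.Seed, ex (weight hη s) P.m (fun D =>
      ∑ l ∈ Finset.Ioc 0 (P.m - P.m1), (if P.prop D ω = s then (0 : ℝ) else
        if P.Alive D (P.prop D ω) l then 1 else 0) +
      P.iters * (if P.prop D ω = s then (0 : ℝ) else
        if P.Alive D (P.prop D ω) (P.m - P.m1) then 1 else 0)) ≤
      Real.exp (t * P.C) * (1 / (1 - ρ) + P.iters * ρ ^ (P.m - P.m1)) := by
    intro ω
    rw [ex_add, ex_sum, ex_const_mul]
    have h3 := hal ω (P.m - P.m1) (by omega)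
    have h4 : ∑ l ∈ Finset.Ioc 0 (P.m - P.m1), ex (weight hη s) P.m (fun D =>
        if P.prop D ω = s then (0 : ℝ) else if P.Alive D (P.prop D ω) l then 1 else 0) ≤
        Real.exp (t * P.C) * (1 / (1 - ρ)) := by
      refine (Finset.sum_le_sum fun l hl => hal ω l (by
        have := (Finset.mem_Ioc.mp hl).2; omega)).trans ?_
      rw [← Finset.mul_sum]
      gcongr
      rw [one_div, ← tsum_geometric_of_lt_one hρ0 hρ1]
      exact (summable_geometric_of_lt_one hρ0 hρ1).sum_le_tsum _ fun _ _ => by positivity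
    calc _ ≤ Real.exp (t * P.C) * (1 / (1 - ρ)) +
          P.iters * (Real.exp (t * P.C) * ρ ^ (P.m - P.m1)) := by gcongr
      _ = _ := by ring
  have hcard : (0 : ℝ) < Fintype.card P.Seed := by exact_mod_cast Fintype.card_pos
  simp only [h1]
  rw [ex_const_mul, ex_sum]
  refine (mul_le_mul_of_nonneg_left (Finset.sum_le_sum fun ω _ => h2 ω) (by positivity)).trans ?_
  rw [Finset.sum_const, Finset.card_univ, nsmul_eq_mul, ← mul_assoc, one_div,
    inv_mul_cancel₀ hcard.ne', one_mul]

/-- The number of the first `m1` samples that are noisy. -/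
def Par.noisy (P : Par) (D : Data P.n P.m) (s : Fin P.n → ZMod 2) : ℕ :=
  ∑ i ∈ Finset.range P.m1, dis D s i

/-- The first `m1` samples are unlikely to contain many noisy ones. -/
theorem ex_noisy_le (hm : P.m1 ≤ P.m) :
    ex (weight hη s) P.m (fun D => if 3 / 2 * η * P.m1 < P.noisy D s then 1 else 0) ≤
      Real.exp (-(η * P.m1) / 26) := by
  have hη0 := hη.1
  -- a Chernoff bound with parameter `log 2`
  have h1 : ∀ D : Data P.n P.m, (if 3 / 2 * η * P.m1 < P.noisy D s then (1 : ℝ) else 0) ≤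
      Real.exp (-Real.log 2 * (3 / 2 * η * P.m1)) *
        ∏ i ∈ Finset.range P.m1, Real.exp (Real.log 2 * disVec s (row D i)) := by
    intro D
    rw [← Real.exp_sum, ← Real.exp_add]
    split_ifs with h
    · apply Real.one_le_exp
      rw [← Finset.mul_sum]
      have : (P.noisy D s : ℝ) = ∑ i ∈ Finset.range P.m1, (disVec s (row D i) : ℝ) := by
        unfold Par.noisy; push_cast; rfl
      rw [← this]
      have := Real.log_nonneg one_le_two
      nlinarith
    · exact Real.exp_nonneg _
  refine (ex_mono (weight_nonneg hη s) h1).trans ?_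
  rw [ex_const_mul, ex_prod_row (sum_weight hη s) (by simpa using hm)
    (fun a => Real.exp (Real.log 2 * disVec s a)),
    sum_weight_disVec_secret hη s fun d => Real.exp (Real.log 2 * d)]
  simp only [CharP.cast_eq_zero, mul_zero, Real.exp_zero, Nat.cast_one, mul_one,
    Real.exp_log two_pos, Finset.card_range]
  calc _ ≤ Real.exp (-Real.log 2 * (3 / 2 * η * P.m1)) * Real.exp η ^ P.m1 := by
        refine mul_le_mul_of_nonneg_left (pow_le_pow_left₀ (by linarith) ?_ _) (Real.exp_nonneg _)
        linarith [Real.add_one_le_exp η]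
    _ = Real.exp (η * P.m1 * (1 - 3 / 2 * Real.log 2)) := by
        rw [← Real.exp_nat_mul, ← Real.exp_add]
        congr 1
        ring
    _ ≤ _ := by
        apply Real.exp_le_exp.mpr
        have h2 : 1 - 3 / 2 * Real.log 2 ≤ -1 / 26 := by linarith [Real.log_two_gt_d9]
        have h3 : 0 ≤ η * P.m1 := by positivity
        nlinarith

/-- The noiseless ones among the first `m1` samples whose vector has scalar product `b` with `w`. -/
def Par.cleanCount (P : Par) (D : Data P.n P.m) (s w : Fin P.n → ZMod 2) (b : ZMod 2) : ℕ :=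
  ((Finset.range P.m1).filter fun i => dis D s i = 0 ∧ (row D i).1 ⬝ᵥ w = b).card

/-- It is unlikely that much more than half of the noiseless samples are orthogonal to `w`. -/
theorem ex_cleanCount_le (hη2 : η ≤ 1 / 2) (hm : P.m1 ≤ P.m) {w : Fin P.n → ZMod 2} (hw : w ≠ 0) :
    ex (weight hη s) P.m (fun D =>
      if 9 * P.cleanCount D s w 1 < P.cleanCount D s w 0 then 1 else 0) ≤ (9 / 10 : ℝ) ^ P.m1 := by
  have hη0 := hη.1
  -- the weight `(10 / 11) ^ 9` makes `φ` multiply to at least `1` in the event to be bounded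
  let φ : Vec P.n → ℝ := fun a => if disVec s a = 0 then
    (if a.1 ⬝ᵥ w = 0 then 11 / 10 else (10 / 11) ^ 9) else 1
  have hφ : ∀ a, φ a = (if disVec s a = 0 ∧ a.1 ⬝ᵥ w = 0 then 11 / 10 else 1) *
      (if disVec s a = 0 ∧ a.1 ⬝ᵥ w = 1 then (10 / 11) ^ 9 else 1) := by
    intro a
    simp only [φ]
    by_cases h1 : disVec s a = 0
    · by_cases h2 : a.1 ⬝ᵥ w = 0
      · simp [h1, h2]
      · simp [h1, zmod_two_eq_one h2]
    · simp [h1]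
  have h1 : ∀ D : Data P.n P.m,
      (if 9 * P.cleanCount D s w 1 < P.cleanCount D s w 0 then (1 : ℝ) else 0) ≤
      ∏ i ∈ Finset.range P.m1, φ (row D i) := by
    intro D
    simp only [hφ]
    rw [Finset.prod_mul_distrib, ← Finset.prod_filter, ← Finset.prod_filter, Finset.prod_const,
      Finset.prod_const]
    change _ ≤ (11 / 10 : ℝ) ^ P.cleanCount D s w 0 * ((10 / 11 : ℝ) ^ 9) ^ P.cleanCount D s w 1
    split_ifs with h
    · rw [← pow_mul]
      calc (1 : ℝ) = (11 / 10) ^ (9 * P.cleanCount D s w 1) *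
            (10 / 11) ^ (9 * P.cleanCount D s w 1) := by rw [← mul_pow]; norm_num
        _ ≤ _ := by
          gcongr
          norm_num
    · positivity
  refine (ex_mono (weight_nonneg hη s) h1).trans ?_
  rw [ex_prod_row (sum_weight hη s) (by simpa using hm) φ, Finset.card_range]
  have h2 : ∑ a, weight hη s a * φ a = (1 - η) * ((11 / 10 + (10 / 11) ^ 9) / 2) + η := by
    rw [sum_weight_mul]
    have e1 : ∀ x : Fin P.n → ZMod 2, φ (x, x ⬝ᵥ s) =
        if x ⬝ᵥ w = 0 then 11 / 10 else (10 / 11) ^ 9 := fun x => by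
      have : disVec s (x, x ⬝ᵥ s) = 0 := by
        simp only [disVec]
        generalize x ⬝ᵥ s = z
        revert z; decide
      simp [φ, this]
    have e2 : ∀ x : Fin P.n → ZMod 2, φ (x, x ⬝ᵥ s + 1) = 1 := fun x => by
      have : disVec s (x, x ⬝ᵥ s + 1) = 1 := by
        simp only [disVec]
        generalize x ⬝ᵥ s = z
        revert z; decide
      simp [φ, this]
    simp only [e1, e2]
    rw [Finset.sum_add_distrib, ← Finset.mul_sum,
      sum_dotProduct hw fun z => if z = 0 then (11 / 10 : ℝ) else (10 / 11) ^ 9]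
    simp
    field_simp
  rw [h2]
  have h3 : ((11 / 10 + (10 / 11) ^ 9) / 2 : ℝ) ≤ 8 / 10 := by norm_num
  have h4 : (0 : ℝ) ≤ (11 / 10 + (10 / 11) ^ 9) / 2 := by norm_num
  refine pow_le_pow_left₀ (add_nonneg (mul_nonneg (by linarith) h4) hη0) ?_ _
  nlinarith

end Tests

/-! ### The probability that the secret is proposed -/

section Hit

open Classical

variable {P : Par}

/-- The nonzero vectors supported on the coordinates in the blocks with numbers in `B`. -/
noncomputable def Par.supported (P : Par) (B : Finset (Fin P.Q)) : Finset (Fin P.n → ZMod 2) :=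
  Finset.univ.filter fun w => w ≠ 0 ∧ ∀ x : Fin P.n, (∀ b ∈ B, (b : ℕ) ≠ x / P.g) → w x = 0

theorem Par.card_supported (B : Finset (Fin P.Q)) (hB : B.card = P.k) :
    (P.supported B).card ≤ 2 ^ P.K := by
  -- A supported vector is determined by its values on the `k` blocks.
  let f : (Fin P.n → ZMod 2) → (B × Fin P.g → ZMod 2) := fun w bj =>
    if h : (bj.1 : ℕ) * P.g + bj.2 < P.n then w ⟨_, h⟩ else 0
  have hf : Set.InjOn f (P.supported B) := by
    intro w hw w' hw' h
    simp only [Par.supported, Finset.coe_filter, Finset.mem_univ, true_and, Set.mem_ofPred_eq]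
      at hw hw'
    funext x
    by_cases hx : ∀ b ∈ B, (b : ℕ) ≠ x / P.g
    · rw [hw.2 x hx, hw'.2 x hx]
    · push Not at hx
      obtain ⟨b, hb, hbx⟩ := hx
      have h1 := congrFun h (⟨b, hb⟩, ⟨x % P.g, Nat.mod_lt _ P.g_pos⟩)
      have h2 : (b : ℕ) * P.g + x % P.g = x := by rw [hbx]; exact Nat.div_add_mod' _ _
      simp only [f, h2, x.2, dif_pos] at h1
      exact h1
  calc _ ≤ (Finset.univ : Finset (B × Fin P.g → ZMod 2)).card :=
        Finset.card_le_card_of_injOn f (fun _ _ => Finset.mem_univ _) hf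
    _ = 2 ^ P.K := by
        rw [Finset.card_univ, Fintype.card_fun, Fintype.card_prod, Fintype.card_coe, hB,
          Fintype.card_fin, ZMod.card, Par.K]

theorem posOf_injOn {β : Fin P.k → Fin P.Q} (hβ : Function.Injective β) {i j : ℕ} (hi : i < P.K)
    (hj : j < P.K) (h : P.posOf (extend β) i = P.posOf (extend β) j) : i = j := by
  have hg := P.g_pos
  have hi' : i / P.g < P.k := Nat.div_lt_of_lt_mul (by rw [mul_comm]; exact hi)
  have hj' : j / P.g < P.k := Nat.div_lt_of_lt_mul (by rw [mul_comm]; exact hj)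
  unfold Par.posOf at h
  rw [extend, extend, dif_pos hi', dif_pos hj'] at h
  have h1 := congrArg (· / P.g) h
  have h2 := congrArg (· % P.g) h
  simp only [Nat.mul_comm _ P.g, Nat.mul_add_div hg, Nat.div_eq_of_lt (Nat.mod_lt _ hg),
    Nat.mul_add_mod, Nat.mod_mod, add_zero] at h1 h2
  have h3 := hβ (Fin.ext h1)
  simp only [Fin.mk.injEq] at h3
  rw [← Nat.div_add_mod i P.g, ← Nat.div_add_mod j P.g, h3, h2]

/-- The secret is proposed if its support is covered by the chosen blocks, and the chosen samples
are noiseless and separate the vectors supported on these blocks. -/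
theorem prop_eq_secret [NeZero P.m1] {D : Data P.n P.m} {s : Fin P.n → ZMod 2}
    {B : Finset (Fin P.Q)} (hs : ∀ x : Fin P.n, (∀ b ∈ B, (b : ℕ) ≠ x / P.g) → s x = 0)
    {β : Fin P.k → Fin P.Q} (hβ : Function.Injective β) (hβB : ∀ b, b ∈ B ↔ ∃ j, β j = b)
    {R : Fin P.r → Fin P.m1} (hR : ∀ t, dis D s (R t) = 0)
    (hker : ∀ w ∈ P.supported B, ∃ t, (row D (R t)).1 ⬝ᵥ w ≠ 0) : P.prop D (β, R) = s := by
  have hg := P.g_pos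
  have hblock : ∀ i < P.K, ∃ b ∈ B, (b : ℕ) = P.posOf (extend β) i / P.g := by
    intro i hi
    have hi' : i / P.g < P.k := Nat.div_lt_of_lt_mul (by rw [mul_comm]; exact hi)
    refine ⟨β ⟨_, hi'⟩, (hβB _).mpr ⟨_, rfl⟩, ?_⟩
    unfold Par.posOf
    rw [extend, dif_pos hi', Nat.mul_comm _ P.g, Nat.mul_add_div hg,
      Nat.div_eq_of_lt (Nat.mod_lt _ hg), add_zero]
  let S : Set (Fin P.n) := {x | ∃ b ∈ B, (b : ℕ) = x / P.g}
  have hS : ∀ x, x ∉ S ↔ ∀ b ∈ B, (b : ℕ) ≠ x / P.g := fun x => by simp [S]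
  let e : ℕ → ZMod 2 := fun y => if h : y < P.n then s ⟨y, h⟩ else 0
  unfold Par.prop Par.cand
  -- The pair `(s, 1)` is the sum of the unit vectors in the support of `s` and of the unit label.
  refine solve_eq (S := S) (σ := fun i => if i < P.K then e (P.posOf (extend β) i) else 1)
    ?_ ?_ ?_ ?_ ?_
  · rw [Finset.sum_range_succ]
    have h0 : ∑ i ∈ Finset.range P.K, (if i < P.K then e (P.posOf (extend β) i) else 1) •
        P.initF (extend β) i = (s, 0) := by
      refine Prod.ext ?_ ?_
      · rw [Prod.fst_sum]
        funext y
        rw [Finset.sum_apply]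
        have h1 : ∀ i ∈ Finset.range P.K, ((if i < P.K then e (P.posOf (extend β) i) else 1) •
            P.initF (extend β) i).1 y = if P.posOf (extend β) i = y then s y else 0 := by
          intro i hi
          rw [Finset.mem_range] at hi
          rw [if_pos hi, Par.initF]
          simp only [hi, true_and, Prod.smul_mk, Pi.smul_apply, smul_eq_mul]
          by_cases h : P.posOf (extend β) i = y
          · rw [if_pos h, if_pos h, mul_one, h]
            exact dif_pos y.2
          · rw [if_neg h, if_neg h, mul_zero]
        rw [Finset.sum_congr rfl h1]
        by_cases hy : y ∈ S
        · obtain ⟨b, hb, hby⟩ := hy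
          obtain ⟨j, hj⟩ := (hβB b).mp hb
          have hi : (j : ℕ) * P.g + y % P.g < P.K := by
            have h2 := Nat.mod_lt (y : ℕ) hg
            calc _ < ((j : ℕ) + 1) * P.g := by rw [Nat.add_mul]; omega
              _ ≤ P.k * P.g := Nat.mul_le_mul_right _ j.2
          have hpos : P.posOf (extend β) ((j : ℕ) * P.g + y % P.g) = y := by
            unfold Par.posOf
            rw [Nat.mul_comm (j : ℕ), Nat.mul_add_div hg, Nat.div_eq_of_lt (Nat.mod_lt _ hg),
              Nat.mul_add_mod, Nat.mod_mod, add_zero, extend, dif_pos j.2, hj, hby]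
            exact Nat.div_add_mod' _ _
          rw [Finset.sum_eq_single_of_mem _ (Finset.mem_range.mpr hi), if_pos hpos]
          intro i hi' hne
          rw [if_neg]
          intro h
          exact hne (posOf_injOn hβ (Finset.mem_range.mp hi') hi (h.trans hpos.symm))
        · simp [show s y = 0 from hs y ((hS y).mp hy)]
      · rw [Prod.snd_sum]
        refine Finset.sum_eq_zero fun i hi => ?_
        have hi' := Finset.mem_range.mp hi
        rw [if_pos hi']
        simp [Par.initF, hi'.ne]
    rw [h0, if_neg (lt_irrefl _), one_smul]
    refine Prod.ext ?_ ?_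
    · funext y
      simp [Par.initF]
    · simp [Par.initF]
  · intro i _ x hx
    simp only [Par.initF]
    rw [if_neg]
    rintro ⟨hi, h⟩
    obtain ⟨b, hb, h2⟩ := hblock i hi
    exact hx ⟨b, hb, by rw [h2, h]⟩
  · exact fun x hx => hs x ((hS x).mp hx)
  · intro t ht
    have h1 := hR ⟨t, ht⟩
    rw [extend, dif_pos ht]
    rw [dis, ZMod.val_eq_zero] at h1
    simpa [dotp] using h1
  · intro w hw hw0
    obtain ⟨t, ht⟩ := hker w (by
      simp only [Par.supported, Finset.mem_filter, Finset.mem_univ, true_and]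
      exact ⟨hw0, fun x hx => hw x ((hS x).mpr hx)⟩)
    refine ⟨t, t.2, ?_⟩
    rw [extend, dif_pos t.2]
    exact ht

/-- If there are few noisy samples, and no vector supported on suitable blocks is orthogonal to
almost all noiseless samples, then the secret is proposed with a good probability. -/
theorem hit_lower [NeZero P.m1] {D : Data P.n P.m} {s : Fin P.n → ZMod 2} {B : Finset (Fin P.Q)}
    (hB : B.card = P.k) (hs : ∀ x : Fin P.n, (∀ b ∈ B, (b : ℕ) ≠ x / P.g) → s x = 0)
    {θ : ℝ} (hθ : 0 ≤ θ) (hnoisy : (P.noisy D s : ℝ) ≤ (1 - θ) * P.m1)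
    (hclean : ∀ w ∈ P.supported B, P.cleanCount D s w 0 ≤ 9 * P.cleanCount D s w 1) :
    (Nat.factorial P.k / (P.Q : ℝ) ^ P.k) * (θ ^ P.r / 2) ≤ P.hit D s := by
  let Cl : Finset (Fin P.m1) := Finset.univ.filter fun i => dis D s i = 0
  have hm1 : 0 < P.m1 := Nat.pos_of_ne_zero (NeZero.ne _)
  have hdis : ∀ i, dis D s i ≤ 1 := fun i => by
    rw [dis_eq, disVec]
    have := ZMod.val_lt ((row D i).1 ⬝ᵥ s + (row D i).2)
    omega
  have hcl : θ * P.m1 ≤ Cl.card := by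
    have h1 : Cl.card + P.noisy D s = P.m1 := by
      have h2 : P.noisy D s = ∑ i : Fin P.m1, dis D s i := by
        rw [Par.noisy, Finset.sum_range]
      rw [h2, Finset.card_filter, ← Finset.sum_add_distrib]
      have h3 : ∀ i : Fin P.m1, (if dis D s i = 0 then 1 else 0) + dis D s i = 1 := fun i => by
        have := hdis i
        split_ifs <;> omega
      rw [Finset.sum_congr rfl fun i _ => h3 i]
      simp
    have h4 : (Cl.card : ℝ) + P.noisy D s = P.m1 := by exact_mod_cast h1
    linarith
  have hcount : ∀ w b, P.cleanCount D s w b =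
      (Cl.filter fun i : Fin P.m1 => (row D i).1 ⬝ᵥ w = b).card := by
    intro w b
    rw [Par.cleanCount, Finset.filter_filter, Finset.card_filter, Finset.card_filter,
      Finset.sum_range]
  have hz : ∀ w ∈ P.supported B,
      ((Cl.filter fun i : Fin P.m1 => (row D i).1 ⬝ᵥ w = 0).card : ℝ) ≤ 9 / 10 * Cl.card := by
    intro w hw
    have h1 := hclean w hw
    rw [hcount, hcount] at h1
    have h2 := Finset.card_filter_add_card_filter_not (s := Cl)
      (fun i : Fin P.m1 => (row D i).1 ⬝ᵥ w = 0)
    have h3 : (Cl.filter fun i : Fin P.m1 => ¬ (row D i).1 ⬝ᵥ w = 0) =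
        Cl.filter fun i : Fin P.m1 => (row D i).1 ⬝ᵥ w = 1 := by
      refine Finset.filter_congr fun i _ => ⟨zmod_two_eq_one, fun h => ?_⟩
      rw [h]; exact one_ne_zero
    rw [h3] at h2
    have h4 : 10 * (Cl.filter fun i : Fin P.m1 => (row D i).1 ⬝ᵥ w = 0).card ≤ 9 * Cl.card := by
      omega
    have h5 : (10 : ℝ) * (Cl.filter fun i : Fin P.m1 => (row D i).1 ⬝ᵥ w = 0).card ≤
      9 * Cl.card := by exact_mod_cast h4
    linarith
  -- the sequences of noiseless samples that separate the supported vectors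
  let G : Finset (Fin P.r → Fin P.m1) := Fintype.piFinset (fun _ => Cl) \
    (P.supported B).biUnion fun w =>
      Fintype.piFinset fun _ => Cl.filter fun i : Fin P.m1 => (row D i).1 ⬝ᵥ w = 0
  have hG : (θ * P.m1) ^ P.r / 2 ≤ (G.card : ℝ) := by
    have h1 : (((P.supported B).biUnion fun w => Fintype.piFinset fun _ : Fin P.r =>
        Cl.filter fun i : Fin P.m1 => (row D i).1 ⬝ᵥ w = 0).card : ℝ) ≤
        2 ^ P.K * (9 / 10 * Cl.card) ^ P.r := by
      calc _ ≤ ∑ w ∈ P.supported B, ((Fintype.piFinset fun _ : Fin P.r =>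
            Cl.filter fun i : Fin P.m1 => (row D i).1 ⬝ᵥ w = 0).card : ℝ) := by
            exact_mod_cast Finset.card_biUnion_le
        _ ≤ ∑ w ∈ P.supported B, (9 / 10 * Cl.card : ℝ) ^ P.r := by
            refine Finset.sum_le_sum fun w hw => ?_
            rw [Fintype.card_piFinset, Finset.prod_const, Finset.card_univ, Fintype.card_fin]
            push_cast
            exact pow_le_pow_left₀ (Nat.cast_nonneg _) (hz w hw) _
        _ ≤ _ := by
            rw [Finset.sum_const, nsmul_eq_mul]
            gcongr
            exact_mod_cast P.card_supported B hB
    have h2 : (2 : ℝ) ^ P.K * (9 / 10 * Cl.card) ^ P.r ≤ (Cl.card : ℝ) ^ P.r / 2 := by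
      have h3 : (9 / 10 : ℝ) ^ P.r ≤ (1 / 2) ^ (P.K + 1) := by
        rw [Par.r, pow_mul]
        exact pow_le_pow_left₀ (by norm_num) (by norm_num) _
      have h4 : (2 : ℝ) ^ P.K * (1 / 2) ^ (P.K + 1) = 1 / 2 := by
        rw [pow_succ, ← mul_assoc, ← mul_pow]; norm_num
      calc (2 : ℝ) ^ P.K * (9 / 10 * Cl.card) ^ P.r =
            2 ^ P.K * (9 / 10) ^ P.r * (Cl.card : ℝ) ^ P.r := by rw [mul_pow]; ring
        _ ≤ 2 ^ P.K * (1 / 2) ^ (P.K + 1) * (Cl.card : ℝ) ^ P.r := by gcongr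
        _ = _ := by rw [h4]; ring
    have h5 : ((Fintype.piFinset fun _ : Fin P.r => Cl).card : ℝ) ≤ G.card +
        (((P.supported B).biUnion fun w => Fintype.piFinset fun _ : Fin P.r =>
        Cl.filter fun i : Fin P.m1 => (row D i).1 ⬝ᵥ w = 0).card : ℝ) := by
      have := Finset.le_card_sdiff ((P.supported B).biUnion fun w =>
        Fintype.piFinset fun _ : Fin P.r => Cl.filter fun i : Fin P.m1 => (row D i).1 ⬝ᵥ w = 0)
        (Fintype.piFinset fun _ : Fin P.r => Cl)
      exact_mod_cast Nat.sub_le_iff_le_add.mp this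
    rw [Fintype.card_piFinset, Finset.prod_const, Finset.card_univ, Fintype.card_fin] at h5
    push_cast at h5
    have h6 : (θ * P.m1) ^ P.r ≤ (Cl.card : ℝ) ^ P.r := pow_le_pow_left₀ (by positivity) hcl _
    linarith
  -- the enumerations of the blocks
  let E : Finset (Fin P.k → Fin P.Q) :=
    Finset.univ.image fun (e : Fin P.k ≃ B) j => (e j : Fin P.Q)
  have hE : E.card = Nat.factorial P.k := by
    rw [Finset.card_image_of_injective, Finset.card_univ, Fintype.card_equiv, Fintype.card_fin]
    · exact Fintype.equivOfCardEq (by simp [hB])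
    · intro e e' h
      ext j
      exact congrArg Fin.val (congrFun h j)
  have hprop : ∀ ω ∈ E ×ˢ G, P.prop D ω = s := by
    rintro ⟨β, R⟩ hω
    obtain ⟨hβ, hR⟩ := Finset.mem_product.mp hω
    obtain ⟨e, -, rfl⟩ := Finset.mem_image.mp hβ
    simp only [G, Finset.mem_sdiff, Fintype.mem_piFinset, Finset.mem_biUnion, not_exists,
      not_and, not_forall, Finset.mem_filter, Cl, Finset.mem_univ, true_and] at hR
    refine prop_eq_secret hs (fun i j h => e.injective (Subtype.ext h)) (fun b => ⟨fun hb =>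
      ⟨e.symm ⟨b, hb⟩, by simp⟩, ?_⟩) hR.1 (fun w hw => ?_)
    · rintro ⟨j, rfl⟩; exact (e j).2
    · obtain ⟨t, ht⟩ := hR.2 w hw
      exact ⟨t, ht (hR.1 t)⟩
  have hcard : (Fintype.card P.Seed : ℝ) = (P.Q : ℝ) ^ P.k * (P.m1 : ℝ) ^ P.r := by
    simp [Par.Seed]
  have hQ : (0 : ℝ) < P.Q := by
    have : 0 < P.Q := by unfold Par.Q; positivity
    exact_mod_cast this
  have hm1' : (0 : ℝ) < P.m1 := by exact_mod_cast hm1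
  rw [Par.hit, Finset.sum_boole, hcard, le_div_iff₀ (by positivity)]
  calc _ = Nat.factorial P.k * ((θ * P.m1) ^ P.r / 2) := by
        rw [mul_pow]; field_simp
    _ ≤ (E.card : ℝ) * G.card := by rw [hE]; gcongr
    _ = ((E ×ˢ G).card : ℝ) := by rw [Finset.card_product]; push_cast; rfl
    _ ≤ _ := by
        exact_mod_cast Finset.card_le_card fun ω hω =>
          Finset.mem_filter.mpr ⟨Finset.mem_univ _, hprop ω hω⟩

/-- Some `k` blocks cover the support of a vector of Hamming weight at most `k`. -/
theorem exists_blocks {s : Fin P.n → ZMod 2} (hs : hammingNorm s ≤ P.k) :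
    ∃ B : Finset (Fin P.Q), B.card = P.k ∧
      ∀ x : Fin P.n, (∀ b ∈ B, (b : ℕ) ≠ x / P.g) → s x = 0 := by
  have hb : ∀ x : Fin P.n, x / P.g < P.Q := fun x => by
    have := Nat.div_le_div_right (c := P.g) x.2.le
    unfold Par.Q; omega
  let B0 : Finset (Fin P.Q) :=
    (Finset.univ.filter fun x => s x ≠ 0).image fun x : Fin P.n => ⟨x / P.g, hb x⟩
  have h0 : B0.card ≤ P.k := Finset.card_image_le.trans (by simpa [hammingNorm] using hs)
  obtain ⟨B, h1, -, h2⟩ := Finset.exists_subsuperset_card_eq (Finset.subset_univ B0) h0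
    (by rw [Finset.card_univ, Fintype.card_fin]; exact Nat.le_add_left _ _)
  refine ⟨B, h2, fun x hx => ?_⟩
  by_contra h
  exact hx ⟨x / P.g, hb x⟩ (h1 (Finset.mem_image.mpr
    ⟨x, Finset.mem_filter.mpr ⟨Finset.mem_univ _, h⟩, rfl⟩)) rfl

end Hit

/-! ### The probability of failure -/

section Failure

open Classical

variable {P : Par} {η : ℝ} (hη : η ∈ Set.Icc (0 : ℝ) 1) (s : Fin P.n → ZMod 2)

/-- The four summands bound the probability that the tests reject the secret, that too many samples
are noisy, that some supported vector is orthogonal to almost all noiseless samples, and that the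
search takes too long although none of this happens. -/
theorem ex_failure_le [NeZero P.m1] (hη2 : η ≤ 1 / 2) (hm : P.m1 < P.m) (hbase : 0 < P.iters)
    (hk : hammingNorm s ≤ P.k) {t ρ u σ : ℝ} (ht : 0 ≤ t)
    (hρ : (1 - η) * Real.exp (t * (0 - P.p)) + η * Real.exp (t * (P.q - P.p)) ≤ ρ) (hρ1 : ρ < 1)
    (hu : 0 ≤ u) (hσ : (Real.exp (-u * (0 - P.p)) + Real.exp (-u * (P.q - P.p))) / 2 ≤ σ)
    (hσ1 : σ < 1) {h : ℝ} (hh : 0 < h)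
    (hhit : h ≤ (Nat.factorial P.k / (P.Q : ℝ) ^ P.k) * ((1 - 3 / 2 * η) ^ P.r / 2)) :
    ex (weight hη s) P.m (fun D => 1 - P.succ D s P.iters .idle) ≤
      Real.exp (-t * P.C) * (1 / (1 - ρ)) + Real.exp (-(η * P.m1) / 26) +
      2 ^ P.K * (9 / 10) ^ P.m1 +
      ((2 + Real.exp (u * P.C) * (1 / (1 - σ) + P.iters * σ ^ (P.m - P.m1))) / h +
        (P.m - P.m1 : ℕ)) / P.iters := by
  have hη0 := hη.1
  obtain ⟨B, hB, hsB⟩ := exists_blocks hk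
  have hI : (0 : ℝ) < P.iters := by exact_mod_cast hbase
  have hρ0 : 0 ≤ ρ := le_trans (add_nonneg (mul_nonneg (by linarith) (Real.exp_nonneg _))
    (mul_nonneg hη0 (Real.exp_nonneg _))) hρ
  have h01 : ∀ p : Prop, (0 : ℝ) ≤ if p then 1 else 0 := fun p => by split_ifs <;> norm_num
  have h01' : ∀ p : Prop, (0 : ℝ) ≤ if p then 0 else 1 := fun p => by split_ifs <;> norm_num
  have hwc : ∀ D, 0 ≤ P.wrongCost D s := fun D => by
    refine div_nonneg (Finset.sum_nonneg fun ω _ => ?_) (Nat.cast_nonneg _)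
    split_ifs
    · exact le_rfl
    · exact add_nonneg (Finset.sum_nonneg fun _ _ => h01 _) (mul_nonneg hI.le (h01 _))
  have key : ∀ D : Data P.n P.m, 1 - P.succ D s P.iters .idle ≤
      ∑ l ∈ Finset.Ioc 0 (P.m - P.m1), (if P.Alive D s l then 0 else 1) +
      (if 3 / 2 * η * P.m1 < P.noisy D s then 1 else 0) +
      ∑ w ∈ P.supported B, (if 9 * P.cleanCount D s w 1 < P.cleanCount D s w 0 then 1 else 0) +
      1 / (h * P.iters) * P.wrongCost D s + (2 / h + (P.m - P.m1 : ℕ)) / P.iters := by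
    intro D
    have n1 : (0 : ℝ) ≤ ∑ l ∈ Finset.Ioc 0 (P.m - P.m1), (if P.Alive D s l then 0 else 1) :=
      Finset.sum_nonneg fun _ _ => h01' _
    have n2 : (0 : ℝ) ≤ if 3 / 2 * η * P.m1 < P.noisy D s then 1 else 0 := h01 _
    have n3 : (0 : ℝ) ≤ ∑ w ∈ P.supported B,
        (if 9 * P.cleanCount D s w 1 < P.cleanCount D s w 0 then 1 else 0) :=
      Finset.sum_nonneg fun _ _ => by split_ifs <;> norm_num
    have n4 : 0 ≤ 1 / (h * P.iters) * P.wrongCost D s := mul_nonneg (by positivity) (hwc D)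
    have n5 : 0 ≤ (2 / h + (P.m - P.m1 : ℕ)) / P.iters := by positivity
    have n6 : 0 ≤ P.succ D s P.iters .idle := Par.succ_nonneg ..
    by_cases g1 : ∀ l ∈ Finset.Ioc 0 (P.m - P.m1), P.Alive D s l
    swap
    · push Not at g1
      obtain ⟨l, hl, hl'⟩ := g1
      have := Finset.single_le_sum (f := fun l => if P.Alive D s l then (0 : ℝ) else 1)
        (fun _ _ => h01' _) hl
      simp only [if_neg hl'] at this
      linarith
    by_cases g2 : 3 / 2 * η * P.m1 < P.noisy D s
    · simp only [if_pos g2] at *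
      linarith
    by_cases g3 : ∀ w ∈ P.supported B, ¬ 9 * P.cleanCount D s w 1 < P.cleanCount D s w 0
    swap
    · push Not at g3
      obtain ⟨w, hw, hw'⟩ := g3
      have := Finset.single_le_sum (f := fun w =>
        if 9 * P.cleanCount D s w 1 < P.cleanCount D s w 0 then (1 : ℝ) else 0)
        (fun _ _ => by split_ifs <;> norm_num) hw
      simp only [if_pos hw'] at this
      linarith
    have b1 := hhit.trans (hit_lower (θ := 1 - 3 / 2 * η) (D := D) hB hsB (by linarith)
      (by push Not at g2; linarith) (fun w hw => not_lt.mp (g3 w hw)))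
    have b2 := P.succ_bound hm (fun l h1 h2 => g1 l (Finset.mem_Ioc.mpr ⟨h1, h2⟩))
      (hh.trans_le b1)
    have b3 : (2 + P.wrongCost D s) / P.hit D s ≤ (2 + P.wrongCost D s) / h :=
      div_le_div_of_nonneg_left (by linarith [hwc D]) hh b1
    have b4 : 1 - P.succ D s P.iters .idle ≤
        ((2 + P.wrongCost D s) / h + (P.m - P.m1 : ℕ)) / P.iters := by
      rw [le_div_iff₀ hI, mul_comm]
      linarith
    have b5 : ((2 + P.wrongCost D s) / h + (P.m - P.m1 : ℕ)) / P.iters =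
        1 / (h * P.iters) * P.wrongCost D s + (2 / h + (P.m - P.m1 : ℕ)) / P.iters := by
      field_simp
      ring
    linarith
  refine (ex_mono (weight_nonneg hη s) key).trans ?_
  rw [ex_add, ex_add, ex_add, ex_add, ex_sum, ex_sum, ex_const_mul, ex_const (sum_weight hη s)]
  have e1 : ∑ l ∈ Finset.Ioc 0 (P.m - P.m1), ex (weight hη s) P.m
      (fun D => if P.Alive D s l then 0 else 1) ≤ Real.exp (-t * P.C) * (1 / (1 - ρ)) := by
    calc _ ≤ ∑ l ∈ Finset.Ioc 0 (P.m - P.m1), Real.exp (-t * P.C) * ρ ^ l := by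
          refine Finset.sum_le_sum fun l hl => (ex_not_alive_le hη s
            (by have := (Finset.mem_Ioc.mp hl).2; omega) ht).trans ?_
          refine mul_le_mul_of_nonneg_left (pow_le_pow_left₀ ?_ hρ _) (Real.exp_nonneg _)
          exact add_nonneg (mul_nonneg (by linarith) (Real.exp_nonneg _))
            (mul_nonneg hη0 (Real.exp_nonneg _))
      _ ≤ _ := by
          rw [← Finset.mul_sum]
          gcongr
          rw [one_div, ← tsum_geometric_of_lt_one hρ0 hρ1]
          exact (summable_geometric_of_lt_one hρ0 hρ1).sum_le_tsum _ fun _ _ => by positivity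
  have e2 := ex_noisy_le hη s hm.le
  have e3 : ∑ w ∈ P.supported B, ex (weight hη s) P.m (fun D =>
      if 9 * P.cleanCount D s w 1 < P.cleanCount D s w 0 then 1 else 0) ≤
      2 ^ P.K * (9 / 10) ^ P.m1 := by
    calc _ ≤ ∑ w ∈ P.supported B, (9 / 10 : ℝ) ^ P.m1 :=
          Finset.sum_le_sum fun w hw => ex_cleanCount_le hη s hη2 hm.le
            (Finset.mem_filter.mp hw).2.1
      _ ≤ _ := by
          rw [Finset.sum_const, nsmul_eq_mul]
          gcongr
          exact_mod_cast P.card_supported B hB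
  have e4 := ex_wrongCost_le hη s hm.le hu hσ hσ1
  have e5 := mul_le_mul_of_nonneg_left e4 (show 0 ≤ 1 / (h * (P.iters : ℝ)) by positivity)
  have e6 : ((2 + Real.exp (u * P.C) * (1 / (1 - σ) + P.iters * σ ^ (P.m - P.m1))) / h +
      (P.m - P.m1 : ℕ)) / P.iters = 1 / (h * (P.iters : ℝ)) *
      (Real.exp (u * P.C) * (1 / (1 - σ) + P.iters * σ ^ (P.m - P.m1))) +
      (2 / h + (P.m - P.m1 : ℕ)) / P.iters := by
    generalize Real.exp (u * P.C) * (1 / (1 - σ) + P.iters * σ ^ (P.m - P.m1)) = y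
    field_simp
    ring
  linarith

end Failure

/-! ### Estimates -/

/-- A Bernoulli variable with mean `μ < p / q` has an exponential moment below `1` when it is centred
at `p / q`. -/
theorem exists_moment_lt_one {μ p q : ℝ} (hμ0 : 0 ≤ μ) (hμ1 : μ ≤ 1) (hq : 0 < q) (hpq : p ≤ q)
    (h : μ * q < p) :
    ∃ t > 0, (1 - μ) * Real.exp (t * (0 - p)) + μ * Real.exp (t * (q - p)) < 1 := by
  have hp : 0 < p := lt_of_le_of_lt (by positivity) h
  set δ := p - μ * q with hδ
  have hδ0 : 0 < δ := by linarith
  have hδq : δ ≤ q := by have : 0 ≤ μ * q := by positivity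
                         linarith
  -- The value `t` is small enough for the quadratic error of `exp` not to eat up half the gain `t * δ`.
  refine ⟨δ / (2 * q ^ 2), by positivity, ?_⟩
  set t := δ / (2 * q ^ 2) with ht
  have ht0 : 0 < t := by positivity
  have htq : t * q ^ 2 = δ / 2 := by rw [ht]; field_simp
  have htq1 : t * q ≤ 1 := by
    rw [ht, div_mul_eq_mul_div, div_le_one (by positivity)]
    nlinarith
  have hexp : ∀ x : ℝ, |x| ≤ 1 → Real.exp x ≤ 1 + x + x ^ 2 := fun x hx => by
    have := (abs_le.mp (Real.abs_exp_sub_one_sub_id_le hx)).2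
    linarith
  have h1 := hexp (t * (0 - p)) (by rw [abs_le]; constructor <;> nlinarith)
  have h2 := hexp (t * (q - p)) (by rw [abs_le]; constructor <;> nlinarith)
  have h3 : (t * (0 - p)) ^ 2 ≤ t * (δ / 2) := by
    rw [← htq]
    have : p ^ 2 ≤ q ^ 2 := by nlinarith
    nlinarith [mul_le_mul_of_nonneg_left this (sq_nonneg t)]
  have h4 : (t * (q - p)) ^ 2 ≤ t * (δ / 2) := by
    rw [← htq]
    have : (q - p) ^ 2 ≤ q ^ 2 := by nlinarith
    nlinarith [mul_le_mul_of_nonneg_left this (sq_nonneg t)]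
  calc _ ≤ (1 - μ) * (1 + t * (0 - p) + t * (δ / 2)) + μ * (1 + t * (q - p) + t * (δ / 2)) := by
        gcongr
        · linarith
        · linarith
    _ = 1 - t * (δ / 2) := by rw [hδ]; ring
    _ < 1 := by have : 0 < t * (δ / 2) := by positivity
                linarith

section Estimates

variable {P : Par} {η : ℝ}

theorem Par.K_add_one_le (hk : 1 ≤ P.k) (hks : P.k ≤ P.s) : P.K + 1 ≤ 3 * P.s := by
  have := Nat.mul_div_le P.s P.k
  unfold Par.K Par.g
  rw [Nat.mul_add]
  omega

theorem Par.r_le (hk : 1 ≤ P.k) (hks : P.k ≤ P.s) : P.r ≤ 21 * P.s := by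
  have := Par.K_add_one_le hk hks
  unfold Par.r
  omega

theorem Par.totalTime_le (hk : 1 ≤ P.k) (hks : P.k ≤ P.s) (hb : 0 < P.base) :
    P.totalTime ≤ 32100 * P.s ^ 4 * P.base ^ P.k := by
  have hK := Par.K_add_one_le hk hks
  have hr := Par.r_le hk hks
  have hs : 1 ≤ P.s := hk.trans hks
  have h1 : P.iterTime + 1 ≤ 32000 * P.s ^ 3 := by
    unfold Par.iterTime Par.genTime
    generalize P.K = K at *
    generalize P.r = r at *
    generalize P.k = k at *
    generalize P.s = s at *
    have hK' : K ≤ 3 * s := by omega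
    calc _ ≤ s * 21 + (21 * s) * 21 + (3 * s) * (3 * s) * 22 +
          (21 * s) * ((3 * s) * ((3 * s) * 80 + 200) + 120) + (3 * s) * 20 + 50 +
          (3 * s) * 90 + s * 20 + 150 + 1 := by gcongr
      _ = 15120 * s ^ 3 + 12798 * s ^ 2 + 3332 * s + 201 := by ring
      _ ≤ 15120 * s ^ 3 + 12798 * s ^ 3 + 3332 * s ^ 3 + 201 * s ^ 3 := by
          have e1 : s ^ 2 ≤ s ^ 3 := Nat.pow_le_pow_right hs (by omega)
          have e2 : s ≤ s ^ 3 := Nat.le_self_pow (by omega) s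
          have e3 : 1 ≤ s ^ 3 := Nat.one_le_pow _ _ hs
          omega
      _ ≤ _ := by omega
  have h2 : 1 ≤ P.s ^ 4 * P.base ^ P.k :=
    Nat.mul_pos (Nat.pow_pos hs) (Nat.pow_pos hb)
  calc P.totalTime = P.s * P.base ^ P.k * (P.iterTime + 1) + 100 := rfl
    _ ≤ P.s * P.base ^ P.k * (32000 * P.s ^ 3) + 100 * (P.s ^ 4 * P.base ^ P.k) := by
        gcongr
        omega
    _ = _ := by ring

theorem Par.Q_le (hk : 1 ≤ P.k) (hks : P.k ≤ P.s) (hsn : P.s ≤ P.n) :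
    P.Q ≤ 4 * (P.k * (P.n / P.s)) := by
  have hN : 1 ≤ P.n / P.s := Nat.div_pos hsn (by omega)
  have hs : 0 < P.s := by omega
  have h1 : P.n / P.g ≤ 2 * (P.k * (P.n / P.s)) := by
    refine Nat.div_le_of_le_mul ?_
    have h2 : P.n < P.s * (P.n / P.s + 1) := Nat.lt_mul_div_succ _ hs
    have h3 : P.s < P.k * P.g := by
      exact Nat.lt_mul_div_succ _ hk
    calc P.n ≤ P.s * (P.n / P.s + 1) := h2.le
      _ ≤ (P.k * P.g) * (2 * (P.n / P.s)) := Nat.mul_le_mul h3.le (by omega)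
      _ = _ := by ring
  have h4 : P.k ≤ P.k * (P.n / P.s) := Nat.le_mul_of_pos_right _ hN
  unfold Par.Q
  omega

theorem exp_neg_le {x : ℝ} (h1 : x ≤ 3 / 4) (h0 : 0 ≤ x) : Real.exp (-(4 * x)) ≤ 1 - x := by
  have h2 : 0 < 1 - x := by linarith
  rw [← Real.le_log_iff_exp_le h2]
  refine le_trans ?_ (Real.one_sub_inv_le_log_of_pos h2)
  rw [← sub_nonneg]
  have : 1 - (1 - x)⁻¹ - -(4 * x) = x * (3 - 4 * x) / (1 - x) := by field_simp; ring
  rw [this]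
  exact div_nonneg (mul_nonneg h0 (by linarith)) h2.le

/-- A lower bound for the probability that the secret is proposed. -/
theorem hit_bound (hk : 1 ≤ P.k) (hks : P.k ≤ P.s) (hsn : P.s ≤ P.n) (hη0 : 0 ≤ η)
    (hη2 : η ≤ 1 / 2) (hηs : η * P.s ≤ 3 / 2 * P.k) :
    Real.exp (-(192 * P.k)) / (2 * ((P.n / P.s : ℕ) : ℝ) ^ P.k) ≤
      (Nat.factorial P.k / (P.Q : ℝ) ^ P.k) * ((1 - 3 / 2 * η) ^ P.r / 2) := by
  have hN : (0 : ℝ) < (P.n / P.s : ℕ) := by exact_mod_cast Nat.div_pos hsn (by omega)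
  have hk0 : (0 : ℝ) < P.k := by exact_mod_cast hk
  set N : ℝ := ((P.n / P.s : ℕ) : ℝ) with hNdef
  have hQ : (P.Q : ℝ) ≤ 4 * (P.k * N) := by rw [hNdef]; exact_mod_cast Par.Q_le hk hks hsn
  have hQ0 : (0 : ℝ) < P.Q := by
    have : 0 < P.Q := by unfold Par.Q; positivity
    exact_mod_cast this
  have h1 : Real.exp (-(189 * P.k)) ≤ (1 - 3 / 2 * η) ^ P.r := by
    calc _ ≤ Real.exp (-(4 * (3 / 2 * η))) ^ P.r := by
          rw [← Real.exp_nat_mul]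
          apply Real.exp_le_exp.mpr
          have : (P.r : ℝ) ≤ 21 * P.s := by exact_mod_cast Par.r_le hk hks
          nlinarith
      _ ≤ _ := pow_le_pow_left₀ (Real.exp_nonneg _) (exp_neg_le (by linarith) (by linarith)) _
  have h2 : Real.exp (-(3 * P.k)) / N ^ P.k ≤ Nat.factorial P.k / (P.Q : ℝ) ^ P.k := by
    rw [div_le_div_iff₀ (by positivity) (by positivity)]
    have h3 := Real.pow_div_factorial_le_exp (P.k : ℝ) hk0.le P.k
    rw [div_le_iff₀ (by positivity)] at h3
    have h4 : (4 : ℝ) ^ P.k ≤ Real.exp (2 * P.k) := by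
      rw [mul_comm, Real.exp_nat_mul]
      refine pow_le_pow_left₀ (by norm_num) ?_ _
      have := Real.exp_one_gt_d9
      rw [show (2 : ℝ) = 1 + 1 by norm_num, Real.exp_add]
      nlinarith
    have h5 : Real.exp (-(3 * P.k)) * (Real.exp (2 * P.k) * Real.exp P.k) = 1 := by
      rw [← Real.exp_add, ← Real.exp_add, ← Real.exp_zero]; congr 1; ring
    calc _ ≤ Real.exp (-(3 * P.k)) * (4 * (P.k * N)) ^ P.k := by gcongr
      _ = Real.exp (-(3 * P.k)) * (4 ^ P.k * (P.k : ℝ) ^ P.k) * N ^ P.k := by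
          rw [mul_pow, mul_pow]; ring
      _ ≤ Real.exp (-(3 * P.k)) * (Real.exp (2 * P.k) * (Real.exp P.k * Nat.factorial P.k)) *
          N ^ P.k := by gcongr
      _ = Real.exp (-(3 * P.k)) * (Real.exp (2 * P.k) * Real.exp P.k) * Nat.factorial P.k *
          N ^ P.k := by ring
      _ = _ := by rw [h5, one_mul]
  calc _ = (Real.exp (-(3 * P.k)) / N ^ P.k) * (Real.exp (-(189 * P.k)) / 2) := by
        rw [show -(192 * (P.k : ℝ)) = -(3 * P.k) + -(189 * P.k) by ring, Real.exp_add]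
        field_simp
    _ ≤ _ := by gcongr

theorem exp_noisy_le (h : 1 ≤ η * P.s) : Real.exp (-(η * P.m1) / 26) ≤ 1 / 100 := by
  have h1 : -(η * P.m1) / 26 ≤ -5 := by
    unfold Par.m1; push_cast; linarith
  refine (Real.exp_le_exp.mpr h1).trans ?_
  rw [Real.exp_neg, inv_eq_one_div]
  refine one_div_le_one_div_of_le (by norm_num) ?_
  rw [show (5 : ℝ) = (5 : ℕ) * 1 by norm_num, Real.exp_nat_mul]
  calc (100 : ℝ) ≤ 2.7 ^ 5 := by norm_num
    _ ≤ _ := by gcongr; linarith [Real.exp_one_gt_d9]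

theorem supported_bound (hk : 1 ≤ P.k) (hks : P.k ≤ P.s) :
    (2 : ℝ) ^ P.K * (9 / 10) ^ P.m1 ≤ 1 / 100 := by
  have hK := Par.K_add_one_le hk hks
  calc (2 : ℝ) ^ P.K * (9 / 10) ^ P.m1 ≤ 2 ^ (3 * P.s) * (9 / 10) ^ (200 * P.s) := by
        unfold Par.m1
        gcongr
        · norm_num
        · omega
    _ = (2 ^ 3 * (9 / 10) ^ 200) ^ P.s := by rw [pow_mul, pow_mul, ← mul_pow]
    _ ≤ (1 / 100) ^ P.s := by gcongr; norm_num
    _ ≤ (1 / 100) ^ 1 := pow_le_pow_of_le_one (by norm_num) (by norm_num) (hk.trans hks)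
    _ = _ := pow_one _

end Estimates

/-! ### The constants -/

section Parameters

/-- The parameters belong to an instance of the `(n, k, η)` problem. -/
structure Par.Valid (P : Par) (η : ℝ) : Prop where
  k_pos : 1 ≤ P.k
  η_pos : 0 < η
  η_le : η ≤ 1 / 2
  s_eq : P.s = ⌈(P.k : ℝ) / η⌉₊
  n_gt : (P.k : ℝ) / η < P.n

/-- The number of samples, up to a constant factor. -/
noncomputable def Par.L (P : Par) (η : ℝ) : ℝ := (P.k : ℝ) / η + P.k * Real.log (P.n / P.k)

variable {P : Par} {η : ℝ}

namespace Par.Valid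

variable (V : P.Valid η)
include V

theorem k_pos' : (1 : ℝ) ≤ P.k := by exact_mod_cast V.k_pos

theorem two_k_le : 2 * (P.k : ℝ) ≤ P.k / η := by
  rw [le_div_iff₀ V.η_pos]
  nlinarith [V.η_le, V.k_pos']

theorem le_s : (P.k : ℝ) / η ≤ P.s := by rw [V.s_eq]; exact Nat.le_ceil _

theorem s_le : (P.s : ℝ) ≤ 3 / 2 * (P.k / η) := by
  have h1 := Nat.ceil_lt_add_one (a := (P.k : ℝ) / η) (by have := V.η_pos; positivity)
  rw [← V.s_eq] at h1
  linarith [V.two_k_le, V.k_pos']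

theorem s_le_n : P.s ≤ P.n := by
  rw [V.s_eq]
  exact Nat.ceil_le.mpr V.n_gt.le

theorem k_le_s : P.k ≤ P.s := by
  have h1 : (P.k : ℝ) ≤ P.s := by linarith [V.two_k_le, V.k_pos', V.le_s]
  exact_mod_cast h1

theorem s_pos : 0 < P.s := V.k_pos.trans V.k_le_s

theorem one_le_div : 1 ≤ P.n / P.s := Nat.div_pos V.s_le_n V.s_pos

theorem η_mul_s_le : η * P.s ≤ 3 / 2 * P.k := by
  have h := mul_le_mul_of_nonneg_left V.s_le V.η_pos.le
  have : η * (3 / 2 * (P.k / η)) = 3 / 2 * P.k := by have := V.η_pos; field_simp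
  linarith

theorem one_le_η_mul_s : 1 ≤ η * P.s := by
  have h := mul_le_mul_of_nonneg_left V.le_s V.η_pos.le
  have : η * (P.k / η) = P.k := by have := V.η_pos; field_simp
  linarith [V.k_pos']

theorem one_le_n_div_k : 1 ≤ (P.n : ℝ) / P.k := by
  rw [_root_.one_le_div (by linarith [V.k_pos'])]
  exact_mod_cast V.k_le_s.trans V.s_le_n

theorem log_nonneg : 0 ≤ P.k * Real.log (P.n / P.k) :=
  mul_nonneg (Nat.cast_nonneg _) (Real.log_nonneg V.one_le_n_div_k)

theorem le_L : (P.k : ℝ) / η ≤ P.L η := by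
  unfold Par.L
  linarith [V.log_nonneg]

/-- The number of samples is at most linear in the number of coordinates. -/
theorem L_le : P.L η ≤ 4 * (P.s * (P.n / P.s : ℕ)) := by
  have hk := V.k_pos'
  have hs : (0 : ℝ) < P.s := by exact_mod_cast V.s_pos
  have hks : (P.k : ℝ) ≤ P.s := by exact_mod_cast V.k_le_s
  have hN : (1 : ℝ) ≤ (P.n / P.s : ℕ) := by exact_mod_cast V.one_le_div
  have hn0 : (0 : ℝ) < P.n := lt_of_lt_of_le hs (by exact_mod_cast V.s_le_n)
  have h1 : (P.n : ℝ) / P.s ≤ (P.n / P.s : ℕ) + 1 := by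
    rw [div_le_iff₀ hs]
    have := (Nat.lt_mul_div_succ P.n V.s_pos).le
    rw [mul_comm]
    exact_mod_cast this
  have h2 : Real.log (P.n / P.k) = Real.log (P.n / P.s) + Real.log (P.s / P.k) := by
    rw [← Real.log_mul (by positivity) (by positivity)]
    congr 1
    field_simp
  have h3 := Real.log_le_sub_one_of_pos (show 0 < (P.n : ℝ) / P.s by positivity)
  have h4 := Real.log_le_sub_one_of_pos (show 0 < (P.s : ℝ) / P.k by positivity)
  have h5 : P.k * Real.log (P.n / P.k) ≤ P.k * (P.n / P.s : ℕ) + P.s := by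
    have h6 : P.k * ((P.s : ℝ) / P.k) = P.s := by field_simp
    rw [h2]
    nlinarith
  unfold Par.L
  have h7 := V.le_s
  have h8 : (P.k : ℝ) * (P.n / P.s : ℕ) ≤ P.s * (P.n / P.s : ℕ) := by gcongr
  nlinarith

theorem div_pow_le :
    (((P.n / P.s : ℕ) : ℝ)) ^ P.k ≤ Real.exp (P.k * Real.log (P.n / P.k)) := by
  have hk := V.k_pos'
  have hks : (P.k : ℝ) ≤ P.s := by exact_mod_cast V.k_le_s
  rw [Real.exp_nat_mul, Real.exp_log (by linarith [V.one_le_n_div_k])]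
  refine pow_le_pow_left₀ (Nat.cast_nonneg _) (Nat.cast_div_le.trans ?_) _
  gcongr

variable {B : ℝ} (hm : P.m = ⌈B * P.L η⌉₊)
include hm

theorem m_le (hB : 0 ≤ B) : (P.m : ℝ) ≤ 4 * (B + 1) * (P.s * (P.n / P.s : ℕ)) := by
  have h1 : 1 ≤ P.L η := by linarith [V.le_L, V.two_k_le, V.k_pos']
  have h2 := Nat.ceil_lt_add_one (a := B * P.L η) (by positivity)
  rw [← hm] at h2
  nlinarith [V.L_le]

theorem tests_ge : (B - 300) * P.L η ≤ (P.m : ℝ) - P.m1 := by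
  have h1 := Nat.le_ceil (B * P.L η)
  rw [← hm] at h1
  have h2 : (P.m1 : ℝ) = 200 * P.s := by unfold Par.m1; push_cast; rfl
  rw [h2]
  linarith [V.s_le, V.le_L]

theorem m1_lt (hB : 300 < B) : P.m1 < P.m := by
  have h1 := V.tests_ge hm
  have h2 : 0 < (B - 300) * P.L η :=
    mul_pos (by linarith) (by linarith [V.le_L, V.two_k_le, V.k_pos'])
  have h3 : (P.m1 : ℝ) < P.m := by linarith
  exact_mod_cast h3

end Par.Valid

/-- The bound for the probability to accept a wrong vector is small even after division by the lower
bound for the probability to propose the secret. This is what the number of samples is needed for. -/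
theorem wrong_accept_le (V : P.Valid η) {u σ B : ℝ} (hu : 0 ≤ u) (hσ0 : 0 < σ) (hσ1 : σ < 1)
    (hm : P.m = ⌈B * P.L η⌉₊) (hm1 : P.m1 < P.m)
    (hB : 300 + (u * P.C + 406) / (-Real.log σ) ≤ B) :
    Real.exp (u * P.C) * σ ^ (P.m - P.m1) *
      (2 * ((P.n / P.s : ℕ) : ℝ) ^ P.k * Real.exp (192 * P.k)) ≤ 1 / 100 := by
  have hlog : 0 < -Real.log σ := neg_pos.mpr (Real.log_neg hσ0 hσ1)
  set M := P.m - P.m1 with hM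
  have hMr : (M : ℝ) = P.m - P.m1 := by rw [hM]; exact Nat.cast_sub hm1.le
  have hk1 := V.k_pos'
  have hL1 : P.k * Real.log (P.n / P.k) + 2 * P.k ≤ P.L η := by
    unfold Par.L; linarith [V.two_k_le]
  have hl := V.log_nonneg
  have hL2 : 2 ≤ P.L η := by linarith
  have h1 : σ ^ M ≤ Real.exp (-((u * P.C + 406) * P.L η)) := by
    rw [← Real.exp_log (pow_pos hσ0 M), Real.log_pow]
    apply Real.exp_le_exp.mpr
    have h2 : u * P.C + 406 ≤ (B - 300) * (-Real.log σ) := by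
      rw [← div_le_iff₀ hlog]; linarith
    have h3 := V.tests_ge hm
    rw [← hMr] at h3
    have h4 := mul_le_mul_of_nonneg_right h3 hlog.le
    have h5 := mul_le_mul_of_nonneg_right h2 (by linarith : 0 ≤ P.L η)
    linarith
  have huC : 0 ≤ u * P.C := mul_nonneg hu (Nat.cast_nonneg _)
  calc _ ≤ Real.exp (u * P.C) * Real.exp (-((u * P.C + 406) * P.L η)) *
        (2 * Real.exp (P.k * Real.log (P.n / P.k)) * Real.exp (192 * P.k)) := by
        have := V.div_pow_le
        gcongr
    _ = 2 * Real.exp (u * P.C + -((u * P.C + 406) * P.L η) + P.k * Real.log (P.n / P.k) +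
        192 * P.k) := by
        rw [Real.exp_add, Real.exp_add, Real.exp_add]; ring
    _ ≤ 2 * Real.exp (-200) := by
        have h6 := mul_le_mul_of_nonneg_left (by linarith : 1 ≤ P.L η) huC
        gcongr
        linarith
    _ ≤ _ := by
        have := Real.add_one_le_exp 200
        rw [Real.exp_neg, ← div_eq_mul_inv, div_le_div_iff₀ (Real.exp_pos _) (by norm_num)]
        linarith

/-- The tests of the secret are a small part of all iterations. -/
theorem tests_div_iters_le (V : P.Valid η) {B : ℝ} (hB0 : 0 ≤ B) (hm : P.m = ⌈B * P.L η⌉₊)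
    (ha2 : 400 * (B + 1) ≤ P.a) : ((P.m - P.m1 : ℕ) : ℝ) / P.iters ≤ 1 / 100 := by
  set N : ℝ := ((P.n / P.s : ℕ) : ℝ) with hNdef
  have hN1 : (1 : ℝ) ≤ N := by rw [hNdef]; exact_mod_cast V.one_le_div
  have hs0 : (1 : ℝ) ≤ P.s := by exact_mod_cast V.s_pos
  have ha0 : (1 : ℝ) ≤ P.a := by linarith
  have haN : 1 ≤ P.a * N := one_le_mul_of_one_le_of_one_le ha0 hN1
  have hI : (P.iters : ℝ) = P.s * (P.a * N) ^ P.k := by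
    unfold Par.iters Par.base; push_cast; rfl
  have hI0 : (0 : ℝ) < P.iters := by rw [hI]; positivity
  set M := P.m - P.m1 with hM
  have h1 := V.m_le hm hB0
  have h2 : (M : ℝ) ≤ P.m := by exact_mod_cast Nat.sub_le _ _
  have h3 : P.a * N ≤ (P.a * N) ^ P.k :=
    le_self_pow₀ haN (by have := V.k_pos; omega)
  rw [div_le_div_iff₀ hI0 (by norm_num), hI]
  calc (M : ℝ) * 100 ≤ 4 * (B + 1) * (P.s * N) * 100 := by gcongr; exact h2.trans h1
    _ = 400 * (B + 1) * (P.s * N) := by ring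
    _ ≤ P.a * (P.s * N) := by gcongr
    _ = P.s * (P.a * N) := by ring
    _ ≤ 1 * (P.s * (P.a * N) ^ P.k) := by rw [one_mul]; gcongr

/-- With suitable constants, the search fails with probability at most `1 / 10`. -/
theorem ex_failure_le_tenth [NeZero P.m1] (hη : η ∈ Set.Icc (0 : ℝ) 1) (V : P.Valid η)
    (s : Fin P.n → ZMod 2) (hk : hammingNorm s ≤ P.k) {t ρ u σ B : ℝ} (ht : 0 ≤ t)
    (hρ : (1 - η) * Real.exp (t * (0 - P.p)) + η * Real.exp (t * (P.q - P.p)) ≤ ρ) (hρ1 : ρ < 1)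
    (hu : 0 ≤ u) (hσ : (Real.exp (-u * (0 - P.p)) + Real.exp (-u * (P.q - P.p))) / 2 ≤ σ)
    (hσ1 : σ < 1) (hm : P.m = ⌈B * P.L η⌉₊)
    (hC : Real.exp (-t * P.C) * (1 / (1 - ρ)) ≤ 1 / 100)
    (hB : 300 + (u * P.C + 406) / (-Real.log σ) ≤ B)
    (ha1 : 100 * ((2 + Real.exp (u * P.C) / (1 - σ)) * (2 * Real.exp 192)) ≤ P.a)
    (ha2 : 400 * (B + 1) ≤ P.a) :
    ex (weight hη s) P.m (fun D => 1 - P.succ D s P.iters .idle) ≤ 1 / 10 := by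
  have hσ0 : 0 < σ := lt_of_lt_of_le (by positivity) hσ
  have hlog : 0 < -Real.log σ := neg_pos.mpr (Real.log_neg hσ0 hσ1)
  have hB' : 300 < B := by
    have : 0 < (u * P.C + 406) / (-Real.log σ) := by positivity
    linarith
  have hmm := V.m1_lt hm hB'
  have hN := V.one_le_div
  have hk1 := V.k_pos'
  set N : ℝ := ((P.n / P.s : ℕ) : ℝ) with hNdef
  have hN1 : (1 : ℝ) ≤ N := by rw [hNdef]; exact_mod_cast hN
  have hs0 : (1 : ℝ) ≤ P.s := by exact_mod_cast V.s_pos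
  have ha0 : (0 : ℝ) < P.a := by linarith
  have hI : (P.iters : ℝ) = P.s * (P.a * N) ^ P.k := by
    unfold Par.iters Par.base; push_cast; rfl
  have hI0 : (0 : ℝ) < P.iters := by rw [hI]; positivity
  have h0 : (0 : ℝ) < Real.exp (-(192 * P.k)) / (2 * N ^ P.k) := by positivity
  have hinv : 1 / (Real.exp (-(192 * P.k)) / (2 * N ^ P.k)) =
      2 * N ^ P.k * Real.exp (192 * P.k) := by
    rw [Real.exp_neg]; field_simp
  refine (ex_failure_le hη s V.η_le hmm (by exact_mod_cast hI0) hk ht hρ hρ1 hu hσ hσ1 h0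
    (hit_bound V.k_pos V.k_le_s V.s_le_n V.η_pos.le V.η_le V.η_mul_s_le)).trans ?_
  set h := Real.exp (-(192 * P.k)) / (2 * N ^ P.k) with hdef
  set e := Real.exp (u * P.C) with he
  set M := P.m - P.m1 with hM
  have e1 := exp_noisy_le V.one_le_η_mul_s
  have e2 := supported_bound V.k_pos V.k_le_s
  have hσ' : 0 < 1 - σ := by linarith
  have e3 : ((2 + e * (1 / (1 - σ) + P.iters * σ ^ M)) / h + M) / P.iters =
      (2 + e / (1 - σ)) * (1 / h / P.iters) + e * σ ^ M * (1 / h) + M / P.iters := by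
    field_simp
    ring
  have hpow : ∀ x : ℝ, 0 ≤ x → x ≤ 1 → x ^ P.k ≤ x := fun x h0 h1 =>
    pow_le_of_le_one h0 h1 (by have := V.k_pos; omega)
  have hW : 0 ≤ e / (1 - σ) := by positivity
  have e4 : (2 + e / (1 - σ)) * (1 / h / P.iters) ≤ 1 / 100 := by
    have h1 : 1 / h / P.iters ≤ 2 * (Real.exp 192 / P.a) := by
      calc 1 / h / P.iters = 2 * (Real.exp 192 / P.a) ^ P.k / P.s := by
            rw [hinv, hI, mul_comm (192 : ℝ), Real.exp_nat_mul, div_pow, mul_pow]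
            field_simp
        _ ≤ 2 * (Real.exp 192 / P.a) ^ P.k := div_le_self (by positivity) hs0
        _ ≤ _ := by
            gcongr
            refine hpow _ (by positivity) ?_
            rw [div_le_one ha0]
            nlinarith [Real.exp_pos 192]
    calc _ ≤ (2 + e / (1 - σ)) * (2 * (Real.exp 192 / P.a)) := by gcongr
      _ = (2 + e / (1 - σ)) * (2 * Real.exp 192) / P.a := by ring
      _ ≤ _ := by rw [div_le_iff₀ ha0]; linarith
  have e5 : e * σ ^ M * (1 / h) ≤ 1 / 100 := by
    rw [hinv]
    exact wrong_accept_le V hu hσ0 hσ1 hm hmm hB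
  have e6 : M / P.iters ≤ (1 : ℝ) / 100 := tests_div_iters_le V (by linarith) hm ha2
  rw [e3]
  linarith

end Parameters

/-! ### Word size, running time and correctness -/

section Final

open Classical

theorem mix_le_mix {x y a b : ℝ} (h : x ≤ y) (hab : a ≤ b) :
    (1 - x) * a + x * b ≤ (1 - y) * a + y * b := by
  nlinarith

theorem Par.Valid.X_le {P : Par} {η : ℝ} (V : P.Valid η) {B : ℕ} (hm : P.m = ⌈B * P.L η⌉₊) :
    P.X ≤ (4 * (B + 1) + P.a + P.p + P.q + P.C + 300) * P.n := by
  have hsN : P.s * (P.n / P.s) ≤ P.n := Nat.mul_div_le _ _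
  have hm' : P.m ≤ 4 * (B + 1) * P.n := by
    have h1 := V.m_le hm (Nat.cast_nonneg B)
    have h2 : P.m ≤ 4 * (B + 1) * (P.s * (P.n / P.s)) := by exact_mod_cast h1
    exact h2.trans (Nat.mul_le_mul_left _ hsN)
  have hs := V.s_le_n
  have hks := V.k_le_s
  have hk := V.k_pos
  have hQ : P.Q ≤ 4 * P.n := (Par.Q_le hk hks hs).trans
    (Nat.mul_le_mul_left _ ((Nat.mul_le_mul_right _ hks).trans hsN))
  have hK := Par.K_add_one_le hk hks
  have hr := Par.r_le hk hks
  have hg : P.g ≤ 2 * P.n := by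
    have := Nat.div_le_self P.s P.k
    unfold Par.g; omega
  have hb : P.base ≤ P.a * P.n := Nat.mul_le_mul_left _ (Nat.div_le_self _ _)
  have hc : P.p + P.q + P.C ≤ (P.p + P.q + P.C) * P.n := Nat.le_mul_of_pos_right _ (by omega)
  have h200 : P.m1 ≤ 200 * P.n := Nat.mul_le_mul_left _ hs
  have e : (4 * (B + 1) + P.a + P.p + P.q + P.C + 300) * P.n =
      4 * (B + 1) * P.n + P.a * P.n + (P.p + P.q + P.C) * P.n + 300 * P.n := by ring
  rw [e]
  unfold Par.X
  omega

theorem fits_of_X_le {P : Par} {H : ℕ} (h : P.X ≤ H * P.n) (hn : 1 ≤ P.n) :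
    P.Fits ((2 + Nat.size (64 * (H * H))) * Nat.size P.n) := by
  have h1 := Nat.lt_size_self P.n
  have h2 := Nat.lt_size_self (64 * (H * H))
  have h3 : 1 ≤ Nat.size P.n := Nat.size_pos.mpr hn
  unfold Par.Fits
  calc 64 * (P.X * P.X) ≤ 64 * ((H * P.n) * (H * P.n)) := by gcongr
    _ = 64 * (H * H) * (P.n * P.n) := by ring
    _ < 2 ^ Nat.size (64 * (H * H)) * (P.n * P.n) := Nat.mul_lt_mul_of_pos_right h2 (by positivity)
    _ ≤ 2 ^ (Nat.size (64 * (H * H)) * Nat.size P.n) * (2 ^ Nat.size P.n * 2 ^ Nat.size P.n) := by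
        gcongr
        · norm_num
        · exact Nat.le_mul_of_pos_right _ h3
    _ = _ := by rw [← pow_add, ← pow_add]; congr 1; ring

/-- The running time of the program. -/
theorem Par.Valid.time_le {P : Par} {η : ℝ} (V : P.Valid η) (ha : 0 < P.a) :
    (P.totalTime : ℝ) ≤ ((P.k : ℝ) / η) ^ 23 * (P.a * (η * P.n / P.k)) ^ P.k := by
  have hη := V.η_pos
  have hk := V.k_pos'
  have hb : 0 < P.base := Nat.mul_pos ha V.one_le_div
  have h1 : (P.totalTime : ℝ) ≤ 32100 * (P.s : ℝ) ^ 4 * (P.base : ℝ) ^ P.k := by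
    exact_mod_cast Par.totalTime_le V.k_pos V.k_le_s hb
  have hκ : 2 ≤ (P.k : ℝ) / η := by linarith [V.two_k_le]
  have h2 : (P.base : ℝ) ≤ P.a * (η * P.n / P.k) := by
    have hs : (0 : ℝ) < P.s := by exact_mod_cast V.s_pos
    unfold Par.base
    push_cast
    gcongr
    refine Nat.cast_div_le.trans ?_
    rw [div_le_div_iff₀ hs (by linarith)]
    have := mul_le_mul_of_nonneg_left V.le_s hη.le
    have e : η * (P.k / η) = P.k := by field_simp
    rw [e] at this
    have := mul_le_mul_of_nonneg_left this (Nat.cast_nonneg (α := ℝ) P.n)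
    linarith
  -- Constant factors are absorbed by powers of `k / η ≥ 2`.
  calc (P.totalTime : ℝ) ≤ 32100 * (P.s : ℝ) ^ 4 * (P.base : ℝ) ^ P.k := h1
    _ ≤ 32100 * (3 / 2 * ((P.k : ℝ) / η)) ^ 4 * (P.a * (η * P.n / P.k)) ^ P.k := by
        gcongr
        exact V.s_le
    _ = (32100 * (3 / 2) ^ 4) * ((P.k : ℝ) / η) ^ 4 * (P.a * (η * P.n / P.k)) ^ P.k := by ring
    _ ≤ ((P.k : ℝ) / η) ^ 19 * ((P.k : ℝ) / η) ^ 4 * (P.a * (η * P.n / P.k)) ^ P.k := by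
        gcongr
        calc (32100 * (3 / 2) ^ 4 : ℝ) ≤ 2 ^ 19 := by norm_num
          _ ≤ _ := by gcongr
    _ = _ := by rw [← pow_add]

/-- The program solves the problem if the search is likely to succeed. -/
theorem solves_of_ex_le {P : Par} [NeZero P.m1] {η : ℝ} (V : P.Valid η)
    (hη : η ∈ Set.Icc (0 : ℝ) 1) {w : ℕ} (hw : P.Fits w) (ha : 0 < P.a) (hm : P.m1 < P.m)
    (h : ∀ s : Fin P.n → ZMod 2, hammingNorm s ≤ P.k →
      ex (weight hη s) P.m (fun D => 1 - P.succ D s P.iters .idle) ≤ 1 / 10) :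
    Solves (learnProg P.p P.q P.C P.a) w P.n P.k η hη P.m P.totalTime (9 / 10) := by
  have hb : 0 < P.base := Nat.mul_pos ha V.one_le_div
  have spec := fun D v => learnProg_spec hw hb V.s_pos hm D v
  rw [V.s_eq] at spec
  refine ⟨fun D c hc => ?_, fun secret hk => ?_⟩
  · obtain ⟨μ, hμ, -⟩ := spec D 0
    rw [hμ _ le_rfl, PMF.support_map] at hc
    obtain ⟨s, -, rfl⟩ := hc
    rfl
  · have h1 : ∀ D : Data P.n P.m, ENNReal.ofReal (P.succ D secret P.iters .idle) ≤
        (run w D P.totalTime (start w (learnProg P.p P.q P.C P.a) P.n P.k ⌈(P.k : ℝ) / η⌉₊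
          P.m)).toOuterMeasure {c | Outputs c secret} := by
      intro D
      obtain ⟨μ, hμ, h2⟩ := spec D secret
      rw [hμ _ le_rfl, PMF.toOuterMeasure_map_apply]
      exact h2
    have h2 : ∀ D : Data P.n P.m, iid (sample η hη secret) P.m D =
        ENNReal.ofReal (∏ i, weight hη secret (D i)) := by
      intro D
      rw [ENNReal.ofReal_prod_of_nonneg fun i _ => weight_nonneg hη secret _]
      change ∏ i, sample η hη secret (D i) = _
      exact Finset.prod_congr rfl fun i _ => (ENNReal.ofReal_toReal (PMF.apply_ne_top _ _)).symm
    have h3 : (9 / 10 : ℝ) ≤ ex (weight hη secret) P.m fun D => P.succ D secret P.iters .idle := by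
      have h4 := h secret hk
      have h5 := ex_add (μ := weight hη secret) (m := P.m)
        (fun D => 1 - P.succ D secret P.iters .idle) (fun D => P.succ D secret P.iters .idle)
      simp only [sub_add_cancel] at h5
      rw [ex_const (sum_weight hη secret)] at h5
      linarith
    rw [PMF.toOuterMeasure_bind_apply, tsum_fintype]
    calc (9 / 10 : ℝ≥0∞) = ENNReal.ofReal (9 / 10) := by
          rw [ENNReal.ofReal_div_of_pos (by norm_num)]; norm_num
      _ ≤ ENNReal.ofReal (ex (weight hη secret) P.m fun D => P.succ D secret P.iters .idle) :=
          ENNReal.ofReal_le_ofReal h3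
      _ = ∑ D : Data P.n P.m, ENNReal.ofReal (∏ i, weight hη secret (D i)) *
            ENNReal.ofReal (P.succ D secret P.iters .idle) := by
          have hw0 : ∀ D : Data P.n P.m, 0 ≤ ∏ i, weight hη secret (D i) := fun D =>
            Finset.prod_nonneg fun i _ => weight_nonneg hη secret _
          unfold ex
          rw [ENNReal.ofReal_sum_of_nonneg fun D _ =>
            mul_nonneg (hw0 D) (Par.succ_nonneg ..)]
          exact Finset.sum_congr rfl fun D _ => ENNReal.ofReal_mul (hw0 D)
      _ ≤ _ := by
          refine Finset.sum_le_sum fun D _ => ?_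
          rw [h2]
          gcongr
          exact h1 D

end Final

end LSPN

open LSPN

theorem theorem3p1 (η₀ : ℝ) (hη₀ : η₀ < 1 / 2) :
    ∃ (P : LSPN.Prog) (b c : ℕ) (A B : ℝ),
      ∀ (n k : ℕ) (η : ℝ) (hpos : 0 < η) (hle : η ≤ η₀), 1 ≤ k → (k : ℝ) / η < n →
        ∃ T : ℕ, (T : ℝ) ≤ ((k : ℝ) / η) ^ c * (A * (η * n / k)) ^ k ∧
          LSPN.Solves P (b * Nat.size n) n k η ⟨hpos.le, by linarith⟩
            ⌈B * ((k : ℝ) / η + k * Real.log (n / k))⌉₊ T (9 / 10) := by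
  -- a rational threshold between the noise rate and `1 / 2`; the maximum makes it positive
  obtain ⟨x, hx1, hx2⟩ := exists_rat_btwn (show max η₀ (1 / 4) < 1 / 2 from max_lt hη₀ (by norm_num))
  set η₁ := max η₀ (1 / 4) with hη₁
  have hη₁0 : 1 / 4 ≤ η₁ := le_max_right _ _
  obtain ⟨p, q, hq, hpq1, hpq2⟩ : ∃ p q : ℕ, 0 < q ∧ η₁ * q < p ∧ (p : ℝ) < 1 / 2 * q := by
    have hx0 : 0 < x := by
      have : (0 : ℝ) < x := by linarith
      exact_mod_cast this
    have hden : (0 : ℝ) < x.den := by exact_mod_cast x.den_pos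
    have hnum : ((x.num.toNat : ℕ) : ℝ) = x * x.den := by
      have h1 : ((x.num.toNat : ℕ) : ℤ) = x.num := Int.toNat_of_nonneg (Rat.num_pos.mpr hx0).le
      have h2 : ((x.num.toNat : ℕ) : ℝ) = (x.num : ℝ) := by exact_mod_cast h1
      rw [h2]
      exact_mod_cast (Rat.mul_den_eq_num x).symm
    exact ⟨x.num.toNat, x.den, x.den_pos, by rw [hnum]; gcongr, by rw [hnum]; gcongr⟩
  have hq' : (0 : ℝ) < q := by exact_mod_cast hq
  obtain ⟨t, ht, hρ1⟩ := exists_moment_lt_one (by linarith) (by linarith) hq' (by linarith) hpq1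
  -- The same estimate, with the roles of agreement and disagreement exchanged.
  obtain ⟨u, hu, hσ1⟩ := exists_moment_lt_one (μ := 1 / 2) (p := q - p) (by norm_num) (by norm_num)
    hq' (by have := Nat.cast_nonneg (α := ℝ) p; linarith) (by linarith)
  set ρ := (1 - η₁) * Real.exp (t * (0 - p)) + η₁ * Real.exp (t * (q - p)) with hρ
  set σ := (Real.exp (-u * (0 - p)) + Real.exp (-u * (q - p))) / 2 with hσ
  replace hσ1 : σ < 1 := by
    refine lt_of_eq_of_lt ?_ hσ1
    rw [hσ, show u * (0 - ((q : ℝ) - p)) = -u * (q - p) by ring,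
      show u * ((q : ℝ) - (q - p)) = -u * (0 - p) by ring]
    ring
  -- the tests seldom reject the secret
  obtain ⟨C, hC⟩ : ∃ C : ℕ, Real.exp (-t * C) * (1 / (1 - ρ)) ≤ 1 / 100 := by
    obtain ⟨C, hC⟩ := exists_nat_ge (100 * (1 / (1 - ρ)) / t)
    refine ⟨C, ?_⟩
    rw [div_le_iff₀ ht] at hC
    have h1 := Real.add_one_le_exp (t * C)
    rw [neg_mul, Real.exp_neg, inv_mul_le_iff₀ (Real.exp_pos _)]
    linarith
  -- the tests reject wrong vectors reliably enough
  obtain ⟨B, hB⟩ := exists_nat_ge (300 + (u * C + 406) / (-Real.log σ))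
  -- there are enough iterations
  obtain ⟨a, ha⟩ := exists_nat_ge
    (max (100 * ((2 + Real.exp (u * C) / (1 - σ)) * (2 * Real.exp 192))) (400 * (B + 1 : ℝ)))
  have ha1 := (le_max_left _ _).trans ha
  have ha2 := (le_max_right _ _).trans ha
  have ha0 : 0 < a := by
    have : (0 : ℝ) < a := by have := Nat.cast_nonneg (α := ℝ) B; linarith
    exact_mod_cast this
  have hσ0 : 0 < σ := by positivity
  have hB' : (300 : ℝ) < B := by
    have : 0 < -Real.log σ := neg_pos.mpr (Real.log_neg hσ0 hσ1)
    have : 0 < (u * C + 406) / (-Real.log σ) := by positivity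
    linarith
  set H := 4 * (B + 1) + a + p + q + C + 300 with hH
  refine ⟨learnProg p q C a, 2 + Nat.size (64 * (H * H)), 23, a, B, fun n k η hpos hle hk hn => ?_⟩
  let P : Par := ⟨n, ⌈B * ((k : ℝ) / η + k * Real.log (n / k))⌉₊, k, ⌈(k : ℝ) / η⌉₊, p, q, C, a⟩
  have hle1 : η ≤ η₁ := hle.trans (le_max_left _ _)
  have hη : η ∈ Set.Icc (0 : ℝ) 1 := ⟨hpos.le, by linarith⟩
  have V : P.Valid η := ⟨hk, hpos, by linarith, rfl, hn⟩
  have hm : P.m = ⌈B * P.L η⌉₊ := rfl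
  have hm1 := V.m1_lt hm hB'
  have : NeZero P.m1 := ⟨Nat.mul_ne_zero (by norm_num) V.s_pos.ne'⟩
  refine ⟨P.totalTime, V.time_le ha0, solves_of_ex_le V hη
    (fits_of_X_le (V.X_le hm) (V.s_pos.trans_le V.s_le_n)) ha0 hm1 fun s hs =>
    ex_failure_le_tenth hη V s hs ht.le (ρ := ρ) ?_ hρ1 hu.le (σ := σ) le_rfl hσ1 hm hC hB ha1 ha2⟩
  exact mix_le_mix hle1 (Real.exp_le_exp.mpr (mul_le_mul_of_nonneg_left (by linarith) ht.le))
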